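/- **Theorem 3.4 (Pochhammer principle).** Let $\Sigma$ be a compact connected surface, possibly with boundary, with base point $x_0$. Put $A := H_1(\Sigma;\mathbb Z)/\mathrm{torsion}$ (so $A = H_1(\Sigma;\mathbb Z)=\pi_1(\Sigma,x_0)^{\mathrm{ab}}$ if $\Sigma$ is orientable), let $\alpha:\pi_1(\Sigma,x_0)\to A$ be the Hurewicz map, and let $\mathbb F := \mathrm{Quot}(\mathbb Z[A])$. Let $p:\tilde\Sigma\to\Sigma$ be the $\alpha$-cover (Hurewicz cover), i.e. the principal $A$-covering with monodromy $\alpha$. For a continuous map $h:Y\to\Sigma$, let $\tilde Y := h^*\tilde\Sigma$ be the pulled-back cover and put $$\mathcal H^\alpha_1(Y) := H_1\bigl(C_*(\tilde Y)\otimes_{\mathbb Z[A]}\mathbb F\bigr),$$ where $C_*$ denotes integral singular chains. A *pair of pants* in $\Sigma$ is the image $P$ of the open standard pair of pants (a $2$-sphere minus three disjoint closed discs) under a continuous map from the closed standard pair of pants to $\Sigma$ that is an open embedding on the open one and injective on each of the three boundary circles, the images of two different boundary circles being disjoint or equal; these images are the *boundary circles* of $P$. It is *fashionable* if every boundary circle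 has nonzero class in $A$ (for orientable $\Sigma$: nonzero class in $H_1(\Sigma;\mathbb Z)$). Let $P\subset\Sigma$ be a fashionable pair of pants, and let $f:S^1\to P$ be a loop that is freely homotopic, in the closed pair of pants, to a commutator $aba^{-1}b^{-1}$, where $a,b$ are loops with a common base point that are freely homotopic to two different boundary circles. Then: 1. $\mathcal H^\alpha_1(S^1)\cong\mathbb F$; 2. $f_*:\mathcal H^\alpha_1(S^1)\to\mathcal H^\alpha_1(P)$ is an isomorphism; 3. $f_*:\mathcal H^\alpha_1(S^1)\to\mathcal H^\alpha_1(\Sigma)$ is injective, and its image is the image of $\mathcal H^\alpha_1(P)\to\mathcal H^\alpha_1(\Sigma)$. -/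

import Mathlib

open scoped TensorProduct

noncomputable section

/-! ### The Hurewicz map -/

/-- `H₁(X; ℤ)` modulo torsion, where `H₁(X; ℤ)` is the abelianization of `π₁(X, x)`.
It is written multiplicatively.  For a compact orientable surface the torsion is trivial, and this
group is `H₁(X; ℤ)` itself. -/
abbrev FreeH1 (X : Type*) [TopologicalSpace X] (x : X) : Type _ :=
  Abelianization (FundamentalGroup X x) ⧸
    CommGroup.torsion (Abelianization (FundamentalGroup X x))

/-- The Hurewicz map `π₁(X, x) → H₁(X; ℤ)`, modulo torsion. -/
def hurewicz (X : Type*) [TopologicalSpace X] (x : X) : FundamentalGroup X x →* FreeH1 X x :=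
  (QuotientGroup.mk' _).comp Abelianization.of

/-- The element of the fundamental group represented by a based loop. -/
def loopClass {X : Type*} [TopologicalSpace X] {x : X} (γ : Path x x) : FundamentalGroup X x :=
  FundamentalGroup.fromPath (Path.Homotopic.Quotient.mk γ)

/-! ### The `α`-cover and its restrictions -/

/-- The `α`-cover of `X` for a homomorphism `α : π₁(X, x₀) → A` to an abelian group: the principal
`A`-covering (a covering map which is the quotient by a free, properly discontinuous action of `A`)
with monodromy `α`, i.e. every lift of a loop `γ` at `x₀` ends at the `α [γ]`-translate of the point
where it starts.  (This determines the cover up to `A`-equivariant isomorphism over `X` when `X` is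
a connected manifold.) -/
structure AlphaCover.{u, v, w} {X : Type u} [TopologicalSpace X] {x₀ : X} {A : Type v} [CommGroup A]
    (α : FundamentalGroup X x₀ →* A) where
  /-- the covering space -/
  Total : Type w
  [topology : TopologicalSpace Total]
  [action : MulAction A Total]
  /-- the covering projection -/
  proj : Total → X
  isQuotientCoveringMap : IsQuotientCoveringMap proj A
  monodromy : ∀ (γ : Path x₀ x₀) (Γ : C(unitInterval, Total)),
    (∀ t, proj (Γ t) = γ t) → Γ 1 = α (loopClass γ) • Γ 0

namespace AlphaCover

attribute [instance] AlphaCover.topology AlphaCover.action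

variable {X A : Type*} [TopologicalSpace X] {x₀ : X} [CommGroup A]
  {α : FundamentalGroup X x₀ →* A} (c : AlphaCover α)

instance : ContinuousConstSMul A c.Total := c.isQuotientCoveringMap.toContinuousConstSMul

/-- The restriction of the `α`-cover along a continuous map `f : Y → X`, i.e. its pull-back.  This
is the cover of `Y` associated with `α ∘ π₁(f)`. -/
def Restrict {Y : Type*} [TopologicalSpace Y] (f : C(Y, X)) : Type _ :=
  {q : Y × c.Total // f q.1 = c.proj q.2}

section Restrict

variable {Y Z : Type*} [TopologicalSpace Y] [TopologicalSpace Z] (f : C(Y, X)) (g : C(Z, Y))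

instance : TopologicalSpace (c.Restrict f) :=
  inferInstanceAs (TopologicalSpace {q : Y × c.Total // f q.1 = c.proj q.2})

/-- `A` acts on the pull-back through the second factor. -/
instance : MulAction A (c.Restrict f) where
  smul a q := ⟨(q.1.1, a • q.1.2), by rw [c.isQuotientCoveringMap.map_smul]; exact q.2⟩
  one_smul q := Subtype.ext (Prod.ext rfl (one_smul A q.1.2))
  mul_smul a b q := Subtype.ext (Prod.ext rfl (mul_smul a b q.1.2))

instance : ContinuousConstSMul A (c.Restrict f) where
  continuous_const_smul a := Continuous.subtype_mk
    ((continuous_fst.comp continuous_subtype_val).prodMk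
      ((continuous_snd.comp continuous_subtype_val).const_smul a)) _

/-- The map of covers `f^* X̃ → X̃` over `f : Y → X`. -/
def restrictProj : C(c.Restrict f, c.Total) :=
  ⟨fun q => q.1.2, continuous_snd.comp continuous_subtype_val⟩

theorem restrictProj_smul (a : A) (q : c.Restrict f) :
    c.restrictProj f (a • q) = a • c.restrictProj f q := rfl

/-- The map of covers `(f ∘ g)^* X̃ → f^* X̃` over `g : Z → Y`. -/
def restrictComp : C(c.Restrict (f.comp g), c.Restrict f) :=
  ⟨fun q => ⟨(g q.1.1, q.1.2), q.2⟩, Continuous.subtype_mk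
    ((g.continuous.comp (continuous_fst.comp continuous_subtype_val)).prodMk
      (continuous_snd.comp continuous_subtype_val)) _⟩

theorem restrictComp_smul (a : A) (q : c.Restrict (f.comp g)) :
    c.restrictComp f g (a • q) = a • c.restrictComp f g q := rfl

end Restrict

end AlphaCover

/-! ### Twisted homology -/

/-- `𝔽 = Quot(ℤ[A])`; it is a field when `A` is torsion-free. -/
def QuotField (A : Type*) [CommGroup A] : Type _ := FractionRing (MonoidAlgebra ℤ A)

instance (A : Type*) [CommGroup A] : CommRing (QuotField A) :=
  inferInstanceAs (CommRing (FractionRing (MonoidAlgebra ℤ A)))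

instance (A : Type*) [CommGroup A] : Algebra (MonoidAlgebra ℤ A) (QuotField A) :=
  inferInstanceAs (Algebra (MonoidAlgebra ℤ A) (FractionRing (MonoidAlgebra ℤ A)))

instance (A : Type*) [CommGroup A] : IsFractionRing (MonoidAlgebra ℤ A) (QuotField A) :=
  inferInstanceAs (IsFractionRing (MonoidAlgebra ℤ A) (FractionRing (MonoidAlgebra ℤ A)))

/-- The `i`-th face inclusion `Δⁿ → Δⁿ⁺¹`. -/
def simplexFace (n : ℕ) (i : Fin (n + 2)) :
    C(stdSimplex ℝ (Fin (n + 1)), stdSimplex ℝ (Fin (n + 2))) :=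
  ⟨stdSimplex.map i.succAbove, stdSimplex.continuous_map _⟩

section Chains

/-- The integral singular `n`-chains of `E`: the free abelian group on the singular simplices
`Δⁿ → E`. -/
def SingularChains (E : Type*) [TopologicalSpace E] (n : ℕ) : Type _ := C(stdSimplex ℝ (Fin (n + 1)), E) →₀ ℤ

instance (E : Type*) [TopologicalSpace E] (n : ℕ) : AddCommGroup (SingularChains E n) :=
  inferInstanceAs (AddCommGroup (C(stdSimplex ℝ (Fin (n + 1)), E) →₀ ℤ))

variable {E E₁ : Type*} [TopologicalSpace E] [TopologicalSpace E₁]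

/-- The chain `k • σ`. -/
def SingularChains.single {n : ℕ} (σ : C(stdSimplex ℝ (Fin (n + 1)), E)) (k : ℤ) :
    SingularChains E n := Finsupp.single σ k

theorem SingularChains.induction {n : ℕ} {p : SingularChains E n → Prop}
    (v : SingularChains E n) (h0 : p 0) (hadd : ∀ v w, p v → p w → p (v + w))
    (h1 : ∀ σ k, p (SingularChains.single σ k)) : p v :=
  Finsupp.induction_linear v h0 hadd h1

/-- The `ℤ`-linear map of chains given on simplices by `u`. -/
def SingularChains.mapSimplices {m n : ℕ}
    (u : C(stdSimplex ℝ (Fin (m + 1)), E) → C(stdSimplex ℝ (Fin (n + 1)), E₁)) :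
    SingularChains E m →ₗ[ℤ] SingularChains E₁ n :=
  (Finsupp.mapDomain.addMonoidHom (M := ℤ) u : SingularChains E m →+ SingularChains E₁ n).toIntLinearMap

theorem SingularChains.mapSimplices_single {m n : ℕ}
    (u : C(stdSimplex ℝ (Fin (m + 1)), E) → C(stdSimplex ℝ (Fin (n + 1)), E₁)) (σ) (k : ℤ) :
    SingularChains.mapSimplices u (SingularChains.single σ k) = SingularChains.single (u σ) k :=
  Finsupp.mapDomain_single

end Chains

section Twisted

variable (A : Type*) [CommGroup A]
variable (E : Type*) [TopologicalSpace E] [MulAction A E] [ContinuousConstSMul A E]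
variable {E₁ : Type*} [TopologicalSpace E₁] [MulAction A E₁] [ContinuousConstSMul A E₁]
variable {E₂ : Type*} [TopologicalSpace E₂] [MulAction A E₂] [ContinuousConstSMul A E₂]

/-- The action of `A` on singular chains by translating simplices. -/
def singularRep (n : ℕ) : A →* Module.End ℤ (SingularChains E n) where
  toFun a := SingularChains.mapSimplices (fun σ => a • σ)
  map_one' := LinearMap.ext fun v => by
    induction v using SingularChains.induction with
    | h0 => simp
    | hadd v w hv hw => simp only [map_add, hv, hw]
    | h1 σ k => rw [SingularChains.mapSimplices_single, one_smul]; rfl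
  map_mul' a b := LinearMap.ext fun v => by
    induction v using SingularChains.induction with
    | h0 => simp
    | hadd v w hv hw => simp only [map_add, hv, hw]
    | h1 σ k =>
      rw [Module.End.mul_apply]
      simp only [SingularChains.mapSimplices_single, mul_smul]

/-- Singular chains form a module over `ℤ[A]`. -/
instance (n : ℕ) : Module (MonoidAlgebra ℤ A) (SingularChains E n) :=
  Module.compHom _ (MonoidAlgebra.lift ℤ _ A (singularRep A E n)).toRingHom

theorem singularChains_single_smul (n : ℕ) (a : A) (v : SingularChains E n) :
    (MonoidAlgebra.single a (1 : ℤ)) • v = singularRep A E n a v := by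
  change (MonoidAlgebra.lift ℤ _ A (singularRep A E n)) (MonoidAlgebra.single a 1) v = _
  rw [MonoidAlgebra.lift_single, one_smul]

/-- The singular boundary `∂ σ = ∑ᵢ (-1)ⁱ σ ∘ dᵢ` on integral chains. -/
def singularBoundaryInt (n : ℕ) : SingularChains E (n + 1) →ₗ[ℤ] SingularChains E n :=
  ∑ i : Fin (n + 2), (-1 : ℤ) ^ (i : ℕ) •
    SingularChains.mapSimplices (fun σ : C(stdSimplex ℝ (Fin (n + 2)), E) =>
      σ.comp (simplexFace n i))

variable {E} in
theorem singularBoundaryInt_rep (n : ℕ) (a : A) (v : SingularChains E (n + 1)) :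
    singularBoundaryInt E n (singularRep A E (n + 1) a v) =
      singularRep A E n a (singularBoundaryInt E n v) := by
  induction v using SingularChains.induction with
  | h0 => simp
  | hadd v w hv hw => simp only [map_add, hv, hw]
  | h1 σ k =>
    simp only [singularBoundaryInt, LinearMap.sum_apply, LinearMap.smul_apply, map_sum, map_smul,
      singularRep, MonoidHom.coe_mk, OneHom.coe_mk, SingularChains.mapSimplices_single]
    rfl

/-- The singular boundary, as a map of `ℤ[A]`-modules. -/
def singularBoundary (n : ℕ) :
    SingularChains E (n + 1) →ₗ[MonoidAlgebra ℤ A] SingularChains E n :=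
  MonoidAlgebra.equivariantOfLinearOfComm (singularBoundaryInt E n) (fun a v => by
    rw [singularChains_single_smul, singularChains_single_smul, singularBoundaryInt_rep])

/-- The `n`-chains `𝔽 ⊗_{ℤ[A]} C_n(E)`. -/
def TwistedChains (n : ℕ) : Type _ := QuotField A ⊗[MonoidAlgebra ℤ A] SingularChains E n

instance (n : ℕ) : AddCommGroup (TwistedChains A E n) :=
  inferInstanceAs (AddCommGroup (QuotField A ⊗[MonoidAlgebra ℤ A] SingularChains E n))

instance (n : ℕ) : Module (QuotField A) (TwistedChains A E n) :=
  inferInstanceAs (Module (QuotField A) (QuotField A ⊗[MonoidAlgebra ℤ A] SingularChains E n))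

/-- The boundary of the complex `𝔽 ⊗_{ℤ[A]} C_*(E)`. -/
def twistedBoundary (n : ℕ) :
    TwistedChains A E (n + 1) →ₗ[QuotField A]
      TwistedChains A E n :=
  (singularBoundary A E n).baseChange (QuotField A)

/-- The `1`-cycles of `𝔽 ⊗_{ℤ[A]} C_*(E)`. -/
abbrev twistedCycles1 :
    Submodule (QuotField A) (TwistedChains A E 1) :=
  LinearMap.ker (twistedBoundary A E 0)

/-- The twisted homology group `H₁(𝔽 ⊗_{ℤ[A]} C_*(E))` of a space `E` with an action of `A`; when
`E` is the `α`-cover of `X`, this is the `α`-twisted homology `ℋ₁^α(X)`. -/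
abbrev TwistedH1 : Type _ :=
  twistedCycles1 A E ⧸ (LinearMap.range (twistedBoundary A E 1)).submoduleOf (twistedCycles1 A E)

variable {A}
variable (φ : C(E₁, E₂)) (hφ : ∀ (a : A) (e : E₁), φ (a • e) = a • φ e)

/-- The map `σ ↦ φ ∘ σ` on singular chains, for an `A`-equivariant map `φ`. -/
def chainMap (n : ℕ) : SingularChains E₁ n →ₗ[MonoidAlgebra ℤ A] SingularChains E₂ n :=
  MonoidAlgebra.equivariantOfLinearOfComm (SingularChains.mapSimplices (fun σ => φ.comp σ))
    (fun a v => by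
      rw [singularChains_single_smul, singularChains_single_smul]
      induction v using SingularChains.induction with
      | h0 => simp
      | hadd v w hv hw => simp only [map_add, hv, hw]
      | h1 σ k =>
        simp only [singularRep, MonoidHom.coe_mk, OneHom.coe_mk,
          SingularChains.mapSimplices_single]
        congr 1
        ext t
        exact hφ a (σ t))

theorem chainMap_boundary (n : ℕ) :
    (singularBoundary A E₂ n).comp (chainMap φ hφ (n + 1)) =
      (chainMap φ hφ n).comp (singularBoundary A E₁ n) := by
  refine LinearMap.ext fun v => ?_
  change singularBoundaryInt E₂ n (SingularChains.mapSimplices (fun σ => φ.comp σ) v) =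
    SingularChains.mapSimplices (fun σ => φ.comp σ) (singularBoundaryInt E₁ n v)
  induction v using SingularChains.induction with
  | h0 => simp
  | hadd v w hv hw => simp only [map_add, hv, hw]
  | h1 σ k =>
    simp only [singularBoundaryInt, LinearMap.sum_apply, LinearMap.smul_apply, map_sum, map_smul,
      SingularChains.mapSimplices_single]
    rfl

/-- The map on `𝔽 ⊗_{ℤ[A]} C_*`. -/
def twistedChainMap (n : ℕ) :
    TwistedChains A E₁ n →ₗ[QuotField A]
      TwistedChains A E₂ n :=
  (chainMap φ hφ n).baseChange (QuotField A)

theorem twistedChainMap_boundary (n : ℕ)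
    (v : TwistedChains A E₁ (n + 1)) :
    twistedBoundary A E₂ n (twistedChainMap φ hφ (n + 1) v) =
      twistedChainMap φ hφ n (twistedBoundary A E₁ n v) := by
  change ((LinearMap.baseChange (QuotField A) (singularBoundary A E₂ n)).comp
      (LinearMap.baseChange (QuotField A) (chainMap φ hφ (n + 1)))) v =
    ((LinearMap.baseChange (QuotField A) (chainMap φ hφ n)).comp
      (LinearMap.baseChange (QuotField A) (singularBoundary A E₁ n))) v
  rw [← LinearMap.baseChange_comp, ← LinearMap.baseChange_comp, chainMap_boundary]

theorem twistedChainMap_mem_cycles (z) (hz : z ∈ twistedCycles1 A E₁) :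
    twistedChainMap φ hφ 1 z ∈ twistedCycles1 A E₂ := by
  rw [LinearMap.mem_ker] at hz ⊢
  rw [twistedChainMap_boundary, hz, map_zero]

/-- The `𝔽`-linear map induced on twisted homology by an `A`-equivariant continuous map. -/
def TwistedH1.map : TwistedH1 A E₁ →ₗ[QuotField A] TwistedH1 A E₂ :=
  Submodule.mapQ _ _ ((twistedChainMap φ hφ 1).restrict (twistedChainMap_mem_cycles φ hφ)) (by
    rintro ⟨z, hz⟩ ⟨w, hw⟩
    exact ⟨twistedChainMap φ hφ 2 w, by
      rw [twistedChainMap_boundary, hw]; rfl⟩)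

end Twisted

namespace AlphaCover

variable {X A : Type*} [TopologicalSpace X] {x₀ : X} [CommGroup A]
  {α : FundamentalGroup X x₀ →* A} (c : AlphaCover α)
  {Y Z : Type*} [TopologicalSpace Y] [TopologicalSpace Z]

/-- `ℋ₁^α(Y)` for a space `Y` mapping to `X` by `f`, where `α` is restricted along `f`. -/
abbrev H1 (f : C(Y, X)) : Type _ := TwistedH1 A (c.Restrict f)

/-- `g_* : ℋ₁^α(Z) → ℋ₁^α(Y)` for a map `g : Z → Y` of spaces over `X`. -/
def mapH1 (f : C(Y, X)) (g : C(Z, Y)) :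
    c.H1 (f.comp g) →ₗ[QuotField A] c.H1 f :=
  TwistedH1.map (c.restrictComp f g) (c.restrictComp_smul f g)

/-- `f_* : ℋ₁^α(Y) → ℋ₁^α(X)` for a map `f : Y → X`. -/
def toBaseH1 (f : C(Y, X)) : c.H1 f →ₗ[QuotField A] TwistedH1 A c.Total :=
  TwistedH1.map (c.restrictProj f) (c.restrictProj_smul f)

end AlphaCover

/-! ### Pairs of pants -/

/-- The standard closed pair of pants: the closed disc of radius `4` about `0` minus the open unit
discs about `2` and `-2`. -/
abbrev ClosedPants : Type :=
  {z : ℂ // ‖z‖ ≤ 4 ∧ 1 ≤ ‖z - 2‖ ∧ 1 ≤ ‖z + 2‖}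

namespace ClosedPants

/-- The open pair of pants: a `2`-sphere minus three disjoint closed discs. -/
def interior : Set ClosedPants := {z | ‖z.1‖ < 4 ∧ 1 < ‖z.1 - 2‖ ∧ 1 < ‖z.1 + 2‖}

/-- Centres of the three boundary circles. -/
def center : Fin 3 → ℂ := ![0, 2, -2]

/-- Radii of the three boundary circles. -/
def radius : Fin 3 → ℝ := ![4, 1, 1]

theorem boundary_mem (k : Fin 3) (z : Circle) :
    ‖center k + radius k * (z : ℂ)‖ ≤ 4 ∧ 1 ≤ ‖center k + radius k * (z : ℂ) - 2‖ ∧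
      1 ≤ ‖center k + radius k * (z : ℂ) + 2‖ := by
  have hz : ‖(z : ℂ)‖ = 1 := Circle.norm_coe z
  have h2 : ‖(2 : ℂ)‖ = 2 := by simp
  have h4 : ‖(4 : ℂ)‖ = 4 := by simp
  have h4z : ‖(4 : ℂ) * z‖ = 4 := by simp [hz]
  fin_cases k
  · refine ⟨by simp [center, radius, hz], ?_, ?_⟩
    · have := norm_sub_norm_le ((4 : ℂ) * z) 2
      simp only [center, radius, Fin.zero_eta, Matrix.cons_val_zero, zero_add]
      push_cast; linarith
    · have := norm_sub_norm_le ((4 : ℂ) * z) (-2)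
      rw [norm_neg, sub_neg_eq_add] at this
      simp only [center, radius, Fin.zero_eta, Matrix.cons_val_zero, zero_add]
      push_cast; linarith
  · simp only [center, radius, Fin.mk_one, Matrix.cons_val_one, Matrix.cons_val_zero,
      Complex.ofReal_one, one_mul]
    refine ⟨?_, ?_, ?_⟩
    · have := norm_add_le (2 : ℂ) z
      linarith
    · rw [add_sub_cancel_left, hz]
    · have := norm_sub_norm_le (4 : ℂ) (-(z : ℂ))
      rw [norm_neg, sub_neg_eq_add] at this
      rw [show (2 : ℂ) + z + 2 = 4 + z by ring]
      linarith
  · simp only [center, radius, Fin.reduceFinMk, Matrix.cons_val,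
      Complex.ofReal_one, one_mul]
    refine ⟨?_, ?_, ?_⟩
    · have := norm_add_le (-2 : ℂ) z
      rw [norm_neg] at this
      linarith
    · have := norm_sub_norm_le (4 : ℂ) (z : ℂ)
      rw [show (-2 : ℂ) + z - 2 = -(4 - z) by ring, norm_neg]
      linarith
    · rw [show (-2 : ℂ) + z + 2 = z by ring, hz]

/-- The three boundary circles `z ↦ c_k + r_k z`. -/
def boundaryCircle (k : Fin 3) : C(Circle, ClosedPants) :=
  ⟨fun z => ⟨center k + radius k * (z : ℂ), boundary_mem k z⟩, by
    refine Continuous.subtype_mk ?_ _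
    fun_prop⟩

end ClosedPants

/-- A pair of pants in `S`, together with a parametrization: a continuous map from the standard
closed pair of pants which is an open embedding on the open pair of pants and injective on each
boundary circle, the images of two different boundary circles being disjoint or equal. -/
structure PairOfPants (S : Type*) [TopologicalSpace S] where
  /-- the parametrization -/
  toMap : C(ClosedPants, S)
  isOpenEmbedding : Topology.IsOpenEmbedding (fun z : ClosedPants.interior => toMap z.1)
  boundary_injective : ∀ k, Function.Injective (toMap.comp (ClosedPants.boundaryCircle k))
  boundary_disjoint_or_eq : ∀ j k,
    Disjoint (Set.range (toMap.comp (ClosedPants.boundaryCircle j)))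
        (Set.range (toMap.comp (ClosedPants.boundaryCircle k))) ∨
      Set.range (toMap.comp (ClosedPants.boundaryCircle j)) =
        Set.range (toMap.comp (ClosedPants.boundaryCircle k))

namespace PairOfPants

variable {S : Type*} [TopologicalSpace S] (P : PairOfPants S)

/-- The (open) pair of pants as a subset of `S`. -/
def carrier : Set S := P.toMap '' ClosedPants.interior

/-- The inclusion of the open pair of pants. -/
def incl : C(P.carrier, S) := ⟨Subtype.val, continuous_subtype_val⟩

end PairOfPants

/-! ### Loops -/

/-- The loop `c : S¹ → X` is the closed path `γ`, run through as `t ↦ c (exp (2πit))`. -/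
def IsLoopOf {X : Type*} [TopologicalSpace X] {x : X} (c : C(Circle, X)) (γ : Path x x) : Prop :=
  ∀ t : unitInterval, c (Circle.exp (2 * Real.pi * (t : ℝ))) = γ t

/-- The loop `c` in `S` is nontrivial in `H₁(S; ℤ)` modulo torsion: joining it to the base point
by a path, one gets an element of `π₁(S, x₀)` with nontrivial image. -/
def HomologicallyNontrivial {S : Type*} [TopologicalSpace S] (x₀ : S) (c : C(Circle, S)) : Prop :=
  ∃ (x : S) (γ : Path x x) (p : Path x₀ x), IsLoopOf c γ ∧
    hurewicz S x₀ (loopClass (p.trans (γ.trans p.symm))) ≠ 1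

/-- The pair of pants is fashionable: all its boundary circles are homologically nontrivial
in `S`. -/
def PairOfPants.Fashionable {S : Type*} [TopologicalSpace S] (P : PairOfPants S) (x₀ : S) : Prop :=
  ∀ k, HomologicallyNontrivial x₀ (P.toMap.comp (ClosedPants.boundaryCircle k))

/-- The loop `g` is freely homotopic to the commutator `a b a⁻¹ b⁻¹` of two loops `a`, `b` with a
common base point which are freely homotopic to `c₁` and `c₂`. -/
def HomotopicToCommutator {X : Type*} [TopologicalSpace X] (g c₁ c₂ : C(Circle, X)) : Prop :=
  ∃ (x : X) (a b : Path x x) (a₁ b₁ g₁ : C(Circle, X)),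
    IsLoopOf a₁ a ∧ IsLoopOf b₁ b ∧ IsLoopOf g₁ (a.trans (b.trans (a.symm.trans b.symm))) ∧
    a₁.Homotopic c₁ ∧ b₁.Homotopic c₂ ∧ g.Homotopic g₁

/-- A curve `f : S¹ → P` is homotopic, in the closed pair of pants, to the commutator of two
(different) boundary circles.  The closed pair of pants is used since the boundary circles do not
lie in `P`; `g` is `f` read in the parametrization of `P`. -/
def PairOfPants.IsCommutatorOfBoundary {S : Type*} [TopologicalSpace S] (P : PairOfPants S)
    (f : C(Circle, P.carrier)) : Prop :=
  ∃ g : C(Circle, ClosedPants),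
    (∀ z, g z ∈ ClosedPants.interior ∧ P.toMap (g z) = (f z : S)) ∧
    ∃ j k : Fin 3, j ≠ k ∧
      HomotopicToCommutator g (ClosedPants.boundaryCircle j) (ClosedPants.boundaryCircle k)

end

/-!
The proof is by duality.  A functional on the twisted `1`-chains of a space `E` with an action of
`A` that kills boundaries is the same as an `𝔽`-valued equivariant cocycle: a function `θ` on the
paths of `E` which is additive on singular triangles (`IsCocycleOn`) and satisfies
`θ (a • σ) = a θ(σ)`.  It vanishes on cycles if `θ` is exact, i.e. the increment of an equivariant
function on `E`.  Hence `ℋ₁^α` is at most one-dimensional as soon as a single linear condition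
forces equivariant cocycles to be exact (`exists_smul_eq_of_exact`), and the class of a closed path
is nonzero as soon as some equivariant cocycle does not vanish on it (`loopH1_ne_zero`).

Upper bounds.  For a circle with trivial monodromy, the condition is that `θ` vanishes on a closed
lift (`IsPrincipal.exists_potential_of_circle`).  For the pair of pants, the basic fact is
`IsPrincipal.exists_potential_of_loops`: where a loop with monodromy `a ≠ 1` can be attached
continuously to each point, `(a - 1)⁻¹` times the value of `θ` on the lift of this loop is a
potential of `θ`.  This applies to the two overlapping halves of the open pants around the two
inner boundary circles, and `θ` is exact if the two potentials agree at one point over the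
connected intersection (`ClosedPants.exists_exactness_condition`).

Nonvanishing.  It remains to find an equivariant cocycle over the whole surface which does not
vanish on the lifts of `f`; these are closed, `f` being homotopic to a commutator.  On the closed
pants, the cocycle with values in `ℤ[A]` dual to an arc from an inner boundary circle to the outer
one vanishes on the other inner circle, and takes the value of a unit `-a` of augmentation `-1` on
each of the two circles at which the arc ends.  By the Fox formula for `a b a⁻¹ b⁻¹`
(`IsPrincipal.cocycle_commutator`), the nontriviality of the boundary circles and a look at
augmentations, its value on the commutator is nonzero (`ClosedPants.exists_cocycle_commutator`).
As the boundary circles are nontrivial, the cocycle is exact on collars by the loops of rotations;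
subtracting this potential makes it vanish there, without changing its values on closed paths, and
it extends by zero to the surface (`AlphaCover.exists_extension_by_zero`).

Thus the class of the lift of `f` is nonzero in the surface, so it spans `ℋ₁^α(S¹)` and `ℋ₁^α(P)`,
and all assertions follow.

Cocycles are used instead of singular homology with excision because they can be glued
(`exists_glued_cocycle`) without subdivision: a path or a singular triangle is a map on a
contractible space, over which local potentials glue.
-/

noncomputable section

local notation "I" => unitInterval

/-! ### Cocycles on paths -/

/-- The straight path from `p` to `q`, as a continuous map on the unit interval. -/
def segMap {V : Type*} [NormedAddCommGroup V] [NormedSpace ℝ V] (p q : V) : C(I, V) :=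
  ⟨fun t => (1 - (t : ℝ)) • p + (t : ℝ) • q, by fun_prop⟩

theorem segMap_mem {V : Type*} [NormedAddCommGroup V] [NormedSpace ℝ V] {s : Set V}
    (hs : Convex ℝ s) {p q : V} (hp : p ∈ s) (hq : q ∈ s) (t : I) : segMap p q t ∈ s :=
  hs hp hq (sub_nonneg.2 t.2.2) t.2.1 (sub_add_cancel _ _)

/-- The edge from the `i`-th to the `j`-th vertex of the standard triangle. -/
def triangleEdge (i j : Fin 3) : C(I, stdSimplex ℝ (Fin 3)) :=
  ⟨fun t => ⟨segMap (V := Fin 3 → ℝ) (Pi.single i 1) (Pi.single j 1) t,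
    segMap_mem (convex_stdSimplex ℝ (Fin 3)) (single_mem_stdSimplex ℝ i)
      (single_mem_stdSimplex ℝ j) t⟩, Continuous.subtype_mk (ContinuousMap.continuous _) _⟩

/-- A function `θ` on the paths of `E` is a cocycle on `W ⊆ E` if it is additive on the boundary
of every singular triangle in `W`.  The values of `θ` on paths which leave `W` are irrelevant. -/
def IsCocycleOn {E M : Type*} [TopologicalSpace E] [AddCommGroup M] (W : Set E)
    (θ : C(I, E) → M) : Prop :=
  ∀ h : C(stdSimplex ℝ (Fin 3), E), (∀ x, h x ∈ W) →
    θ (h.comp (triangleEdge 0 1)) + θ (h.comp (triangleEdge 1 2)) =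
      θ (h.comp (triangleEdge 0 2))

section Cocycle

variable {E M : Type*} [TopologicalSpace E] [AddCommGroup M] {W : Set E} {θ : C(I, E) → M}
variable {V : Type*} [NormedAddCommGroup V] [NormedSpace ℝ V]

/-- The affine triangle with vertices `v 0`, `v 1`, `v 2`. -/
def affineTriangle (v : Fin 3 → V) : C(stdSimplex ℝ (Fin 3), V) :=
  ⟨fun x => ∑ i, x.1 i • v i, by
    refine continuous_finsetSum _ fun i _ => ?_
    exact ((continuous_apply i).comp continuous_subtype_val).smul continuous_const⟩

theorem affineTriangle_comp_triangleEdge (v : Fin 3 → V) (i j : Fin 3) :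
    (affineTriangle v).comp (triangleEdge i j) = segMap (v i) (v j) := by
  ext t
  simp only [affineTriangle, triangleEdge, segMap, ContinuousMap.comp_apply,
    ContinuousMap.coe_mk, Pi.add_apply, Pi.smul_apply, add_smul,
    Finset.sum_add_distrib, smul_eq_mul, mul_smul, ← Finset.smul_sum]
  simp [Pi.single_apply, ite_smul]

theorem affineTriangle_mem {s : Set V} (hs : Convex ℝ s) {v : Fin 3 → V} (hv : ∀ i, v i ∈ s)
    (x : stdSimplex ℝ (Fin 3)) : affineTriangle v x ∈ s :=
  hs.sum_mem (fun i _ => x.2.1 i) x.2.2 fun i _ => hv i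

theorem IsCocycleOn.add_of_convex (hθ : IsCocycleOn W θ) (h : C(V, E)) {s : Set V}
    (hs : Convex ℝ s) (hsW : ∀ x ∈ s, h x ∈ W) {p q r : V} (hp : p ∈ s) (hq : q ∈ s)
    (hr : r ∈ s) :
    θ (h.comp (segMap p q)) + θ (h.comp (segMap q r)) = θ (h.comp (segMap p r)) := by
  have hv : ∀ i, (![p, q, r] : Fin 3 → V) i ∈ s := by
    intro i; fin_cases i <;> assumption
  have := hθ (h.comp (affineTriangle ![p, q, r])) fun x => hsW _ (affineTriangle_mem hs hv x)
  simp only [ContinuousMap.comp_assoc, affineTriangle_comp_triangleEdge] at this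
  exact this

theorem IsCocycleOn.const (hθ : IsCocycleOn W θ) {x : E} (hx : x ∈ W) :
    θ (ContinuousMap.const I x) = 0 := by
  have := hθ (ContinuousMap.const _ x) fun _ => hx
  simpa only [ContinuousMap.const_comp, add_eq_left] using this

theorem segMap_self (p : V) : segMap p p = ContinuousMap.const I p := by
  ext t; simp [segMap, ← add_smul]

/-- A path extended to the real line by constants. -/
def extendPath (σ : C(I, E)) : C(ℝ, E) :=
  ⟨Set.IccExtend zero_le_one σ, σ.continuous.Icc_extend'⟩

theorem extendPath_coe (σ : C(I, E)) (t : I) : extendPath σ (t : ℝ) = σ t :=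
  Set.IccExtend_val _ _ t

theorem extendPath_mem {σ : C(I, E)} (hσ : ∀ t, σ t ∈ W) (t : ℝ) : extendPath σ t ∈ W :=
  hσ _

theorem extendPath_comp_segMap (σ : C(I, E)) : (extendPath σ).comp (segMap 0 1) = σ := by
  ext t
  have : segMap (0 : ℝ) 1 t = (t : ℝ) := by simp [segMap]
  rw [ContinuousMap.comp_apply, this, extendPath_coe]

omit [AddCommGroup M] in
theorem eq_of_locally_const {f : V → M}
    (hf : ∀ x, ∃ r > 0, ∀ y ∈ Metric.ball x r, f y = f x) (x y : V) : f x = f y := by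
  have : IsLocallyConstant f := by
    rw [IsLocallyConstant.iff_eventually_eq]
    intro x
    obtain ⟨r, hr, h⟩ := hf x
    exact Filter.eventually_of_mem (Metric.ball_mem_nhds x hr) h
  exact this.apply_eq_of_preconnectedSpace x y

omit [NormedSpace ℝ V] in
theorem exists_ball_of_open (h : C(V, E)) {U : Set E} (hU : IsOpen U) {x : V} (hx : h x ∈ U) :
    ∃ r > 0, ∀ y ∈ Metric.ball x r, h y ∈ U :=
  Metric.isOpen_iff.1 (hU.preimage h.continuous) x hx

/-- A cocycle which vanishes on short paths vanishes: along a path, its value on initial segments is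
locally constant. -/
theorem IsCocycleOn.eq_zero_of_locally (hθ : IsCocycleOn W θ)
    (hloc : ∀ x ∈ W, ∃ U, IsOpen U ∧ x ∈ U ∧
      ∀ σ : C(I, E), (∀ t, σ t ∈ U) → (∀ t, σ t ∈ W) → θ σ = 0)
    {σ : C(I, E)} (hσ : ∀ t, σ t ∈ W) : θ σ = 0 := by
  have hW : ∀ t, extendPath σ t ∈ W := extendPath_mem hσ
  have key := eq_of_locally_const (V := ℝ)
    (f := fun t => θ ((extendPath σ).comp (segMap 0 t))) (fun x => by
      obtain ⟨U, hU, hxU, hz⟩ := hloc _ (hW x)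
      obtain ⟨r, hr, hb⟩ := exists_ball_of_open (extendPath σ) hU hxU
      refine ⟨r, hr, fun y hy => ?_⟩
      have h1 := hθ.add_of_convex (extendPath σ) convex_univ (fun x _ => hW x)
        (Set.mem_univ 0) (Set.mem_univ x) (Set.mem_univ y)
      have h2 : θ ((extendPath σ).comp (segMap x y)) = 0 :=
        hz _ (fun t => hb _ (segMap_mem (convex_ball x r) (Metric.mem_ball_self hr) hy t))
          (fun t => hW _)
      rw [← h1, h2, add_zero]) 0 1
  simp only [extendPath_comp_segMap, segMap_self] at key
  rw [← key]
  exact hθ.const (x := extendPath σ 0) (hW 0)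

/-! ### Gluing cocycles -/

/-- Local functions on `V`, defined up to locally constant functions, glue: this is the
vanishing of the first cohomology of `V` with coefficients in `M`. -/
theorem exists_glued_potential (O : V → Set V) (hO : ∀ p, IsOpen (O p)) (hmem : ∀ p, p ∈ O p)
    (hconv : ∀ p, Convex ℝ (O p)) (ψ : V → V → M)
    (hψ : ∀ p q x y, x ∈ O p → y ∈ O p → x ∈ O q → y ∈ O q →
      ψ p y - ψ p x = ψ q y - ψ q x) :
    ∃ g : V → M, ∀ p x y, x ∈ O p → y ∈ O p → ψ p y - ψ p x = g y - g x := by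
  -- the `ψ p` are the transition data of a covering of `V` with discrete fibre `M`, which has a
  -- section because `V` is simply connected
  let _ : TopologicalSpace M := ⊥
  have : DiscreteTopology M := ⟨rfl⟩
  let Z : FiberBundleCore V V M :=
    { baseSet := O
      isOpen_baseSet := hO
      indexAt := id
      mem_baseSet_at := hmem
      coordChange := fun p q x t => t + ψ p x - ψ q x
      coordChange_self := fun p x _ v => by abel
      continuousOn_coordChange := fun p q => by
        have hf : ContinuousOn (fun x => ψ p x - ψ q x) (O p ∩ O q) := by
          intro x hx
          refine (continuousWithinAt_const (b := ψ p x - ψ q x)).congr (fun y hy => ?_) rfl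
          have h := hψ p q x y hx.1 hy.1 hx.2 hy.2
          rw [← sub_eq_zero] at h ⊢
          rw [← h]; abel
        have := (continuous_snd.continuousOn (s := (O p ∩ O q) ×ˢ (Set.univ : Set M))).add
          (hf.comp continuous_fst.continuousOn (fun z hz => hz.1))
        refine this.congr fun z _ => ?_
        exact add_sub_assoc _ _ _
      coordChange_comp := fun p q r x _ v => by abel }
  have cov : IsCoveringMap (Bundle.TotalSpace.proj : Bundle.TotalSpace M Z.Fiber → V) :=
    FiberBundle.isCoveringMap (F := M) (E := Z.Fiber)
  obtain ⟨s, ⟨-, hs⟩, -⟩ := cov.existsUnique_continuousMap_lifts (ContinuousMap.id V) (0 : V)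
    (⟨0, (0 : M)⟩ : Bundle.TotalSpace M Z.Fiber) rfl
  have hs' : ∀ x, (s x).1 = x := fun x => congrFun hs x
  let s2 : V → M := fun x => (s x).2
  refine ⟨fun x => s2 x + ψ (s x).1 x, fun p x y hx hy => ?_⟩
  have hcont : ContinuousOn (fun x => (Z.localTriv p (s x)).2) (O p) := by
    refine continuous_snd.comp_continuousOn
      ((Z.localTriv p).continuousOn.comp s.continuous.continuousOn fun x hx => ?_)
    rw [Z.mem_localTriv_source, hs' x]; exact hx
  have hc := (hconv p).isPreconnected.constant hcont hx hy
  have hval : ∀ x, (Z.localTriv p (s x)).2 = s2 x + ψ (s x).1 x - ψ p x := by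
    intro x
    rw [Z.localTriv_apply]
    simp only [Z, hs' x, id]
    rfl
  rw [hval, hval] at hc
  have aux : ∀ a b c d : M, a - c = b - d → d - c = b - a := fun a b c d h => by
    rw [← sub_eq_zero] at h ⊢
    rw [← h]; abel
  exact aux _ _ _ _ hc

variable {ι : Type*} {Ws : ι → Set E} {θs : ι → C(I, E) → M}

/-- Compatible cocycles on an open cover have, along every map from a vector space, a common
potential. -/
theorem exists_potential_of_cover (hopen : ∀ i, IsOpen (Ws i)) (hcover : ∀ x, ∃ i, x ∈ Ws i)
    (hc : ∀ i, IsCocycleOn (Ws i) (θs i))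
    (hagree : ∀ i j (σ : C(I, E)), (∀ t, σ t ∈ Ws i) → (∀ t, σ t ∈ Ws j) → θs i σ = θs j σ)
    (h : C(V, E)) :
    ∃ g : V → M, ∀ i p q, (∀ t, h (segMap p q t) ∈ Ws i) →
      θs i (h.comp (segMap p q)) = g q - g p := by
  choose k hk using fun p : V => hcover (h p)
  choose r hr hb using fun p : V => exists_ball_of_open h (hopen (k p)) (hk p)
  have tri : ∀ p x y, x ∈ Metric.ball p (r p) → y ∈ Metric.ball p (r p) →
      θs (k p) (h.comp (segMap p y)) - θs (k p) (h.comp (segMap p x)) =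
        θs (k p) (h.comp (segMap x y)) := by
    intro p x y hx hy
    rw [sub_eq_iff_eq_add, add_comm]
    exact ((hc (k p)).add_of_convex h (convex_ball p (r p)) (hb p)
      (Metric.mem_ball_self (hr p)) hx hy).symm
  have hin : ∀ p x y, x ∈ Metric.ball p (r p) → y ∈ Metric.ball p (r p) →
      ∀ t, h (segMap x y t) ∈ Ws (k p) := fun p x y hx hy t =>
    hb p _ (segMap_mem (convex_ball p (r p)) hx hy t)
  obtain ⟨g, hg⟩ := exists_glued_potential (fun p => Metric.ball p (r p))
    (fun p => Metric.isOpen_ball) (fun p => Metric.mem_ball_self (hr p))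
    (fun p => convex_ball p (r p)) (fun p q => θs (k p) (h.comp (segMap p q)))
    (fun p q x y hxp hyp hxq hyq => by
      rw [tri p x y hxp hyp, tri q x y hxq hyq]
      exact hagree _ _ _ (hin p x y hxp hyp) (hin q x y hxq hyq))
  refine ⟨g, fun i p q hpq => ?_⟩
  -- along the segment, the difference of the two sides is locally constant
  have hpt : ∀ x ∈ segment ℝ p q, h x ∈ Ws i := by
    intro x hx
    rw [segment_eq_image] at hx
    obtain ⟨t, ht, rfl⟩ := hx
    exact hpq ⟨t, ht⟩
  have hH : ∀ t, extendPath (segMap p q) t ∈ segment ℝ p q := fun t => segMap_mem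
    (convex_segment p q) (left_mem_segment ℝ p q) (right_mem_segment ℝ p q) _
  have hadd := fun x y hx hy => (hc i).add_of_convex h (convex_segment p q) hpt
    (left_mem_segment ℝ p q) (q := x) (r := y) hx hy
  have key := eq_of_locally_const (V := ℝ)
    (f := fun t => g (extendPath (segMap p q) t) -
      θs i (h.comp (segMap p (extendPath (segMap p q) t)))) (fun t => by
      obtain ⟨d, hd, hball⟩ := exists_ball_of_open (extendPath (segMap p q))
        (Metric.isOpen_ball (x := extendPath (segMap p q) t) (ε := r (extendPath (segMap p q) t)))
        (Metric.mem_ball_self (hr _))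
      refine ⟨d, hd, fun y hy => ?_⟩
      have hx := Metric.mem_ball_self (x := extendPath (segMap p q) t)
        (hr (extendPath (segMap p q) t))
      have h1 := hg _ _ _ hx (hball y hy)
      rw [tri _ _ _ hx (hball y hy), hagree _ i _ (hin _ _ _ hx (hball y hy))
        (fun s => hpt _ (segMap_mem (convex_segment p q) (hH t) (hH y) s))] at h1
      have h2 := hadd _ _ (hH t) (hH y)
      rw [← h2, h1]; abel) 0 1
  have e0 : extendPath (segMap p q) 0 = p := by
    have := extendPath_coe (segMap p q) 0
    simpa [segMap] using this
  have e1 : extendPath (segMap p q) 1 = q := by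
    have := extendPath_coe (segMap p q) 1
    simpa [segMap] using this
  have h0 : θs i (h.comp (segMap p p)) = 0 := by
    rw [segMap_self]
    exact (hc i).const (x := h p) (hpt _ (left_mem_segment ℝ p q))
  simp only [e0, e1, h0] at key
  rw [eq_sub_iff_add_eq] at key ⊢
  rw [← sub_eq_zero] at key ⊢
  rw [← key]; abel

/-- A retraction of the plane onto the triangle `0 ≤ y ≤ x ≤ 1`, which is identified with the
standard triangle.  It makes a singular triangle a map on a vector space. -/
def planeToTriangle : C(ℝ × ℝ, stdSimplex ℝ (Fin 3)) :=
  ⟨fun x => ⟨![1 - max 0 (min 1 x.1), max 0 (min 1 x.1) - max 0 (min (max 0 (min 1 x.1)) x.2),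
      max 0 (min (max 0 (min 1 x.1)) x.2)], by
    refine ⟨fun i => ?_, by simp [Fin.sum_univ_three]⟩
    fin_cases i
    · simp
    · exact sub_nonneg.2 (max_le (le_max_left _ _) (min_le_left _ _))
    · simp⟩, by
    refine Continuous.subtype_mk (continuous_pi fun i => ?_) _
    fin_cases i
    · simp only [Fin.zero_eta, Matrix.cons_val_zero]; fun_prop
    · simp only [Fin.mk_one, Matrix.cons_val_one, Matrix.cons_val_zero]; fun_prop
    · simp only [Fin.reduceFinMk, Matrix.cons_val]; fun_prop⟩

/-- The vertices of the triangle `0 ≤ y ≤ x ≤ 1`. -/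
def planeVertex : Fin 3 → ℝ × ℝ := ![(0, 0), (1, 0), (1, 1)]

theorem planeToTriangle_comp_segMap {i j : Fin 3} (hij : i < j) :
    planeToTriangle.comp (segMap (planeVertex i) (planeVertex j)) = triangleEdge i j := by
  refine ContinuousMap.ext fun t => Subtype.ext (funext fun k => ?_)
  have h0 := t.2.1
  have h1 := t.2.2
  fin_cases i <;> fin_cases j <;> first | exact absurd hij (by decide) | skip
  all_goals
    fin_cases k <;>
    simp [planeToTriangle, planeVertex, triangleEdge, segMap, h0, h1]

/-- Compatible cocycles on an open cover glue to a global cocycle: its value on a path is the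
increment of a common potential along the path.  Common potentials exist on singular triangles as
well, which gives the cocycle condition. -/
theorem exists_glued_cocycle (hopen : ∀ i, IsOpen (Ws i)) (hcover : ∀ x, ∃ i, x ∈ Ws i)
    (hc : ∀ i, IsCocycleOn (Ws i) (θs i))
    (hagree : ∀ i j (σ : C(I, E)), (∀ t, σ t ∈ Ws i) → (∀ t, σ t ∈ Ws j) → θs i σ = θs j σ) :
    ∃ θ : C(I, E) → M, IsCocycleOn Set.univ θ ∧
      ∀ i (σ : C(I, E)), (∀ t, σ t ∈ Ws i) → θ σ = θs i σ := by
  -- the increment along a path does not depend on the common potential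
  have uniq : ∀ (σ : C(I, E)) (g g' : ℝ → M),
      (∀ i, ∀ p ∈ Set.Icc (0 : ℝ) 1, ∀ q ∈ Set.Icc (0 : ℝ) 1,
        (∀ t, extendPath σ (segMap p q t) ∈ Ws i) →
          θs i ((extendPath σ).comp (segMap p q)) = g q - g p) →
      (∀ i, ∀ p ∈ Set.Icc (0 : ℝ) 1, ∀ q ∈ Set.Icc (0 : ℝ) 1,
        (∀ t, extendPath σ (segMap p q t) ∈ Ws i) →
          θs i ((extendPath σ).comp (segMap p q)) = g' q - g' p) →
      g 1 - g 0 = g' 1 - g' 0 := by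
    intro σ g g' hg hg'
    have key := eq_of_locally_const (V := ℝ)
      (f := fun t => g (Set.projIcc 0 1 zero_le_one t : I) -
        g' (Set.projIcc 0 1 zero_le_one t : I)) (fun t => by
        obtain ⟨i, hi⟩ := hcover (extendPath σ (Set.projIcc 0 1 zero_le_one t : I))
        obtain ⟨d, hd, hb⟩ := exists_ball_of_open (extendPath σ) (hopen i) hi
        obtain ⟨d', hd', hb'⟩ := exists_ball_of_open
          (V := ℝ) (⟨fun t => (Set.projIcc 0 1 zero_le_one t : I), by fun_prop⟩ : C(ℝ, ℝ))
          (Metric.isOpen_ball (x := ((Set.projIcc 0 1 zero_le_one t : I) : ℝ)) (ε := d))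
          (x := t) (Metric.mem_ball_self hd)
        refine ⟨d', hd', fun y hy => ?_⟩
        have hin := fun s => hb _ (segMap_mem (convex_ball _ d) (Metric.mem_ball_self hd)
          (hb' y hy) s)
        have h1 := hg i _ (Subtype.prop _) _ (Subtype.prop _) hin
        have h2 := hg' i _ (Subtype.prop _) _ (Subtype.prop _) hin
        rw [h1] at h2
        rw [← sub_eq_zero] at h2 ⊢
        rw [← h2]; abel) 0 1
    simp only [Set.projIcc_left, Set.projIcc_right] at key
    rw [← sub_eq_zero] at key ⊢
    rw [← neg_eq_zero, ← key]; abel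
  choose g hg using fun σ : C(I, E) =>
    exists_potential_of_cover hopen hcover hc hagree (extendPath σ)
  refine ⟨fun σ => g σ 1 - g σ 0, fun h _ => ?_, fun i σ hσ => ?_⟩
  · obtain ⟨G, hG⟩ := exists_potential_of_cover hopen hcover hc hagree (h.comp planeToTriangle)
    have edge : ∀ i j : Fin 3, i < j → g (h.comp (triangleEdge i j)) 1 -
        g (h.comp (triangleEdge i j)) 0 = G (planeVertex j) - G (planeVertex i) := by
      intro i j hij
      have := uniq (h.comp (triangleEdge i j)) (g (h.comp (triangleEdge i j)))
        (fun t => G ((1 - t) • planeVertex i + t • planeVertex j))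
        (fun k p _ q _ hpq => hg _ k p q hpq) (fun k p hp q hq hpq => by
          have e : (extendPath (h.comp (triangleEdge i j))).comp (segMap p q) =
              (h.comp planeToTriangle).comp (segMap ((1 - p) • planeVertex i + p • planeVertex j)
                ((1 - q) • planeVertex i + q • planeVertex j)) := by
            ext t
            have ht := segMap_mem (convex_Icc (0 : ℝ) 1) hp hq t
            have h1 := extendPath_coe (h.comp (triangleEdge i j)) ⟨segMap p q t, ht⟩
            rw [ContinuousMap.comp_apply, h1, ← planeToTriangle_comp_segMap hij]
            simp only [ContinuousMap.comp_apply]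
            congr 2
            simp only [segMap, ContinuousMap.coe_mk]
            module
          have e' : ∀ t, extendPath (h.comp (triangleEdge i j)) (segMap p q t) =
              (h.comp planeToTriangle) (segMap ((1 - p) • planeVertex i + p • planeVertex j)
                ((1 - q) • planeVertex i + q • planeVertex j) t) := fun t => congrArg (· t) e
          rw [e]
          exact hG k _ _ fun t => (e' t) ▸ hpq t)
      simpa using this
    change g _ 1 - g _ 0 + (g _ 1 - g _ 0) = g _ 1 - g _ 0
    rw [edge 0 1 (by decide), edge 1 2 (by decide), edge 0 2 (by decide)]
    abel
  · have := hg σ i 0 1 (fun t => hσ _)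
    rw [extendPath_comp_segMap] at this
    exact this.symm

/-! ### Calculus of cocycles -/

theorem triangleEdge_one_eq_zero (i j k : Fin 3) : triangleEdge i j 1 = triangleEdge j k 0 := by
  refine Subtype.ext ?_
  simp [triangleEdge, segMap]

theorem triangleEdge_zero_eq (i j k : Fin 3) : triangleEdge i j 0 = triangleEdge i k 0 := by
  refine Subtype.ext ?_
  simp [triangleEdge, segMap]

theorem triangleEdge_one_eq (i j k : Fin 3) : triangleEdge i k 1 = triangleEdge j k 1 := by
  refine Subtype.ext ?_
  simp [triangleEdge, segMap]

/-- The increment of a function is a cocycle. -/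
theorem isCocycleOn_increment (W : Set E) (ψ : E → M) :
    IsCocycleOn W (fun σ => ψ (σ 1) - ψ (σ 0)) := by
  intro h _
  simp only [ContinuousMap.comp_apply, triangleEdge_one_eq_zero 0 1 2,
    triangleEdge_zero_eq 0 1 2, triangleEdge_one_eq 0 1 2]
  abel

theorem IsCocycleOn.zero (W : Set E) : IsCocycleOn W (fun _ => (0 : M)) := fun _ _ => add_zero 0

theorem IsCocycleOn.sub {θ' : C(I, E) → M} (hθ : IsCocycleOn W θ) (hθ' : IsCocycleOn W θ') :
    IsCocycleOn W (fun σ => θ σ - θ' σ) := by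
  intro h hW
  simp only [← hθ h hW, ← hθ' h hW]
  abel

theorem IsCocycleOn.map {N : Type*} [AddCommGroup N] (u : M →+ N) (hθ : IsCocycleOn W θ) :
    IsCocycleOn W (fun σ => u (θ σ)) := by
  intro h hW
  simp only [← hθ h hW, map_add]

theorem IsCocycleOn.mono {W' : Set E} (hθ : IsCocycleOn W θ) (hW : W' ⊆ W) : IsCocycleOn W' θ :=
  fun h hh => hθ h fun x => hW (hh x)

theorem IsCocycleOn.comap {E' : Type*} [TopologicalSpace E'] (φ : C(E', E)) {W' : Set E'}
    (hθ : IsCocycleOn W θ) (hφ : ∀ x ∈ W', φ x ∈ W) : IsCocycleOn W' (fun σ => θ (φ.comp σ)) :=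
  fun h hh => hθ (φ.comp h) fun x => hφ _ (hh x)

theorem IsCocycleOn.segMap_eq_sub (hθ : IsCocycleOn Set.univ θ) (h : C(V, E)) (p q : V) :
    θ (h.comp (segMap p q)) = θ (h.comp (segMap 0 q)) - θ (h.comp (segMap 0 p)) := by
  rw [eq_sub_iff_add_eq, add_comm]
  exact hθ.add_of_convex h convex_univ (fun _ _ => trivial) (Set.mem_univ _) (Set.mem_univ _)
    (Set.mem_univ _)

/-- Along a map from a vector space, a cocycle has a potential which computes it on all paths. -/
theorem IsCocycleOn.exists_potential (hθ : IsCocycleOn Set.univ θ) (h : C(V, E)) :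
    ∃ g : V → M, ∀ ω : C(I, V), θ (h.comp ω) = g (ω 1) - g (ω 0) := by
  refine ⟨fun q => θ (h.comp (segMap 0 q)), fun ω => ?_⟩
  rw [← hθ.segMap_eq_sub h]
  -- the straight-line homotopy from `ω` to the segment
  let H : C(ℝ × ℝ, V) := ⟨fun x => (1 - x.1) • extendPath ω x.2 +
    x.1 • ((1 - x.2) • ω 0 + x.2 • ω 1), by fun_prop⟩
  have hω0 : extendPath ω 0 = ω 0 := extendPath_coe ω 0
  have hω1 : extendPath ω 1 = ω 1 := extendPath_coe ω 1
  have e1 : H.comp (segMap (0, 0) (0, 1)) = ω := by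
    ext t
    simp [H, segMap, extendPath_coe]
  have e2 : H.comp (segMap (1, 0) (1, 1)) = segMap (ω 0) (ω 1) := by
    ext t
    simp [H, segMap]
  have e3 : H.comp (segMap (0, 0) (1, 0)) = ContinuousMap.const I (ω 0) := by
    ext t
    simp [H, segMap, hω0, ← add_smul]
  have e4 : H.comp (segMap (0, 1) (1, 1)) = ContinuousMap.const I (ω 1) := by
    ext t
    simp [H, segMap, hω1, ← add_smul]
  have k1 := hθ.segMap_eq_sub (h.comp H) (0, 0) (0, 1)
  have k2 := hθ.segMap_eq_sub (h.comp H) (1, 0) (1, 1)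
  have k3 := hθ.segMap_eq_sub (h.comp H) (0, 0) (1, 0)
  have k4 := hθ.segMap_eq_sub (h.comp H) (0, 1) (1, 1)
  rw [ContinuousMap.comp_assoc, e1] at k1
  rw [ContinuousMap.comp_assoc, e2] at k2
  rw [ContinuousMap.comp_assoc, e3, ContinuousMap.comp_const,
    hθ.const (Set.mem_univ _), eq_comm, sub_eq_zero] at k3
  rw [ContinuousMap.comp_assoc, e4, ContinuousMap.comp_const,
    hθ.const (Set.mem_univ _), eq_comm, sub_eq_zero] at k4
  rw [k1, k2, k3, k4]

/-- A square of paths, extended to the plane. -/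
def extendSquare (H : C(I × I, E)) : C(ℝ × ℝ, E) :=
  H.comp ⟨fun x => (Set.projIcc 0 1 zero_le_one x.1, Set.projIcc 0 1 zero_le_one x.2), by fun_prop⟩

theorem extendSquare_coe (H : C(I × I, E)) (s t : I) :
    extendSquare H ((s : ℝ), (t : ℝ)) = H (s, t) := by
  simp [extendSquare]

/-- The path `t ↦ H (s, t)` of a square. -/
def squareRow (H : C(I × I, E)) (s : I) : C(I, E) := ⟨fun t => H (s, t), by fun_prop⟩

/-- The path `s ↦ H (s, t)` of a square. -/
def squareCol (H : C(I × I, E)) (t : I) : C(I, E) := ⟨fun s => H (s, t), by fun_prop⟩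

/-- A cocycle vanishes on the boundary of a square. -/
theorem IsCocycleOn.square (hθ : IsCocycleOn Set.univ θ) (H : C(I × I, E)) :
    θ (squareRow H 0) + θ (squareCol H 1) = θ (squareCol H 0) + θ (squareRow H 1) := by
  obtain ⟨g, hg⟩ := hθ.exists_potential (extendSquare H)
  have row : ∀ s : I, θ (squareRow H s) = g ((s : ℝ), 1) - g ((s : ℝ), 0) := by
    intro s
    have := hg ⟨fun t => ((s : ℝ), (t : ℝ)), by fun_prop⟩
    have e : (extendSquare H).comp ⟨fun t : I => ((s : ℝ), (t : ℝ)), by fun_prop⟩ = squareRow H s := by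
      ext t; exact extendSquare_coe H s t
    rw [e] at this
    simpa using this
  have col : ∀ t : I, θ (squareCol H t) = g (1, (t : ℝ)) - g (0, (t : ℝ)) := by
    intro t
    have := hg ⟨fun s => ((s : ℝ), (t : ℝ)), by fun_prop⟩
    have e : (extendSquare H).comp ⟨fun s : I => ((s : ℝ), (t : ℝ)), by fun_prop⟩ = squareCol H t := by
      ext s; exact extendSquare_coe H s t
    rw [e] at this
    simpa using this
  rw [row, row, col, col]
  simp

/-- The potential of a cocycle along a path. -/
theorem IsCocycleOn.exists_path_potential (hθ : IsCocycleOn Set.univ θ) (σ : C(I, E)) :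
    ∃ g : I → M, ∀ ω : C(I, I), θ (σ.comp ω) = g (ω 1) - g (ω 0) := by
  obtain ⟨g, hg⟩ := hθ.exists_potential (extendPath σ)
  refine ⟨fun t => g t, fun ω => ?_⟩
  have := hg ⟨fun t => (ω t : ℝ), by fun_prop⟩
  have e : (extendPath σ).comp ⟨fun t => (ω t : ℝ), by fun_prop⟩ = σ.comp ω := by
    ext t; exact extendPath_coe σ _
  rwa [e] at this

theorem IsCocycleOn.trans (hθ : IsCocycleOn Set.univ θ) {x y z : E} (γ : Path x y)
    (γ' : Path y z) : θ (γ.trans γ').toContinuousMap = θ γ.toContinuousMap + θ γ'.toContinuousMap := by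
  obtain ⟨g, hg⟩ := hθ.exists_path_potential (γ.trans γ').toContinuousMap
  let ω₁ : C(I, I) := ⟨fun t => ⟨t / 2, by constructor <;> linarith [t.2.1, t.2.2]⟩, by fun_prop⟩
  let ω₂ : C(I, I) := ⟨fun t => ⟨(t + 1) / 2, by constructor <;> linarith [t.2.1, t.2.2]⟩, by fun_prop⟩
  have h0 := hg (ContinuousMap.id I)
  have h1 := hg ω₁
  have h2 := hg ω₂
  have e1 : (γ.trans γ').toContinuousMap.comp ω₁ = γ.toContinuousMap := by
    ext t
    change (γ.trans γ') (ω₁ t) = γ t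
    have ht : ((ω₁ t : I) : ℝ) ≤ 1 / 2 := by simp only [ω₁, ContinuousMap.coe_mk]; linarith [t.2.2]
    rw [Path.trans_apply, dif_pos ht]
    congr 1
    ext
    simp only [ω₁, ContinuousMap.coe_mk]; ring
  have e2 : (γ.trans γ').toContinuousMap.comp ω₂ = γ'.toContinuousMap := by
    ext t
    change (γ.trans γ') (ω₂ t) = γ' t
    rw [Path.trans_apply]
    split_ifs with ht
    · have : t = 0 := by
        ext
        simp only [ω₂, ContinuousMap.coe_mk] at ht
        have := t.2.1
        simp only [Set.Icc.coe_zero]; linarith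
      subst this
      have : (⟨2 * ((ω₂ 0 : I) : ℝ), (unitInterval.mul_pos_mem_iff zero_lt_two).2
          ⟨(ω₂ 0).2.1, ht⟩⟩ : I) = 1 := by
        ext; simp [ω₂]
      rw [this, γ.target, γ'.source]
    · congr 1
      ext
      simp only [ω₂, ContinuousMap.coe_mk]; ring
  have k0 : ω₁ 0 = 0 := by ext; simp [ω₁]
  have k1 : ω₂ 1 = 1 := by ext; simp [ω₂]
  have k2 : ω₁ 1 = ω₂ 0 := by ext; simp [ω₁, ω₂]
  rw [e1, k0, k2] at h1
  rw [e2, k1] at h2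
  rw [ContinuousMap.comp_id] at h0
  rw [h0, h1, h2]
  simp

theorem IsCocycleOn.symm (hθ : IsCocycleOn Set.univ θ) {x y : E} (γ : Path x y) :
    θ γ.symm.toContinuousMap = - θ γ.toContinuousMap := by
  obtain ⟨g, hg⟩ := hθ.exists_path_potential γ.toContinuousMap
  have h0 := hg (ContinuousMap.id I)
  have h1 := hg ⟨unitInterval.symm, unitInterval.continuous_symm⟩
  rw [ContinuousMap.comp_id] at h0
  have e : γ.toContinuousMap.comp ⟨unitInterval.symm, unitInterval.continuous_symm⟩ =
    γ.symm.toContinuousMap := rfl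
  rw [e] at h1
  rw [h0, h1]
  simp

end Cocycle

/-! ### Lifting through principal coverings -/

/-- A principal `A`-covering `p : E → Y`, described by its lifting properties: `A` acts simply
transitively on the fibres, squares lift, and lifts of paths are unique. -/
structure IsPrincipal (A : Type*) [CommGroup A] {E Y : Type*} [TopologicalSpace E]
    [TopologicalSpace Y] [MulAction A E] (p : E → Y) : Prop where
  continuous : Continuous p
  surjective : Function.Surjective p
  map_smul : ∀ (a : A) (e : E), p (a • e) = p e
  exists_smul : ∀ e e' : E, p e = p e' → ∃ a : A, e' = a • e
  free : ∀ (a : A) (e : E), a • e = e → a = 1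
  lift : ∀ (h : C(I × I, Y)) (σ : C(I, E)), (∀ s, p (σ s) = h (s, 0)) →
    ∃ H : C(I × I, E), (∀ x, p (H x) = h x) ∧ ∀ s, H (s, 0) = σ s
  unique : ∀ σ τ : C(I, E), (∀ t, p (σ t) = p (τ t)) → ∀ t, σ t = τ t → σ = τ

/-- The loop `L` has monodromy `a`: every lift of `L` ends at the `a`-translate of its origin. -/
def HasMonodromy {A : Type*} [CommGroup A] {E Y : Type*} [TopologicalSpace E]
    [TopologicalSpace Y] [MulAction A E] (p : E → Y) (L : C(I, Y)) (a : A) : Prop :=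
  ∀ Γ : C(I, E), (∀ t, p (Γ t) = L t) → Γ 1 = a • Γ 0

/-- The closed path `t ↦ c (exp (2πit))`. -/
def circleLoop {Y : Type*} [TopologicalSpace Y] (c : C(Circle, Y)) : C(I, Y) :=
  c.comp ⟨fun t => Circle.exp (2 * Real.pi * (t : ℝ)), by fun_prop⟩

theorem circleLoop_zero_eq_one {Y : Type*} [TopologicalSpace Y] (c : C(Circle, Y)) :
    circleLoop c 0 = circleLoop c 1 := by
  simp [circleLoop]

section Principal

variable {A : Type*} [CommGroup A] {E Y : Type*} [TopologicalSpace E] [TopologicalSpace Y]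
  [MulAction A E] [ContinuousConstSMul A E] {p : E → Y}

omit [ContinuousConstSMul A E] in
theorem IsPrincipal.exists_path_lift (hp : IsPrincipal A p) (L : C(I, Y)) (e : E)
    (he : p e = L 0) : ∃ Γ : C(I, E), (∀ t, p (Γ t) = L t) ∧ Γ 0 = e := by
  obtain ⟨H, hH, h0⟩ := hp.lift (L.comp ⟨Prod.snd, continuous_snd⟩) (ContinuousMap.const I e)
    (fun _ => he)
  exact ⟨squareRow H 0, fun t => hH _, h0 0⟩

omit [ContinuousConstSMul A E] in
/-- A square lifts with prescribed lift of its initial row. -/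
theorem IsPrincipal.exists_square_lift (hp : IsPrincipal A p) (h : C(I × I, Y)) (Γ : C(I, E))
    (hΓ : ∀ t, p (Γ t) = h (0, t)) :
    ∃ H : C(I × I, E), (∀ x, p (H x) = h x) ∧ squareRow H 0 = Γ := by
  obtain ⟨σ, hσ, hσ0⟩ := hp.exists_path_lift (squareCol h 0) (Γ 0) (hΓ 0)
  obtain ⟨H, hH, h0⟩ := hp.lift h σ hσ
  refine ⟨H, hH, hp.unique _ _ (fun t => (hH _).trans (hΓ t).symm) 0 ?_⟩
  exact (h0 0).trans hσ0

omit [ContinuousConstSMul A E] in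
theorem IsPrincipal.smul_right_cancel (hp : IsPrincipal A p) {a b : A} {e : E}
    (h : a • e = b • e) : a = b := by
  have := hp.free (b⁻¹ * a) e (by rw [mul_smul, h, inv_smul_smul])
  rwa [inv_mul_eq_one, eq_comm] at this

/-- The two vertical sides of a lifted square of closed paths differ by the monodromy. -/
theorem IsPrincipal.squareCol_one (hp : IsPrincipal A p) {h : C(I × I, Y)}
    (hh : ∀ s, h (s, 0) = h (s, 1)) {H : C(I × I, E)} (hH : ∀ x, p (H x) = h x) {a : A} {s : I}
    (hs : H (s, 1) = a • H (s, 0)) : squareCol H 1 = a • squareCol H 0 := by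
  refine hp.unique _ _ (fun t => ?_) s hs
  rw [ContinuousMap.smul_apply, hp.map_smul]
  exact (hH _).trans ((hh t).symm.trans (hH _).symm)

/-- Monodromy is invariant under free homotopy of closed paths. -/
theorem IsPrincipal.hasMonodromy_homotopy (hp : IsPrincipal A p) (h : C(I × I, Y))
    (hh : ∀ s, h (s, 0) = h (s, 1)) {a : A} (ha : HasMonodromy p (squareRow h 1) a) :
    HasMonodromy p (squareRow h 0) a := by
  intro Γ hΓ
  obtain ⟨H, hH, h0⟩ := hp.exists_square_lift h Γ hΓ
  have h1 := ha (squareRow H 1) fun t => hH _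
  have := congrArg (· 0) (hp.squareCol_one hh hH h1)
  rw [← h0]
  exact this

variable {R : Type*} [CommRing R] (χ : A →* R) {θ : C(I, E) → R}

/-- The change of a cocycle under a free homotopy of closed paths. -/
theorem IsPrincipal.cocycle_homotopy (hp : IsPrincipal A p) (hθ : IsCocycleOn Set.univ θ)
    (hequiv : ∀ (a : A) σ, θ (a • σ) = χ a * θ σ) (h : C(I × I, Y))
    (hh : ∀ s, h (s, 0) = h (s, 1)) {a : A} (ha : HasMonodromy p (squareRow h 0) a)
    {Γ : C(I, E)} (hΓ : ∀ t, p (Γ t) = h (0, t)) :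
    ∃ (r : R) (Γ' : C(I, E)), (∀ t, p (Γ' t) = h (1, t)) ∧ θ Γ = (1 - χ a) * r + θ Γ' := by
  obtain ⟨H, hH, h0⟩ := hp.exists_square_lift h Γ hΓ
  have h1 := ha (squareRow H 0) fun t => hH _
  refine ⟨θ (squareCol H 0), squareRow H 1, fun t => hH _, ?_⟩
  have h2 := hθ.square H
  rw [hp.squareCol_one hh hH h1, hequiv, h0] at h2
  linear_combination h2

omit [MulAction A E] [ContinuousConstSMul A E] [CommGroup A] in
theorem lifts_trans {x x' x'' : E} {z z' z'' : Y} {γ : Path x x'} {δ : Path z z'}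
    (h : ∀ t, p (γ t) = δ t) {γ' : Path x' x''} {δ' : Path z' z''} (h' : ∀ t, p (γ' t) = δ' t)
    (t : I) : p (γ.trans γ' t) = δ.trans δ' t := by
  simp only [Path.trans_apply]
  split_ifs
  · exact h _
  · exact h' _

/-- The commutator of two loops lifts to a closed path; the value of an equivariant cocycle on it
is given by the Fox derivatives of `a b a⁻¹ b⁻¹`. -/
theorem IsPrincipal.cocycle_commutator (hp : IsPrincipal A p) (hθ : IsCocycleOn Set.univ θ)
    (hequiv : ∀ (a : A) σ, θ (a • σ) = χ a * θ σ) {y : Y} (u v : Path y y) {a b : A}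
    (ha : HasMonodromy p u.toContinuousMap a) (hb : HasMonodromy p v.toContinuousMap b)
    {Γ : C(I, E)} (hΓ : ∀ t, p (Γ t) = (u.trans (v.trans (u.symm.trans v.symm))) t) :
    Γ 1 = Γ 0 ∧ ∃ Γu Γv : C(I, E), (∀ t, p (Γu t) = u t) ∧ (∀ t, p (Γv t) = v t) ∧
      θ Γ = (1 - χ b) * θ Γu + (χ a - 1) * θ Γv := by
  have hy : p (Γ 0) = y := (hΓ 0).trans (Path.source _)
  obtain ⟨Γu, hu, hu0⟩ := hp.exists_path_lift u.toContinuousMap (Γ 0) (hy.trans u.source.symm)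
  obtain ⟨Γv, hv, hv0⟩ := hp.exists_path_lift v.toContinuousMap (Γ 0) (hy.trans v.source.symm)
  have hu1 := ha Γu hu
  have hv1 := hb Γv hv
  rw [hu0] at hu1
  rw [hv0] at hv1
  let U : Path (Γ 0) (a • Γ 0) := ⟨Γu, hu0, hu1⟩
  let V : Path (Γ 0) (b • Γ 0) := ⟨Γv, hv0, hv1⟩
  let V' : Path (a • Γ 0) (b • a • Γ 0) :=
    ⟨a • Γv, congrArg (a • ·) hv0, (congrArg (a • ·) hv1).trans (smul_comm _ _ _)⟩
  let U' : Path (b • Γ 0) (b • a • Γ 0) := ⟨b • Γu, congrArg (b • ·) hu0, congrArg (b • ·) hu1⟩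
  let W := U.trans (V'.trans (U'.symm.trans V.symm))
  have hW : ∀ t, p (W t) = (u.trans (v.trans (u.symm.trans v.symm))) t :=
    lifts_trans hu (lifts_trans (fun t => (hp.map_smul _ _).trans (hv t))
      (lifts_trans (fun t => (hp.map_smul _ _).trans (hu _)) fun t => hv _))
  have hΓW : Γ = W.toContinuousMap :=
    hp.unique _ _ (fun t => (hΓ t).trans (hW t).symm) 0 W.source.symm
  refine ⟨?_, Γu, Γv, hu, hv, ?_⟩
  · calc Γ 1 = W.toContinuousMap 1 := by rw [← hΓW]
      _ = Γ 0 := W.target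
  · have e1 : θ U'.toContinuousMap = χ b * θ Γu := hequiv b Γu
    have e2 : θ V'.toContinuousMap = χ a * θ Γv := hequiv a Γv
    rw [hΓW, hθ.trans, hθ.trans, hθ.trans, hθ.symm, hθ.symm, e1, e2]
    change θ Γu + (χ a * θ Γv + (-(χ b * θ Γu) + -θ Γv)) = _
    ring

omit [ContinuousConstSMul A E] in
/-- A free homotopy of loops on the circle, as a square of closed paths. -/
theorem circleHomotopy_square {c c' : C(Circle, Y)} (h : c.Homotopic c') :
    ∃ H : C(I × I, Y), (∀ s, H (s, 0) = H (s, 1)) ∧ squareRow H 0 = circleLoop c ∧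
      squareRow H 1 = circleLoop c' := by
  obtain ⟨H⟩ := h
  refine ⟨H.toContinuousMap.comp
    ⟨fun x => (x.1, Circle.exp (2 * Real.pi * (x.2 : ℝ))), by fun_prop⟩, fun s => by simp, ?_, ?_⟩
  · ext t
    exact H.apply_zero _
  · ext t
    exact H.apply_one _

/-- If a cocycle vanishes on one of two loops and has nonzero augmentation on the other, it does
not vanish on their commutator: up to a factor `1 - χ a` or `1 - χ b`, its value has the same
augmentation as its value on the second loop. -/
theorem IsPrincipal.cocycle_commutator_ne_zero [IsDomain R] (hp : IsPrincipal A p)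
    (hθ : IsCocycleOn Set.univ θ) (hequiv : ∀ (a : A) σ, θ (a • σ) = χ a * θ σ)
    (ε : R →+* ℤ) (hε : ∀ a, ε (χ a) = 1) {g c₁ c₂ : C(Circle, Y)}
    (hg : HomotopicToCommutator g c₁ c₂) {a b : A} (ha : HasMonodromy p (circleLoop c₁) a)
    (hb : HasMonodromy p (circleLoop c₂) b) (ha1 : χ a ≠ 1) (hb1 : χ b ≠ 1)
    (h : ((∀ Γ : C(I, E), (∀ t, p (Γ t) = circleLoop c₁ t) → θ Γ = 0) ∧
        ∀ Γ : C(I, E), (∀ t, p (Γ t) = circleLoop c₂ t) → ε (θ Γ) ≠ 0) ∨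
      ((∀ Γ : C(I, E), (∀ t, p (Γ t) = circleLoop c₁ t) → ε (θ Γ) ≠ 0) ∧
        ∀ Γ : C(I, E), (∀ t, p (Γ t) = circleLoop c₂ t) → θ Γ = 0)) :
    HasMonodromy p (circleLoop g) (1 : A) ∧
      ∀ Γ : C(I, E), (∀ t, p (Γ t) = circleLoop g t) → θ Γ ≠ 0 := by
  obtain ⟨y, u, v, u₁, v₁, g₁, hu₁, hv₁, hg₁, hu, hv, hgg⟩ := hg
  have hu₁' : circleLoop u₁ = u.toContinuousMap := ContinuousMap.ext hu₁
  have hv₁' : circleLoop v₁ = v.toContinuousMap := ContinuousMap.ext hv₁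
  obtain ⟨Hu, hu0, hu1, hu2⟩ := circleHomotopy_square hu
  obtain ⟨Hv, hv0, hv1, hv2⟩ := circleHomotopy_square hv
  obtain ⟨Hg, hg0, hg1, hg2⟩ := circleHomotopy_square hgg
  have hau := hp.hasMonodromy_homotopy Hu hu0 (hu2 ▸ ha)
  have hbv := hp.hasMonodromy_homotopy Hv hv0 (hv2 ▸ hb)
  have hcomm : ∀ Γ : C(I, E), (∀ t, p (Γ t) = circleLoop g₁ t) →
      Γ 1 = Γ 0 ∧ ∃ Γu Γv : C(I, E), (∀ t, p (Γu t) = u t) ∧ (∀ t, p (Γv t) = v t) ∧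
        θ Γ = (1 - χ b) * θ Γu + (χ a - 1) * θ Γv := fun Γ hΓ =>
    hp.cocycle_commutator χ hθ hequiv u v (by rwa [hu1, hu₁'] at hau) (by rwa [hv1, hv₁'] at hbv)
      (fun t => (hΓ t).trans (hg₁ t))
  have hmon : HasMonodromy p (squareRow Hg 0) (1 : A) :=
    hp.hasMonodromy_homotopy Hg hg0 (by
      rw [hg2]; intro Γ hΓ; rw [one_smul]; exact (hcomm Γ hΓ).1)
  refine ⟨hg1 ▸ hmon, fun Γ hΓ hzero => ?_⟩
  obtain ⟨_, Γ', hΓ', e⟩ := hp.cocycle_homotopy χ hθ hequiv Hg hg0 hmon (Γ := Γ)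
    (fun t => (hΓ t).trans (DFunLike.congr_fun hg1 t).symm)
  obtain ⟨-, Γu, Γv, hΓu, hΓv, e'⟩ := hcomm Γ' fun t =>
    (hΓ' t).trans (DFunLike.congr_fun hg2 t)
  obtain ⟨r, Γ₁, hΓ₁, er⟩ := hp.cocycle_homotopy χ hθ hequiv Hu hu0 hau (Γ := Γu) fun t =>
    (hΓu t).trans (DFunLike.congr_fun (hu1.trans hu₁') t).symm
  obtain ⟨s, Γ₂, hΓ₂, es⟩ := hp.cocycle_homotopy χ hθ hequiv Hv hv0 hbv (Γ := Γv) fun t =>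
    (hΓv t).trans (DFunLike.congr_fun (hv1.trans hv₁') t).symm
  replace hΓ₁ := fun t => (hΓ₁ t).trans (DFunLike.congr_fun hu2 t)
  replace hΓ₂ := fun t => (hΓ₂ t).trans (DFunLike.congr_fun hv2 t)
  rw [hzero, map_one, sub_self, zero_mul, zero_add, e', er, es] at e
  have hε' : ∀ a r, ε ((1 - χ a) * r) = 0 := fun a r => by simp [hε]
  rcases h with ⟨h1, h2⟩ | ⟨h1, h2⟩
  · have := mul_left_cancel₀ (sub_ne_zero.2 ha1.symm)
      (show (1 - χ a) * θ Γ₂ = (1 - χ a) * ((1 - χ b) * (r - s)) by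
        rw [h1 Γ₁ hΓ₁] at e; linear_combination e)
    exact h2 Γ₂ hΓ₂ (by rw [this, hε'])
  · have := mul_left_cancel₀ (sub_ne_zero.2 hb1.symm)
      (show (1 - χ b) * θ Γ₁ = (1 - χ b) * ((1 - χ a) * (s - r)) by
        rw [h2 Γ₂ hΓ₂] at e; linear_combination -e)
    exact h1 Γ₁ hΓ₁ (by rw [this, hε'])

/-- Equivariant cocycles are exact on the part of the covering over `U` if every point of `U` is
the base point of a loop with nontrivial monodromy `a`, depending continuously on the point: a
potential is `(χ a - 1)⁻¹` times the value on the lift of this loop.  It is linear in the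
cocycle. -/
theorem IsPrincipal.exists_potential_of_loops {F : Type*} [Field F] (χ : A →* F)
    (hp : IsPrincipal A p) (U : Set Y) (l : C(U × I, Y))
    (hl0 : ∀ y, l (y, 0) = y) (hl1 : ∀ y, l (y, 1) = y)
    (hmon : ∀ y, ∃ a : A, HasMonodromy p (l.comp ⟨fun t => (y, t), by fun_prop⟩) a ∧ χ a ≠ 1) :
    ∃ Ψ : (C(I, E) → F) →ₗ[F] (E → F), ∀ θ : C(I, E) → F, IsCocycleOn Set.univ θ →
      (∀ (a : A) σ, θ (a • σ) = χ a * θ σ) → (∀ (a : A) e, Ψ θ (a • e) = χ a * Ψ θ e) ∧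
      ∀ σ : C(I, E), (∀ t, p (σ t) ∈ U) → θ σ = Ψ θ (σ 1) - Ψ θ (σ 0) := by
  classical
  choose a ha ha1 using hmon
  choose Γ hΓ hΓ0 using fun e : {e : E // p e ∈ U} => hp.exists_path_lift
    (l.comp ⟨fun t => (⟨p e.1, e.2⟩, t), by fun_prop⟩) e.1 (hl0 ⟨p e.1, e.2⟩).symm
  let Ψ : (C(I, E) → F) →ₗ[F] (E → F) :=
    { toFun := fun θ e => if h : p e ∈ U then (χ (a ⟨p e, h⟩) - 1)⁻¹ * θ (Γ ⟨e, h⟩) else 0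
      map_add' := fun θ θ' => by
        funext e
        by_cases h : p e ∈ U
        · simp only [dif_pos h, Pi.add_apply, mul_add]
        · simp only [dif_neg h, Pi.add_apply, add_zero]
      map_smul' := fun k θ => by
        funext e
        by_cases h : p e ∈ U
        · simp only [dif_pos h, Pi.smul_apply, smul_eq_mul, RingHom.id_apply, mul_left_comm]
        · simp only [dif_neg h, Pi.smul_apply, smul_zero] }
  have hΨ : ∀ θ e (h : p e ∈ U), Ψ θ e = (χ (a ⟨p e, h⟩) - 1)⁻¹ * θ (Γ ⟨e, h⟩) :=
    fun θ e h => dif_pos h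
  have hΨ' : ∀ θ e, p e ∉ U → Ψ θ e = 0 := fun θ e h => dif_neg h
  refine ⟨Ψ, fun θ hθ hequiv => ⟨fun b e => ?_, fun σ hσ => ?_⟩⟩
  · by_cases h : p e ∈ U
    · have h' : p (b • e) ∈ U := by rwa [hp.map_smul]
      have e1 : (⟨p (b • e), h'⟩ : U) = ⟨p e, h⟩ := Subtype.ext (hp.map_smul b e)
      have e2 : Γ ⟨b • e, h'⟩ = b • Γ ⟨e, h⟩ := by
        refine hp.unique _ _ (fun t => ?_) 0 ?_
        · exact (hΓ _ t).trans ((congrArg (fun y => l (y, t)) e1).trans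
            ((hΓ ⟨e, h⟩ t).symm.trans (hp.map_smul _ _).symm))
        · rw [hΓ0, ContinuousMap.smul_apply, hΓ0]
      rw [hΨ θ _ h, hΨ θ _ h', e1, e2, hequiv]
      ring
    · have h' : p (b • e) ∉ U := by rwa [hp.map_smul]
      rw [hΨ' θ _ h, hΨ' θ _ h', mul_zero]
  · let h : C(I × I, Y) := l.comp ⟨fun x => (⟨p (σ x.1), hσ x.1⟩, x.2),
      ((hp.continuous.comp (σ.continuous.comp continuous_fst)).subtype_mk _).prodMk continuous_snd⟩
    have hh : ∀ s, h (s, 0) = h (s, 1) := fun s => (hl0 _).trans (hl1 _).symm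
    obtain ⟨H, hH, hH0⟩ := hp.lift h σ (fun s => (hl0 ⟨p (σ s), hσ s⟩).symm)
    have hrow : ∀ s, squareRow H s = Γ ⟨σ s, hσ s⟩ := fun s =>
      hp.unique _ _ (fun t => (hH _).trans (hΓ ⟨σ s, hσ s⟩ t).symm) 0
        ((hH0 s).trans (hΓ0 ⟨σ s, hσ s⟩).symm)
    have hcol : squareCol H 0 = σ := ContinuousMap.ext hH0
    have hs : ∀ s, H (s, 1) = a ⟨p (σ s), hσ s⟩ • H (s, 0) := fun s =>
      ha ⟨p (σ s), hσ s⟩ (squareRow H s) fun t => hH _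
    have h0 := hp.squareCol_one hh hH (hs 0)
    have h1 := hp.squareCol_one hh hH (hs 1)
    have haa : a ⟨p (σ 1), hσ 1⟩ = a ⟨p (σ 0), hσ 0⟩ :=
      hp.smul_right_cancel (e := H (0, 0)) (congrArg (· 0) (h1.symm.trans h0))
    have sq := hθ.square H
    rw [h0, hequiv, hrow, hrow, hcol] at sq
    have hne : χ (a ⟨p (σ 0), hσ 0⟩) - 1 ≠ 0 := sub_ne_zero.2 (ha1 _)
    rw [hΨ θ _ (hσ 0), hΨ θ _ (hσ 1), haa, ← mul_sub, eq_inv_mul_iff_mul_eq₀ hne]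
    linear_combination sq

end Principal

/-! ### The coefficient field -/

/-- Torsion-free abelian groups have unique products: this only concerns finitely many elements at
a time, and finitely generated torsion-free abelian groups embed in an affine monoid. -/
theorem uniqueProds_of_isMulTorsionFree (A : Type*) [CommGroup A] [IsMulTorsionFree A] :
    UniqueProds A where
  uniqueMul_of_nonempty {s t} hs ht := by
    classical
    let H := Submonoid.closure ((s ∪ t : Finset A) : Set A)
    have hsub : ∀ x ∈ s ∪ t, x ∈ H := fun x hx => Submonoid.subset_closure hx
    have : IsMulTorsionFree H :=
      Function.Injective.isMulTorsionFree H.subtype Subtype.val_injective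
    let _ : CancelCommMonoid H :=
      { (inferInstance : CommMonoid H) with
        mul_left_cancel := fun a b c h => Subtype.ext (mul_left_cancel (congrArg Subtype.val h)) }
    have : TwoUniqueProds H := AffineMonoid.to_twoUniqueProds
    have : UniqueProds H := TwoUniqueProds.toUniqueProds H
    obtain ⟨x, hx⟩ := hs
    obtain ⟨y, hy⟩ := ht
    obtain ⟨a, ha, b, hb, hab⟩ := UniqueProds.uniqueMul_of_nonempty
      (A := s.subtype (· ∈ H)) (B := t.subtype (· ∈ H))
      ⟨⟨x, hsub x (Finset.mem_union_left _ hx)⟩, by simpa using hx⟩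
      ⟨⟨y, hsub y (Finset.mem_union_right _ hy)⟩, by simpa using hy⟩
    refine ⟨a, by simpa using ha, b, by simpa using hb, fun c d hc hd hcd => ?_⟩
    have := hab (a := ⟨c, hsub c (Finset.mem_union_left _ hc)⟩)
      (b := ⟨d, hsub d (Finset.mem_union_right _ hd)⟩) (by simpa using hc) (by simpa using hd)
      (Subtype.ext hcd)
    exact ⟨congrArg Subtype.val this.1, congrArg Subtype.val this.2⟩

instance isDomain_groupRing (A : Type*) [CommGroup A] [IsMulTorsionFree A] :
    IsDomain (MonoidAlgebra ℤ A) :=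
  have := uniqueProds_of_isMulTorsionFree A
  NoZeroDivisors.to_isDomain _

/-- The field structure of `𝔽`.  It is a local instance, so that the ring structure of `𝔽` in the
statement of the final theorem is found independently of it. -/
local instance fieldQuotField (A : Type*) [CommGroup A] [IsMulTorsionFree A] : Field (QuotField A) :=
  IsFractionRing.toField (MonoidAlgebra ℤ A)

/-- The elements of `A`, as elements of the field `𝔽`. -/
def groupToField (A : Type*) [CommGroup A] : A →* QuotField A :=
  (algebraMap (MonoidAlgebra ℤ A) (QuotField A)).toMonoidHom.comp (MonoidAlgebra.of ℤ A)

theorem groupToField_ne_one {A : Type*} [CommGroup A] [IsMulTorsionFree A] {a : A} (ha : a ≠ 1) :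
    groupToField A a ≠ 1 := by
  intro h
  refine ha (MonoidAlgebra.of_injective (R := ℤ) (IsFractionRing.injective (MonoidAlgebra ℤ A)
    (QuotField A) ?_))
  rw [map_one, map_one]
  exact h

/-! ### The `α`-cover as a principal covering -/

namespace AlphaCover

variable {X A : Type*} [TopologicalSpace X] {x₀ : X} [CommGroup A]
  {α : FundamentalGroup X x₀ →* A} (c : AlphaCover α)

theorem isPrincipal : IsPrincipal A c.proj where
  continuous := c.isQuotientCoveringMap.continuous
  surjective := c.isQuotientCoveringMap.surjective
  map_smul a e := c.isQuotientCoveringMap.map_smul a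
  exists_smul e e' h := by
    obtain ⟨a, ha⟩ := c.isQuotientCoveringMap.apply_eq_iff_mem_orbit.1 h.symm
    exact ⟨a, ha.symm⟩
  free a e h := by
    have := c.isQuotientCoveringMap.isCancelSMul
    exact IsCancelSMul.right_cancel a 1 e (h.trans (one_smul A e).symm)
  lift h σ hσ := by
    have cov := IsQuotientCoveringMap.isCoveringMap _ _ c.isQuotientCoveringMap
    let h' : C(I × I, X) := h.comp ⟨Prod.swap, continuous_swap⟩
    have h0 : ∀ s, h' (0, s) = c.proj (σ s) := fun s => (hσ s).symm
    refine ⟨(cov.liftHomotopy h' σ h0).comp ⟨Prod.swap, continuous_swap⟩, fun x => ?_, fun s => ?_⟩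
    · exact congrFun (cov.liftHomotopy_lifts h' σ h0) x.swap
    · exact cov.liftHomotopy_zero h' σ h0 s
  unique σ τ h t ht := DFunLike.coe_injective
    ((IsQuotientCoveringMap.isCoveringMap _ _ c.isQuotientCoveringMap).eq_of_comp_eq
      σ.continuous τ.continuous (funext h) t ht)

variable {Y : Type*} [TopologicalSpace Y] (f : C(Y, X))

/-- The projection of the restricted cover. -/
def restrictBase (q : c.Restrict f) : Y := q.1.1

theorem restrictBase_isPrincipal : IsPrincipal A (c.restrictBase f) where
  continuous := continuous_fst.comp continuous_subtype_val
  surjective y := by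
    obtain ⟨e, he⟩ := c.isPrincipal.surjective (f y)
    exact ⟨⟨(y, e), he.symm⟩, rfl⟩
  map_smul a e := rfl
  exists_smul e e' h := by
    obtain ⟨a, ha⟩ := c.isPrincipal.exists_smul e.1.2 e'.1.2
      (by rw [← e.2, ← e'.2]; exact congrArg f h)
    exact ⟨a, Subtype.ext (Prod.ext h.symm ha)⟩
  free a e h := c.isPrincipal.free a e.1.2 (congrArg (fun q => q.1.2) h)
  lift h σ hσ := by
    obtain ⟨H, hH, h0⟩ := c.isPrincipal.lift (f.comp h) ((c.restrictProj f).comp σ) (fun s => by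
      rw [ContinuousMap.comp_apply, ContinuousMap.comp_apply, ← hσ]; exact (σ s).2.symm)
    exact ⟨⟨fun x => ⟨(h x, H x), (hH x).symm⟩, Continuous.subtype_mk (by fun_prop) _⟩, fun x => rfl,
      fun s => Subtype.ext (Prod.ext (hσ s).symm (h0 s))⟩
  unique σ τ h t ht := by
    have := c.isPrincipal.unique ((c.restrictProj f).comp σ) ((c.restrictProj f).comp τ)
      (fun t => by
        have h1 : f (σ t).1.1 = c.proj (σ t).1.2 := (σ t).2
        have h2 : f (τ t).1.1 = c.proj (τ t).1.2 := (τ t).2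
        exact h1.symm.trans ((congrArg f (h t)).trans h2)) t
      (congrArg (c.restrictProj f) ht)
    ext t
    exact Subtype.ext (Prod.ext (h t) (DFunLike.congr_fun this t))

theorem hasMonodromy_restrict {L : C(I, Y)} (hL : L 0 = L 1) {a : A}
    (h : HasMonodromy c.proj (f.comp L) a) : HasMonodromy (c.restrictBase f) L a := by
  intro Γ hΓ
  refine Subtype.ext (Prod.ext ((hΓ 1).trans (hL.symm.trans (hΓ 0).symm)) ?_)
  refine h ((c.restrictProj f).comp Γ) fun t => ?_
  exact (Γ t).2.symm.trans (congrArg f (hΓ t))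

theorem hasMonodromy_of_restrict {L : C(I, Y)} {a : A}
    (h : HasMonodromy (c.restrictBase f) L a) : HasMonodromy c.proj (f.comp L) a := by
  intro Γ hΓ
  exact congrArg (c.restrictProj f) (h ⟨fun t => ⟨(L t, Γ t), (hΓ t).symm⟩,
    Continuous.subtype_mk (by fun_prop) _⟩ fun t => rfl)

/-- Homologically nontrivial loops have nontrivial monodromy. -/
theorem exists_hasMonodromy_of_nontrivial {S : Type*} [TopologicalSpace S] {x₀ : S}
    (c : AlphaCover (hurewicz S x₀)) {u : C(Circle, S)} (hu : HomologicallyNontrivial x₀ u) :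
    ∃ a : FreeH1 S x₀, HasMonodromy c.proj (circleLoop u) a ∧ a ≠ 1 := by
  obtain ⟨x, γ, q, hγ, hne⟩ := hu
  refine ⟨_, fun Γ hΓ => ?_, hne⟩
  have hΓ' : ∀ t, c.proj (Γ t) = γ t := fun t => (hΓ t).trans (hγ t)
  obtain ⟨a, ha⟩ := c.isPrincipal.exists_smul (Γ 0) (Γ 1)
    (by rw [hΓ', hΓ', γ.source, γ.target])
  obtain ⟨Q, hQ, hQ0⟩ := c.isPrincipal.exists_path_lift q.symm.toContinuousMap (Γ 0)
    ((hΓ' 0).trans (γ.source.trans q.symm.source.symm))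
  let Q' : Path (Γ 0) (Q 1) := ⟨Q, hQ0, rfl⟩
  let G : Path (Γ 0) (a • Γ 0) := ⟨Γ, rfl, ha⟩
  let Q'' : Path (a • Γ 0) (a • Q 1) := ⟨a • Q, congrArg (a • ·) hQ0, rfl⟩
  have hQt : ∀ t, c.proj (Q'.symm t) = q t := fun t => (hQ _).trans (by
    change q (unitInterval.symm (unitInterval.symm t)) = q t
    rw [unitInterval.symm_symm])
  have key := c.monodromy (q.trans (γ.trans q.symm)) (Q'.symm.trans (G.trans Q'')).toContinuousMap
    (lifts_trans hQt (lifts_trans hΓ'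
      fun t => (c.isPrincipal.map_smul a _).trans (hQ t)))
  have e1 : (Q'.symm.trans (G.trans Q'')).toContinuousMap 1 = a • Q 1 := Path.target _
  have e0 : (Q'.symm.trans (G.trans Q'')).toContinuousMap 0 = Q 1 := Path.source _
  rw [e1, e0] at key
  rw [ha, c.isPrincipal.smul_right_cancel key]

end AlphaCover

/-! ### Cocycles and twisted homology -/

section Chains

variable {A : Type*} [CommGroup A] {E : Type*} [TopologicalSpace E] [MulAction A E]
  [ContinuousConstSMul A E]

theorem quotField_single_smul (a : A) (k : QuotField A) :
    MonoidAlgebra.single a (1 : ℤ) • k = groupToField A a * k :=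
  Algebra.smul_def _ _

/-- The additive extension of a function on singular simplices. -/
def SingularChains.liftInt {n : ℕ} {M : Type*} [AddCommGroup M]
    (u : C(stdSimplex ℝ (Fin (n + 1)), E) → M) : SingularChains E n →ₗ[ℤ] M :=
  (Finsupp.liftAddHom (M := ℤ) (fun s => zmultiplesHom M (u s)) :
    SingularChains E n →+ M).toIntLinearMap

omit [MulAction A E] [ContinuousConstSMul A E] [CommGroup A] in
theorem SingularChains.liftInt_single {n : ℕ} {M : Type*} [AddCommGroup M]
    (u : C(stdSimplex ℝ (Fin (n + 1)), E) → M) (s) (k : ℤ) :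
    SingularChains.liftInt u (SingularChains.single s k) = k • u s :=
  (Finsupp.liftAddHom_apply_single _ _ _).trans rfl

/-- The functional on twisted chains given by an equivariant function on singular simplices. -/
def equivariantFunctional {n : ℕ} (u : C(stdSimplex ℝ (Fin (n + 1)), E) → QuotField A)
    (hu : ∀ (a : A) s, u (a • s) = groupToField A a * u s) :
    TwistedChains A E n →ₗ[QuotField A] QuotField A :=
  LinearMap.liftBaseChange (QuotField A)
    (MonoidAlgebra.equivariantOfLinearOfComm (SingularChains.liftInt u) (fun a v => by
      rw [singularChains_single_smul, quotField_single_smul]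
      induction v using SingularChains.induction with
      | h0 => simp
      | hadd v w hv hw => simp only [map_add, hv, hw, mul_add]
      | h1 s k =>
        simp only [singularRep, MonoidHom.coe_mk, OneHom.coe_mk,
          SingularChains.mapSimplices_single, SingularChains.liftInt_single, hu, mul_smul_comm]))

/-- The twisted chain of a singular simplex. -/
def simplexChain {n : ℕ} (s : C(stdSimplex ℝ (Fin (n + 1)), E)) : TwistedChains A E n :=
  (1 : QuotField A) ⊗ₜ[MonoidAlgebra ℤ A] SingularChains.single s 1

theorem equivariantFunctional_simplexChain {n : ℕ}
    (u : C(stdSimplex ℝ (Fin (n + 1)), E) → QuotField A)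
    (hu : ∀ (a : A) s, u (a • s) = groupToField A a * u s) (s) :
    equivariantFunctional u hu (simplexChain s) = u s := by
  have h : equivariantFunctional u hu (simplexChain s) =
      (1 : QuotField A) • SingularChains.liftInt u (SingularChains.single s 1) := rfl
  rw [h, one_smul]
  exact (SingularChains.liftInt_single u s 1).trans (one_smul _ _)

theorem TwistedChains.induction {n : ℕ} {P : TwistedChains A E n → Prop}
    (v : TwistedChains A E n) (h0 : P 0) (hadd : ∀ v w, P v → P w → P (v + w))
    (h1 : ∀ (k : QuotField A) s, P (k • simplexChain s)) : P v := by
  refine TensorProduct.induction_on (motive := P) v h0 (fun k v => ?_) hadd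
  induction v using SingularChains.induction with
  | h0 => exact (TensorProduct.tmul_zero (R := MonoidAlgebra ℤ A) (SingularChains E n) k).symm ▸ h0
  | hadd v w hv hw => exact (TensorProduct.tmul_add (R := MonoidAlgebra ℤ A) k v w).symm ▸ hadd _ _ hv hw
  | h1 s m =>
    have e : SingularChains.single s m = m • SingularChains.single s 1 := by
      refine ((Finsupp.smul_single m s (1 : ℤ)).trans ?_).symm
      rw [smul_eq_mul, mul_one]; rfl
    have e2 : (m • k) • (simplexChain s : TwistedChains A E n) =
        k ⊗ₜ[MonoidAlgebra ℤ A] SingularChains.single s m := by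
      refine (TensorProduct.smul_tmul' (R := MonoidAlgebra ℤ A) (m • k) (1 : QuotField A)
        (SingularChains.single s 1)).trans ?_
      rw [smul_eq_mul, mul_one, e]
      exact (TensorProduct.smul_tmul m k (SingularChains.single s 1))
    exact e2 ▸ h1 (m • k) s

/-- Functionals on twisted chains are determined by their values on simplices. -/
theorem twistedChains_ext {n : ℕ} {N : Type*} [AddCommGroup N] [Module (QuotField A) N]
    {Φ Ψ : TwistedChains A E n →ₗ[QuotField A] N}
    (h : ∀ s, Φ (simplexChain s) = Ψ (simplexChain s)) : Φ = Ψ := by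
  refine LinearMap.ext fun v => ?_
  induction v using TwistedChains.induction with
  | h0 => rw [map_zero, map_zero]
  | hadd v w hv hw => rw [map_add, map_add, hv, hw]
  | h1 k s => rw [map_smul, map_smul, h]

theorem simplexChain_smul {n : ℕ} (a : A) (s : C(stdSimplex ℝ (Fin (n + 1)), E)) :
    (simplexChain (a • s) : TwistedChains A E n) = groupToField A a • simplexChain s := by
  have e : SingularChains.single (a • s) 1 =
      MonoidAlgebra.single a (1 : ℤ) • SingularChains.single s 1 := by
    rw [singularChains_single_smul]
    exact (SingularChains.mapSimplices_single _ s 1).symm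
  have h1 : (groupToField A a • simplexChain s : TwistedChains A E n) =
      (groupToField A a • (1 : QuotField A)) ⊗ₜ[MonoidAlgebra ℤ A] SingularChains.single s 1 :=
    TensorProduct.smul_tmul' _ _ _
  have h2 : groupToField A a • (1 : QuotField A) =
      MonoidAlgebra.single a (1 : ℤ) • (1 : QuotField A) := (quotField_single_smul a 1).symm
  rw [h1, h2]
  refine Eq.trans ?_ (TensorProduct.smul_tmul _ _ _).symm
  rw [← e]; rfl

theorem twistedBoundary_simplexChain {n : ℕ} (s : C(stdSimplex ℝ (Fin (n + 2)), E)) :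
    twistedBoundary A E n (simplexChain s) =
      ∑ i : Fin (n + 2), (-1 : ℤ) ^ (i : ℕ) • simplexChain (s.comp (simplexFace n i)) := by
  have h1 : twistedBoundary A E n (simplexChain s) =
      (1 : QuotField A) ⊗ₜ[MonoidAlgebra ℤ A] singularBoundary A E n (SingularChains.single s 1) :=
    LinearMap.baseChange_tmul _ _ _
  have h2 : singularBoundary A E n (SingularChains.single s 1) =
      ∑ i : Fin (n + 2), (-1 : ℤ) ^ (i : ℕ) •
        SingularChains.single (s.comp (simplexFace n i)) 1 := by
    change singularBoundaryInt E n _ = _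
    simp only [singularBoundaryInt, LinearMap.sum_apply, LinearMap.smul_apply,
      SingularChains.mapSimplices_single]
  rw [h1, h2]
  refine (TensorProduct.tmul_sum _ _ _).trans (Finset.sum_congr rfl fun i _ => ?_)
  exact TensorProduct.tmul_smul _ _ _

/-- A path, as a singular simplex. -/
def pathSimplex (γ : C(I, E)) : C(stdSimplex ℝ (Fin 2), E) :=
  γ.comp ⟨stdSimplexHomeomorphUnitInterval, stdSimplexHomeomorphUnitInterval.continuous⟩

/-- A singular simplex, as a path. -/
def simplexPath (s : C(stdSimplex ℝ (Fin 2), E)) : C(I, E) :=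
  s.comp ⟨stdSimplexHomeomorphUnitInterval.symm, stdSimplexHomeomorphUnitInterval.symm.continuous⟩

omit [MulAction A E] [ContinuousConstSMul A E] [CommGroup A] in
theorem simplexPath_pathSimplex (γ : C(I, E)) : simplexPath (pathSimplex γ) = γ := by
  ext t
  exact congrArg γ (stdSimplexHomeomorphUnitInterval.apply_symm_apply t)

omit [MulAction A E] [ContinuousConstSMul A E] [CommGroup A] in
theorem pathSimplex_simplexPath (s : C(stdSimplex ℝ (Fin 2), E)) :
    pathSimplex (simplexPath s) = s := by
  ext t
  exact congrArg s (stdSimplexHomeomorphUnitInterval.symm_apply_apply t)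

/-- A point, as a singular simplex. -/
def pointSimplex (e : E) : C(stdSimplex ℝ (Fin 1), E) := ContinuousMap.const _ e

omit [MulAction A E] [ContinuousConstSMul A E] [CommGroup A] in
/-- The faces of a singular triangle are its three edges. -/
theorem simplexPath_face (h : C(stdSimplex ℝ (Fin 3), E)) :
    simplexPath (h.comp (simplexFace 1 0)) = h.comp (triangleEdge 1 2) ∧
    simplexPath (h.comp (simplexFace 1 1)) = h.comp (triangleEdge 0 2) ∧
    simplexPath (h.comp (simplexFace 1 2)) = h.comp (triangleEdge 0 1) := by
  refine ⟨?_, ?_, ?_⟩ <;>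
  · ext t
    refine congrArg h (Subtype.ext (funext fun j => ?_))
    refine (congrFun (stdSimplex.map_coe _ _) j).trans ?_
    rw [FunOnFinite.linearMap_apply_apply]
    fin_cases j <;>
      simp [triangleEdge, Finset.sum_filter, Fin.sum_univ_two, Fin.succAbove,
        stdSimplexHomeomorphUnitInterval, stdSimplexEquivIcc, segMap] <;> rfl

omit [MulAction A E] [ContinuousConstSMul A E] [CommGroup A] in
theorem pathSimplex_face (γ : C(I, E)) :
    (pathSimplex γ).comp (simplexFace 0 0) = pointSimplex (γ 1) ∧
    (pathSimplex γ).comp (simplexFace 0 1) = pointSimplex (γ 0) := by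
  refine ⟨?_, ?_⟩ <;>
  · ext t
    refine congrArg γ (Subtype.ext ?_)
    refine (congrFun (stdSimplex.map_coe _ _) 1).trans ?_
    rw [FunOnFinite.linearMap_apply_apply]
    rw [Finset.sum_filter, Fin.sum_univ_one]
    simp [Fin.succAbove]

theorem twistedBoundary_pathSimplex (γ : C(I, E)) :
    twistedBoundary A E 0 (simplexChain (pathSimplex γ)) =
      simplexChain (pointSimplex (γ 1)) - simplexChain (pointSimplex (γ 0)) := by
  refine (twistedBoundary_simplexChain _).trans ((Fin.sum_univ_two _).trans ?_)
  rw [(pathSimplex_face γ).1, (pathSimplex_face γ).2]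
  simp [sub_eq_add_neg]

theorem twistedBoundary_triangle (s : C(stdSimplex ℝ (Fin 3), E)) :
    twistedBoundary A E 1 (simplexChain s) =
      simplexChain (pathSimplex (s.comp (triangleEdge 1 2))) -
        simplexChain (pathSimplex (s.comp (triangleEdge 0 2))) +
        simplexChain (pathSimplex (s.comp (triangleEdge 0 1))) := by
  obtain ⟨h0, h1, h2⟩ := simplexPath_face s
  refine (twistedBoundary_simplexChain _).trans ((Fin.sum_univ_three _).trans ?_)
  rw [← h0, ← h1, ← h2, pathSimplex_simplexPath, pathSimplex_simplexPath, pathSimplex_simplexPath]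
  simp [sub_eq_add_neg]

/-! ### Functionals and cocycles -/

/-- The values of a functional that kills boundaries form a cocycle. -/
theorem isCocycleOn_of_functional {Λ : TwistedChains A E 1 →ₗ[QuotField A] QuotField A}
    (hΛ : ∀ w, Λ (twistedBoundary A E 1 w) = 0) :
    IsCocycleOn Set.univ fun γ : C(I, E) => Λ (simplexChain (pathSimplex γ)) := by
  intro h _
  have e := hΛ (simplexChain h)
  rw [twistedBoundary_triangle, map_add, map_sub] at e
  linear_combination e

theorem functional_smul (Λ : TwistedChains A E 1 →ₗ[QuotField A] QuotField A) (a : A)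
    (γ : C(I, E)) : Λ (simplexChain (pathSimplex (a • γ))) =
      groupToField A a * Λ (simplexChain (pathSimplex γ)) := by
  have : pathSimplex (a • γ) = a • pathSimplex γ := rfl
  rw [this, simplexChain_smul, map_smul, smul_eq_mul]

/-- A functional whose cocycle is exact vanishes on cycles. -/
theorem functional_eq_zero_of_exact {Λ : TwistedChains A E 1 →ₗ[QuotField A] QuotField A}
    {ψ : E → QuotField A} (hψ : ∀ (a : A) e, ψ (a • e) = groupToField A a * ψ e)
    (h : ∀ γ : C(I, E), Λ (simplexChain (pathSimplex γ)) = ψ (γ 1) - ψ (γ 0))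
    {z : TwistedChains A E 1} (hz : z ∈ twistedCycles1 A E) : Λ z = 0 := by
  let Ψ : TwistedChains A E 0 →ₗ[QuotField A] QuotField A :=
    equivariantFunctional (fun s => ψ (s default)) fun a s => hψ a _
  have key : Λ = Ψ.comp (twistedBoundary A E 0) := by
    refine twistedChains_ext fun s => ?_
    obtain ⟨γ, rfl⟩ : ∃ γ, s = pathSimplex γ := ⟨_, (pathSimplex_simplexPath s).symm⟩
    rw [LinearMap.comp_apply, twistedBoundary_pathSimplex, map_sub, h]
    simp only [Ψ, equivariantFunctional_simplexChain, pointSimplex, ContinuousMap.const_apply]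
  rw [key, LinearMap.comp_apply, LinearMap.mem_ker.1 hz, map_zero]

theorem simplexChain_mem_cycles {γ : C(I, E)} (hγ : γ 1 = γ 0) :
    (simplexChain (pathSimplex γ) : TwistedChains A E 1) ∈ twistedCycles1 A E := by
  rw [LinearMap.mem_ker, twistedBoundary_pathSimplex, hγ, sub_self]

/-- The class of a closed path in twisted homology. -/
def loopH1 (A : Type*) [CommGroup A] {E : Type*} [TopologicalSpace E] [MulAction A E]
    [ContinuousConstSMul A E] (γ : C(I, E)) (hγ : γ 1 = γ 0) : TwistedH1 A E :=
  Submodule.Quotient.mk ⟨simplexChain (pathSimplex γ), simplexChain_mem_cycles hγ⟩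

theorem TwistedH1.map_loopH1 {E' : Type*} [TopologicalSpace E'] [MulAction A E']
    [ContinuousConstSMul A E'] (u : C(E, E')) (hu : ∀ (a : A) e, u (a • e) = a • u e)
    (γ : C(I, E)) (hγ : γ 1 = γ 0) :
    TwistedH1.map u hu (loopH1 A γ hγ) = loopH1 A (u.comp γ) (congrArg u hγ) := by
  refine (Submodule.mapQ_apply _ _ _ _).trans ?_
  refine congrArg Submodule.Quotient.mk (Subtype.ext ?_)
  refine (LinearMap.baseChange_tmul _ _ _).trans ?_
  refine congrArg ((1 : QuotField A) ⊗ₜ[MonoidAlgebra ℤ A] ·) ?_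
  exact SingularChains.mapSimplices_single _ _ 1

/-- The class of a closed path is nonzero as soon as some equivariant cocycle detects it. -/
theorem loopH1_ne_zero {θ : C(I, E) → QuotField A} (hθ : IsCocycleOn Set.univ θ)
    (hequiv : ∀ (a : A) σ, θ (a • σ) = groupToField A a * θ σ) {γ : C(I, E)} (hγ : γ 1 = γ 0)
    (hne : θ γ ≠ 0) : loopH1 A γ hγ ≠ 0 := by
  intro h0
  obtain ⟨w, hw⟩ := (Submodule.Quotient.mk_eq_zero _).1 h0
  let Λ : TwistedChains A E 1 →ₗ[QuotField A] QuotField A :=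
    equivariantFunctional (fun s => θ (simplexPath s)) fun a s => hequiv a (simplexPath s)
  have hΛ : ∀ σ, Λ (simplexChain (pathSimplex σ)) = θ σ := fun σ =>
    (equivariantFunctional_simplexChain _ _ _).trans (congrArg θ (simplexPath_pathSimplex σ))
  have key : Λ.comp (twistedBoundary A E 1) = 0 := by
    refine twistedChains_ext fun s => ?_
    rw [LinearMap.comp_apply, twistedBoundary_triangle, map_add, map_sub, LinearMap.zero_apply]
    rw [hΛ, hΛ, hΛ]
    have := hθ s fun _ => Set.mem_univ _
    linear_combination this
  refine hne ((hΛ γ).symm.trans ?_)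
  have hw' : twistedBoundary A E 1 w = simplexChain (pathSimplex γ) := hw
  rw [← hw']
  exact LinearMap.congr_fun key w

/-- If a single linear condition forces an equivariant cocycle to be exact, then twisted homology
is at most one-dimensional. -/
theorem exists_smul_eq_of_exact [IsMulTorsionFree A]
    (κ : (C(I, E) → QuotField A) →ₗ[QuotField A] QuotField A)
    (hκ : ∀ θ : C(I, E) → QuotField A, IsCocycleOn Set.univ θ →
      (∀ (a : A) σ, θ (a • σ) = groupToField A a * θ σ) → κ θ = 0 →
      ∃ ψ : E → QuotField A, (∀ (a : A) e, ψ (a • e) = groupToField A a * ψ e) ∧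
        ∀ γ, θ γ = ψ (γ 1) - ψ (γ 0))
    {v : TwistedH1 A E} (hv : v ≠ 0) (w : TwistedH1 A E) :
    ∃ k : QuotField A, w = k • v := by
  -- functionals on homology come from functionals on chains
  have ext : ∀ f : TwistedH1 A E →ₗ[QuotField A] QuotField A,
      ∃ Λ : TwistedChains A E 1 →ₗ[QuotField A] QuotField A,
        (∀ z : twistedCycles1 A E, Λ z = f (Submodule.Quotient.mk z)) ∧
        ∀ u, Λ (twistedBoundary A E 1 u) = 0 := by
    intro f
    obtain ⟨Λ, hΛ⟩ := LinearMap.exists_extend (f.comp (Submodule.mkQ _) :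
      twistedCycles1 A E →ₗ[QuotField A] QuotField A)
    have h1 : ∀ z : twistedCycles1 A E, Λ z = f (Submodule.Quotient.mk z) :=
      fun z => LinearMap.congr_fun hΛ z
    refine ⟨Λ, h1, fun u => ?_⟩
    have hu : twistedBoundary A E 1 u ∈ twistedCycles1 A E := by
      have : (twistedBoundary A E 0).comp (twistedBoundary A E 1) = 0 := by
        refine twistedChains_ext fun s => ?_
        rw [LinearMap.comp_apply, twistedBoundary_triangle, map_add, map_sub]
        simp only [twistedBoundary_pathSimplex, ContinuousMap.comp_apply,
          triangleEdge_one_eq_zero 0 1 2, triangleEdge_zero_eq 0 1 2, triangleEdge_one_eq 0 1 2,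
          LinearMap.zero_apply]
        abel
      exact LinearMap.congr_fun this u
    rw [h1 ⟨_, hu⟩, (Submodule.Quotient.mk_eq_zero _).2, map_zero]
    exact ⟨u, rfl⟩
  have vanish : ∀ Λ : TwistedChains A E 1 →ₗ[QuotField A] QuotField A,
      (∀ u, Λ (twistedBoundary A E 1 u) = 0) →
      κ (fun γ => Λ (simplexChain (pathSimplex γ))) = 0 →
      ∀ z : twistedCycles1 A E, Λ z = 0 := by
    intro Λ hΛ h0 z
    obtain ⟨ψ, hψ, hψθ⟩ := hκ _ (isCocycleOn_of_functional hΛ) (functional_smul Λ) h0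
    exact functional_eq_zero_of_exact hψ hψθ z.2
  by_contra! hcon
  obtain ⟨f, hfw, hfv⟩ := Submodule.exists_le_ker_of_notMem
    (p := Submodule.span (QuotField A) {v}) (v := w) (fun h => by
      obtain ⟨k, hk⟩ := Submodule.mem_span_singleton.1 h
      exact hcon k hk.symm)
  obtain ⟨g, hgv, -⟩ := Submodule.exists_le_ker_of_notMem
    (p := (⊥ : Submodule (QuotField A) (TwistedH1 A E))) (v := v) (by simpa using hv)
  have hfv : f v = 0 := LinearMap.mem_ker.1 (hfv (Submodule.mem_span_singleton_self v))
  obtain ⟨z, rfl⟩ := Submodule.Quotient.mk_surjective _ v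
  obtain ⟨y, rfl⟩ := Submodule.Quotient.mk_surjective _ w
  obtain ⟨Λ, hΛ, hΛ0⟩ := ext f
  obtain ⟨Λ', hΛ', hΛ0'⟩ := ext g
  set r := κ fun γ => Λ (simplexChain (pathSimplex γ)) with hr
  set r' := κ fun γ => Λ' (simplexChain (pathSimplex γ)) with hr'
  have h1 := vanish (r' • Λ - r • Λ') (fun u => by simp [hΛ0, hΛ0']) (by
    have e : (fun γ : C(I, E) => (r' • Λ - r • Λ') (simplexChain (pathSimplex γ))) =
        r' • (fun γ => Λ (simplexChain (pathSimplex γ))) -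
          r • fun γ => Λ' (simplexChain (pathSimplex γ)) := rfl
    rw [e, map_sub, map_smul, map_smul, ← hr, ← hr', smul_eq_mul, smul_eq_mul]
    ring) z
  have h2 : r = 0 := by
    rw [LinearMap.sub_apply, LinearMap.smul_apply, LinearMap.smul_apply, hΛ, hΛ', hfv, smul_zero,
      zero_sub, neg_eq_zero, smul_eq_mul] at h1
    exact (mul_eq_zero.1 h1).resolve_right hgv
  exact hfw ((hΛ y).symm.trans (vanish Λ hΛ0 h2 y))

end Chains

/-! ### The homology of the circle -/

theorem AlphaCover.exists_real_lift {X A : Type*} [TopologicalSpace X] {x₀ : X} [CommGroup A]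
    {α : FundamentalGroup X x₀ →* A} (c : AlphaCover α) (g : C(ℝ, X)) :
    ∃ e : C(ℝ, c.Total), ∀ t, c.proj (e t) = g t := by
  obtain ⟨e₀, he₀⟩ := c.isPrincipal.surjective (g 0)
  obtain ⟨e, ⟨-, he⟩, -⟩ := (IsQuotientCoveringMap.isCoveringMap _ _
    c.isQuotientCoveringMap).existsUnique_continuousMap_lifts g 0 e₀ he₀
  exact ⟨e, congrFun he⟩

/-- The polar angle along a path in the circle, in turns. -/
theorem exists_circle_path_lift (L : C(I, Circle)) :
    ∃ ω : C(I, ℝ), ∀ t, Circle.exp (2 * Real.pi * ω t) = L t := by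
  have h0 : L 0 = Circle.exp (Complex.arg (L 0)) := (Circle.exp_arg _).symm
  refine ⟨⟨fun t => (2 * Real.pi)⁻¹ * Circle.isCoveringMap_exp.liftPath L _ h0 t,
    by fun_prop⟩, fun t => ?_⟩
  refine Eq.trans ?_ (congrFun (Circle.isCoveringMap_exp.liftPath_lifts L _ h0) t)
  have : (2 * Real.pi) ≠ 0 := Real.two_pi_pos.ne'
  exact congrArg Circle.exp (mul_inv_cancel_left₀ this _)

section

variable {A : Type*} [CommGroup A] {E : Type*} [TopologicalSpace E] [MulAction A E]
  [ContinuousConstSMul A E] {p : E → Circle} {R : Type*} [CommRing R] (χ : A →* R)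
  {θ : C(I, E) → R}

/-- Over a circle with trivial monodromy, a cocycle is exact if it vanishes on a lift of the
circle. -/
theorem IsPrincipal.exists_potential_of_circle (hp : IsPrincipal A p) (e : C(ℝ, E))
    (he : ∀ t, p (e t) = Circle.exp (2 * Real.pi * t)) (hmon : e 1 = e 0)
    (hθ : IsCocycleOn Set.univ θ) (hequiv : ∀ (a : A) σ, θ (a • σ) = χ a * θ σ)
    (h0 : θ (e.comp ⟨fun t : I => (t : ℝ), by fun_prop⟩) = 0) :
    ∃ ψ : E → R, (∀ (a : A) x, ψ (a • x) = χ a * ψ x) ∧ ∀ γ, θ γ = ψ (γ 1) - ψ (γ 0) := by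
  have exp_add : ∀ (t : ℝ) (n : ℤ), Circle.exp (2 * Real.pi * (t + n)) =
      Circle.exp (2 * Real.pi * t) := fun t n => Circle.exp_eq_exp.2 ⟨n, by ring⟩
  -- `e` is periodic: both sides lift the same path
  have per : ∀ t, e (t + 1) = e t := by
    intro t
    let ω : C(I, ℝ) := ⟨fun s => s * t, by fun_prop⟩
    have := hp.unique (e.comp (ω + 1)) (e.comp ω) (fun s => by
      have := exp_add (s * t) 1
      rw [Int.cast_one] at this
      exact (he _).trans (this.trans (he _).symm)) 0 (by
      simpa [ω] using hmon)
    simpa [ω] using DFunLike.congr_fun this 1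
  obtain ⟨g, hg⟩ := hθ.exists_potential e
  have gper : ∀ t, g (t + 1) = g t := by
    intro t
    let ω : C(I, ℝ) := ⟨fun s => s * t, by fun_prop⟩
    have e1 : e.comp (ω + 1) = e.comp ω := ContinuousMap.ext fun s => per _
    have h1 := hg (ω + 1)
    rw [e1, hg] at h1
    have h2 := hg ⟨fun t : I => (t : ℝ), by fun_prop⟩
    rw [h0] at h2
    simp only [ContinuousMap.coe_mk, ContinuousMap.add_apply, ContinuousMap.one_apply,
      Set.Icc.coe_one, Set.Icc.coe_zero, zero_mul, one_mul, zero_add, ω] at h1 h2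
    linear_combination -h2 - h1
  have eper : ∀ (n : ℤ) t, e (t + n) = e t := fun n t =>
    (Function.Periodic.int_mul (c := (1 : ℝ)) per n t |> fun h => by simpa using h)
  have gper' : ∀ (n : ℤ) t, g (t + n) = g t := fun n t =>
    (Function.Periodic.int_mul (c := (1 : ℝ)) gper n t |> fun h => by simpa using h)
  have repr : ∀ x : E, ∃ q : A × ℝ, x = q.1 • e q.2 := by
    intro x
    obtain ⟨a, ha⟩ := hp.exists_smul (e ((2 * Real.pi)⁻¹ * Complex.arg (p x))) x (by
      rw [he, mul_inv_cancel_left₀ Real.two_pi_pos.ne', Circle.exp_arg])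
    exact ⟨(a, _), ha⟩
  choose q hq using repr
  have hψ : ∀ (a : A) t, χ (q (a • e t)).1 * g (q (a • e t)).2 = χ a * g t := by
    intro a t
    set b := (q (a • e t)).1
    set s := (q (a • e t)).2
    have h1 : a • e t = b • e s := hq (a • e t)
    have h2 : Circle.exp (2 * Real.pi * t) = Circle.exp (2 * Real.pi * s) := by
      have := congrArg p h1
      rwa [hp.map_smul, hp.map_smul, he, he] at this
    obtain ⟨n, hn⟩ := Circle.exp_eq_exp.1 h2
    have hts : t = s + n := by
      have := Real.two_pi_pos.ne'
      have h3 : (2 * Real.pi) * t = (2 * Real.pi) * (s + n) := by rw [hn]; ring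
      exact mul_left_cancel₀ this h3
    rw [hts, eper] at h1
    rw [hts, gper', hp.smul_right_cancel h1]
  refine ⟨fun x => χ (q x).1 * g (q x).2, fun a x => ?_, fun γ => ?_⟩
  · have := hψ (a * (q x).1) (q x).2
    rw [mul_smul, ← hq x, map_mul] at this
    exact this.trans (mul_assoc _ _ _)
  · obtain ⟨ω, hω⟩ := exists_circle_path_lift ⟨fun t => p (γ t), hp.continuous.comp γ.continuous⟩
    obtain ⟨a, ha⟩ := hp.exists_smul (e (ω 0)) (γ 0) ((he _).trans (hω 0))
    have hγ : γ = a • e.comp ω := hp.unique _ _ (fun t => by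
      rw [ContinuousMap.smul_apply, hp.map_smul]
      exact (hω t).symm.trans (he _).symm) 0 ha
    have h1 : γ 1 = a • e (ω 1) := DFunLike.congr_fun hγ 1
    rw [ha, h1]
    refine Eq.trans ?_ (congrArg₂ (· - ·) (hψ a (ω 1)) (hψ a (ω 0))).symm
    conv_lhs => rw [hγ]
    rw [hequiv, hg]
    ring

end

/-! ### Loops in the pair of pants -/

namespace ClosedPants

theorem mem_of_three_le_norm {z : ℂ} (h3 : 3 ≤ ‖z‖) (h4 : ‖z‖ ≤ 4) :
    ‖z‖ ≤ 4 ∧ 1 ≤ ‖z - 2‖ ∧ 1 ≤ ‖z + 2‖ := by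
  have h2 : ‖(2 : ℂ)‖ = 2 := by simp
  have h1 := norm_sub_norm_le z 2
  have h1' := norm_sub_norm_le z (-2)
  rw [norm_neg, sub_neg_eq_add] at h1'
  exact ⟨h4, by linarith, by linarith⟩

/-- In the part `-1 ≤ s * re z` of the disc, only the hole about `2 s` has to be avoided. -/
theorem mem_of_re {s : ℝ} (hs : s = 1 ∨ s = -1) {z : ℂ} (h4 : ‖z‖ ≤ 4)
    (h1 : 1 ≤ ‖z - (2 * s : ℝ)‖) (hre : -1 ≤ s * z.re) :
    ‖z‖ ≤ 4 ∧ 1 ≤ ‖z - 2‖ ∧ 1 ≤ ‖z + 2‖ := by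
  rcases hs with rfl | rfl
  · refine ⟨h4, by simpa using h1, ?_⟩
    have := (le_abs_self _).trans (Complex.abs_re_le_norm (z + 2))
    simp at this hre
    linarith
  · refine ⟨h4, ?_, by simpa using h1⟩
    have := (neg_le_abs _).trans (Complex.abs_re_le_norm (z - 2))
    simp at this hre
    linarith

theorem mem_interior_of_re {s : ℝ} (hs : s = 1 ∨ s = -1) {z : ClosedPants} (h4 : ‖z.1‖ < 4)
    (h1 : 1 < ‖z.1 - (2 * s : ℝ)‖) (hre : -1 < s * z.1.re) : z ∈ interior := by
  rcases hs with rfl | rfl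
  · refine ⟨h4, by simpa using h1, ?_⟩
    have := (le_abs_self _).trans (Complex.abs_re_le_norm (z.1 + 2))
    simp at this hre
    linarith
  · refine ⟨h4, ?_, by simpa using h1⟩
    have := (neg_le_abs _).trans (Complex.abs_re_le_norm (z.1 - 2))
    simp at this hre
    linarith

/-- The index of the boundary circle with centre `2 s`. -/
theorem exists_index {s : ℝ} (hs : s = 1 ∨ s = -1) :
    ∃ k : Fin 3, center k = (2 * s : ℝ) ∧ radius k = 1 := by
  rcases hs with rfl | rfl
  · exact ⟨1, by simp [center], by simp [radius]⟩
  · exact ⟨2, by simp [center], by simp [radius]⟩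

section Monodromy

variable {A : Type*} [CommGroup A] {E : Type*} [TopologicalSpace E] [MulAction A E]
  [ContinuousConstSMul A E] {p : E → ClosedPants}

/-- A loop which winds once around a boundary circle and can be pushed to it radially has the
monodromy of that circle. -/
theorem hasMonodromy_of_radial (hp : IsPrincipal A p) {k : Fin 3} {a : A}
    (ha : HasMonodromy p (circleLoop (boundaryCircle k)) a) (L : C(I, ClosedPants))
    (ρ ω : C(I, ℝ)) (hL : ∀ t, (L t).1 = center k + ρ t * (Circle.exp (ω t) : ℂ))
    (hρ : ρ 0 = ρ 1) (hω : ω 1 = ω 0 + 2 * Real.pi)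
    (hmem : ∀ s t : I, ‖center k + ((1 - s) * ρ t + s * radius k : ℝ) * (Circle.exp (ω t) : ℂ)‖ ≤ 4 ∧
      1 ≤ ‖center k + ((1 - s) * ρ t + s * radius k : ℝ) * (Circle.exp (ω t) : ℂ) - 2‖ ∧
      1 ≤ ‖center k + ((1 - s) * ρ t + s * radius k : ℝ) * (Circle.exp (ω t) : ℂ) + 2‖) :
    HasMonodromy p L a := by
  have hexp : Circle.exp (ω 0) = Circle.exp (ω 1) := by
    rw [hω]; exact (Circle.periodic_exp _).symm
  let h₁ : C(I × I, ClosedPants) := ⟨fun x => ⟨_, hmem x.1 x.2⟩, by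
    refine Continuous.subtype_mk ?_ _
    fun_prop⟩
  let h₂ : C(I × I, ClosedPants) := (boundaryCircle k).comp
    ⟨fun x => Circle.exp ((1 - x.1) * ω x.2 + x.1 * (2 * Real.pi * x.2)), by fun_prop⟩
  have e1 : squareRow h₁ 0 = L := by
    ext t
    refine Eq.trans ?_ (hL t).symm
    simp [squareRow, h₁]
  have e2 : squareRow h₁ 1 = squareRow h₂ 0 := by
    ext t
    simp [squareRow, h₁, h₂, boundaryCircle]
  have e3 : squareRow h₂ 1 = circleLoop (boundaryCircle k) := by
    ext t
    simp [squareRow, h₂, circleLoop]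
  rw [← e1]
  refine hp.hasMonodromy_homotopy h₁ (fun s => ?_) ?_
  · refine Subtype.ext ?_
    change center k + ((1 - s) * ρ 0 + s * radius k : ℝ) * (Circle.exp (ω 0) : ℂ) =
      center k + ((1 - s) * ρ 1 + s * radius k : ℝ) * (Circle.exp (ω 1) : ℂ)
    rw [hρ, hexp]
  rw [e2]
  refine hp.hasMonodromy_homotopy h₂ (fun s => ?_) (e3 ▸ ha)
  refine congrArg (boundaryCircle k) (Circle.exp_eq_exp.2 ⟨-1, ?_⟩)
  rw [hω]
  push_cast
  ring

/-- Rotation about a boundary circle, in its collar. -/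
theorem hasMonodromy_rotation (hp : IsPrincipal A p) {k : Fin 3} {a : A}
    (ha : HasMonodromy p (circleLoop (boundaryCircle k)) a) (L : C(I, ClosedPants)) (z : ℂ)
    (hL : ∀ t, (L t).1 = center k + (z - center k) * (Circle.exp (2 * Real.pi * t) : ℂ))
    (hz : ∀ w : ℂ, (∃ s : I, ‖w - center k‖ = (1 - s) * ‖z - center k‖ + s * radius k) →
      ‖w‖ ≤ 4 ∧ 1 ≤ ‖w - 2‖ ∧ 1 ≤ ‖w + 2‖) : HasMonodromy p L a := by
  have hr : 0 ≤ radius k := by fin_cases k <;> simp [radius]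
  refine hasMonodromy_of_radial hp ha L (ContinuousMap.const _ ‖z - center k‖)
    ⟨fun t => Complex.arg (z - center k) + 2 * Real.pi * t, by fun_prop⟩ (fun t => ?_) rfl
    (by simp) (fun s t => hz _ ⟨s, ?_⟩)
  · rw [hL]
    congr 1
    have := Complex.norm_mul_exp_arg_mul_I (z - center k)
    conv_lhs => rw [← this]
    simp only [ContinuousMap.const_apply, ContinuousMap.coe_mk, Circle.coe_exp]
    rw [mul_assoc, ← Complex.exp_add]
    push_cast
    ring_nf
  · rw [add_sub_cancel_left, norm_mul, Circle.norm_coe, mul_one, Complex.norm_real,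
      Real.norm_of_nonneg]
    · rfl
    · change 0 ≤ (1 - (s : ℝ)) * ‖z - center k‖ + s * radius k
      exact add_nonneg (mul_nonneg (sub_nonneg.2 s.2.2) (norm_nonneg _)) (mul_nonneg s.2.1 hr)

end Monodromy

end ClosedPants

/-- Composing a principal covering with a homeomorphism of its base. -/
theorem IsPrincipal.comp_homeomorph {A : Type*} [CommGroup A] {E Y Z : Type*} [TopologicalSpace E]
    [TopologicalSpace Y] [TopologicalSpace Z] [MulAction A E] {p : E → Y} (hp : IsPrincipal A p)
    (u : Y ≃ₜ Z) : IsPrincipal A (fun e => u (p e)) where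
  continuous := u.continuous.comp hp.continuous
  surjective := u.surjective.comp hp.surjective
  map_smul a e := congrArg u (hp.map_smul a e)
  exists_smul e e' h := hp.exists_smul e e' (u.injective h)
  free := hp.free
  lift h σ hσ := by
    obtain ⟨H, hH, h0⟩ := hp.lift ((u.symm : C(Z, Y)).comp h) σ fun s =>
      u.injective ((hσ s).trans (u.apply_symm_apply _).symm)
    exact ⟨H, fun x => (congrArg u (hH x)).trans (u.apply_symm_apply _), h0⟩
  unique σ τ h t ht := hp.unique σ τ (fun t => u.injective (h t)) t ht

theorem HasMonodromy.comp_homeomorph {A : Type*} [CommGroup A] {E Y Z : Type*} [TopologicalSpace E]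
    [TopologicalSpace Y] [TopologicalSpace Z] [MulAction A E] {p : E → Y} (u : Y ≃ₜ Z)
    {L : C(I, Z)} {a : A} (h : HasMonodromy p ((u.symm : C(Z, Y)).comp L) a) :
    HasMonodromy (fun e => u (p e)) L a := fun Γ hΓ =>
  h Γ fun t => (u.symm_apply_apply (p (Γ t))).symm.trans (congrArg u.symm (hΓ t))

namespace PairOfPants

variable {S : Type*} [TopologicalSpace S] (P : PairOfPants S)

/-- The parametrization of the open pair of pants. -/
def homeo : ClosedPants.interior ≃ₜ P.carrier :=
  P.isOpenEmbedding.toHomeomorph.trans (Homeomorph.setCongr (by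
    rw [carrier, Set.image_eq_range]))

theorem homeo_apply (z : ClosedPants.interior) : (P.homeo z : S) = P.toMap z.1 := rfl

theorem isOpen_carrier : IsOpen P.carrier := by
  have := P.isOpenEmbedding.isOpen_range
  rwa [carrier, Set.image_eq_range]

theorem toMap_homeo_symm (y : P.carrier) : P.toMap (P.homeo.symm y).1 = y := by
  rw [← homeo_apply, Homeomorph.apply_symm_apply]

end PairOfPants

/-! ### The homology of the open pair of pants -/

namespace ClosedPants

/-- The progress of a radial motion inward, a pause, and the same motion back. -/
def radialPhase (t : ℝ) : ℝ := min 1 (min (3 * t) (3 - 3 * t))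

/-- The angle of a full turn performed during the pause of `radialPhase`. -/
def angularPhase (t : ℝ) : ℝ := 2 * Real.pi * max 0 (min 1 (3 * t - 1))

/-- The distance from the centre during the motion, starting at distance `n`; the turn is performed
at distance `6 / 5`. -/
def radiusPhase (n t : ℝ) : ℝ := (1 - radialPhase t) * n + 6 / 5 * radialPhase t

theorem radialPhase_nonneg (t : I) : 0 ≤ radialPhase t :=
  le_min zero_le_one (le_min (by linarith [t.2.1]) (by linarith [t.2.2]))

theorem radialPhase_le (t : ℝ) : radialPhase t ≤ 1 := min_le_left _ _

theorem radialPhase_eq_one_or (t : ℝ) : radialPhase t = 1 ∨ Circle.exp (angularPhase t) = 1 := by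
  by_cases h1 : 3 * t ≤ 1
  · right
    rw [angularPhase, max_eq_left ((min_le_right _ _).trans (by linarith)), mul_zero,
      Circle.exp_zero]
  by_cases h2 : 2 ≤ 3 * t
  · right
    rw [angularPhase, min_eq_left (by linarith), max_eq_right zero_le_one, mul_one,
      Circle.exp_two_pi]
  · left
    exact min_eq_left (le_min (by linarith) (by linarith))

theorem one_lt_radiusPhase {n : ℝ} (hn : 1 < n) (t : I) : 1 < radiusPhase n t := by
  have h0 := radialPhase_nonneg t
  have h1 := radialPhase_le t
  rw [radiusPhase]
  rcases h0.eq_or_lt with h | h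
  · rw [← h]; linarith
  · nlinarith [mul_nonneg (sub_nonneg.2 h1) (sub_nonneg.2 hn.le)]

theorem one_le_radiusPhase {n : ℝ} (hn : 1 < n) (t : I) : 1 ≤ radiusPhase n t :=
  (one_lt_radiusPhase hn t).le

/-- Far from the centre, the motion is still in its radial phase. -/
theorem radiusPhase_le_or {n : ℝ} (t : I) : radiusPhase n t ≤ 6 / 5 ∨
    (Circle.exp (angularPhase t) = 1 ∧ radiusPhase n t ≤ n) := by
  have h0 := radialPhase_nonneg t
  have h1 := radialPhase_le t
  by_cases h : radiusPhase n t ≤ 6 / 5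
  · exact Or.inl h
  · refine Or.inr ⟨(radialPhase_eq_one_or t).resolve_left fun h2 => h ?_, ?_⟩
    · rw [radiusPhase, h2]; linarith
    · rw [radiusPhase] at h ⊢
      have hn : 6 / 5 ≤ n := by
        by_contra hn
        exact h (by nlinarith [mul_nonneg (sub_nonneg.2 h1) (sub_nonneg.2 (not_le.1 hn).le)])
      nlinarith [mul_nonneg h0 (sub_nonneg.2 hn)]

/-- The points visited by the motion stay in the half of the pants around the centre `2 s`. -/
theorem norm_lt_and_re_gt {s : ℝ} (hs : s = 1 ∨ s = -1) {z w : ℂ} (hz : ‖z‖ < 4)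
    (hre : -(1 / 2) < s * z.re) (hw : ‖w‖ = 1) {r : ℝ} (hr : 0 ≤ r)
    (h : r ≤ 6 / 5 ∨ (z - (2 * s : ℝ) = ‖z - (2 * s : ℝ)‖ * w ∧ r ≤ ‖z - (2 * s : ℝ)‖)) :
    ‖((2 * s : ℝ) : ℂ) + r * w‖ < 4 ∧ -(1 / 2) < s * (((2 * s : ℝ) : ℂ) + r * w).re := by
  have hss : s * s = 1 := by rcases hs with rfl | rfl <;> norm_num
  have hs1 : |s| = 1 := by rcases hs with rfl | rfl <;> simp
  have hn2 : ‖((2 * s : ℝ) : ℂ)‖ = 2 := by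
    rw [Complex.norm_real, norm_mul, Real.norm_eq_abs, Real.norm_eq_abs, hs1]; norm_num
  rcases h with h | ⟨h1, h2⟩
  · constructor
    · have := norm_add_le ((2 * s : ℝ) : ℂ) (r * w)
      rw [hn2, norm_mul, hw, Complex.norm_real, Real.norm_of_nonneg hr] at this
      linarith
    · have h3 : |s * w.re| ≤ 1 := by
        rw [abs_mul, hs1, one_mul, ← hw]; exact Complex.abs_re_le_norm w
      have h4 := (abs_le.1 h3).1
      have e : s * (((2 * s : ℝ) : ℂ) + r * w).re = 2 + r * (s * w.re) := by
        simp
        linear_combination 2 * hss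
      rw [e]
      nlinarith
  · set n := ‖z - (2 * s : ℝ)‖ with hn
    rcases hr.eq_or_lt with rfl | hr0
    · constructor
      · simp only [Complex.ofReal_zero, zero_mul, add_zero, hn2]; norm_num
      · simp
        nlinarith
    have hn0 : 0 < n := hr0.trans_le h2
    have hc : ((2 * s : ℝ) : ℂ) + r * w = ((1 - r / n : ℝ) : ℂ) * (2 * s : ℝ) + (r / n : ℝ) * z := by
      have hz' : z = (2 * s : ℝ) + n * w := by rw [← h1]; ring
      rw [hz']
      push_cast
      have : (n : ℂ) ≠ 0 := by exact_mod_cast hn0.ne'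
      field_simp
      ring
    have hl0 : 0 < r / n := by positivity
    have hl1 : r / n ≤ 1 := (div_le_one hn0).2 h2
    generalize r / n = l at hc hl0 hl1
    rw [hc]
    constructor
    · refine (norm_add_le _ _).trans_lt ?_
      rw [norm_mul, norm_mul, hn2, Complex.norm_real, Complex.norm_real, Real.norm_of_nonneg hl0.le,
        Real.norm_of_nonneg (by linarith)]
      nlinarith
    · have e : s * (((1 - l : ℝ) : ℂ) * (2 * s : ℝ) + (l : ℝ) * z).re =
          (1 - l) * 2 + l * (s * z.re) := by
        simp
        linear_combination 2 * (1 - l) * hss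
      rw [e]
      nlinarith

/-- One half of the open pair of pants. -/
def halfPants (s : ℝ) : Set interior := {z | -(1 / 2) < s * z.1.1.re}

theorem one_lt_norm_sub {s : ℝ} (hs : s = 1 ∨ s = -1) (z : interior) :
    1 < ‖z.1.1 - (2 * s : ℝ)‖ := by
  rcases hs with rfl | rfl
  · simpa using z.2.2.1
  · simpa using z.2.2.2

/-- The loop which goes radially towards the boundary circle about `2 s`, around it and back. -/
theorem exists_halfPants_loops {s : ℝ} (hs : s = 1 ∨ s = -1) :
    ∃ l : C(halfPants s × I, interior), ∀ y t, (l (y, t)).1.1 = (2 * s : ℝ) +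
      (radiusPhase ‖y.1.1.1 - (2 * s : ℝ)‖ t : ℝ) *
        (Circle.exp (Complex.arg (y.1.1.1 - (2 * s : ℝ)) + angularPhase t) : ℂ) := by
  have harg : ∀ w : ℂ, (‖w‖ : ℂ) * (Circle.exp (Complex.arg w) : ℂ) = w := fun w => by
    rw [Circle.coe_exp]; exact Complex.norm_mul_exp_arg_mul_I w
  have key : ∀ (y : halfPants s) (t : I), ((2 * s : ℝ) : ℂ) +
      (radiusPhase ‖y.1.1.1 - (2 * s : ℝ)‖ t : ℝ) *
        (Circle.exp (Complex.arg (y.1.1.1 - (2 * s : ℝ)) + angularPhase t) : ℂ) = (2 * s : ℝ) +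
      (radiusPhase ‖y.1.1.1 - (2 * s : ℝ)‖ t / ‖y.1.1.1 - (2 * s : ℝ)‖ : ℝ) *
        (y.1.1.1 - (2 * s : ℝ)) * (Circle.exp (angularPhase t) : ℂ) := by
    intro y t
    have h1 := one_lt_norm_sub hs y.1
    have h2 := harg (y.1.1.1 - (2 * s : ℝ))
    set w := y.1.1.1 - (2 * s : ℝ)
    have h0 : (‖w‖ : ℂ) ≠ 0 := by exact_mod_cast (zero_lt_one.trans h1).ne'
    rw [Circle.exp_add, Circle.coe_mul, Complex.ofReal_div]
    nth_rewrite 5 [← h2]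
    field_simp
  have bounds : ∀ (y : halfPants s) (t : I), ‖((2 * s : ℝ) : ℂ) +
      (radiusPhase ‖y.1.1.1 - (2 * s : ℝ)‖ t : ℝ) *
        (Circle.exp (Complex.arg (y.1.1.1 - (2 * s : ℝ)) + angularPhase t) : ℂ)‖ < 4 ∧ 
      -(1 / 2) < s * (((2 * s : ℝ) : ℂ) +
      (radiusPhase ‖y.1.1.1 - (2 * s : ℝ)‖ t : ℝ) *
        (Circle.exp (Complex.arg (y.1.1.1 - (2 * s : ℝ)) + angularPhase t) : ℂ)).re := by
    intro y t
    have h1 := one_lt_norm_sub hs y.1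
    refine norm_lt_and_re_gt hs y.1.2.1 y.2 (Circle.norm_coe _)
      (zero_le_one.trans (one_le_radiusPhase h1 t)) ((radiusPhase_le_or t).imp_right fun h => ?_)
    rw [Circle.exp_add, h.1, mul_one, harg]
    exact ⟨rfl, h.2⟩
  have dist : ∀ (y : halfPants s) (t : I), 1 < ‖((2 * s : ℝ) : ℂ) +
      (radiusPhase ‖y.1.1.1 - (2 * s : ℝ)‖ t : ℝ) *
        (Circle.exp (Complex.arg (y.1.1.1 - (2 * s : ℝ)) + angularPhase t) : ℂ) - (2 * s : ℝ)‖ := by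
    intro y t
    have h1 := one_lt_radiusPhase (one_lt_norm_sub hs y.1) t
    rw [add_sub_cancel_left, norm_mul, Circle.norm_coe, mul_one, Complex.norm_real,
      Real.norm_of_nonneg (zero_le_one.trans h1.le)]
    exact h1
  refine ⟨⟨fun x => ⟨⟨_, mem_of_re hs (bounds x.1 x.2).1.le (dist x.1 x.2).le
    (by linarith [(bounds x.1 x.2).2])⟩, mem_interior_of_re hs (bounds x.1 x.2).1 (dist x.1 x.2)
    (by linarith [(bounds x.1 x.2).2])⟩, ?_⟩, fun y t => rfl⟩
  refine Continuous.subtype_mk (Continuous.subtype_mk ?_ _) _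
  simp only [key]
  have hne : ∀ x : halfPants s × I, ‖x.1.1.1.1 - (2 * s : ℝ)‖ ≠ 0 := fun x =>
    (zero_lt_one.trans (one_lt_norm_sub hs x.1.1)).ne'
  unfold radiusPhase radialPhase angularPhase
  fun_prop (disch := exact hne)

variable {A : Type*} [CommGroup A] {E Q : Type*} [TopologicalSpace E] [MulAction A E]
  [ContinuousConstSMul A E] {p : E → interior} [TopologicalSpace Q] [MulAction A Q]
  [ContinuousConstSMul A Q] {q : Q → ClosedPants}

/-- On each half of the open pants, equivariant cocycles have a canonical potential.  The covering
`q` of the closed pants serves to express that the boundary circles have nontrivial monodromy. -/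
theorem exists_potential_halfPants {F : Type*} [Field F] (χ : A →* F) (hp : IsPrincipal A p)
    (hq : IsPrincipal A q)
    (hpq : ∀ (L : C(I, interior)) (a : A), L 0 = L 1 →
      HasMonodromy q (ContinuousMap.comp ⟨Subtype.val, continuous_subtype_val⟩ L) a →
      HasMonodromy p L a)
    (hmon : ∀ k, ∃ a : A, HasMonodromy q (circleLoop (boundaryCircle k)) a ∧ χ a ≠ 1)
    {s : ℝ} (hs : s = 1 ∨ s = -1) :
    ∃ Ψ : (C(I, E) → F) →ₗ[F] (E → F), ∀ θ : C(I, E) → F, IsCocycleOn Set.univ θ →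
      (∀ (a : A) σ, θ (a • σ) = χ a * θ σ) → (∀ (a : A) e, Ψ θ (a • e) = χ a * Ψ θ e) ∧
      ∀ σ : C(I, E), (∀ t, p (σ t) ∈ halfPants s) → θ σ = Ψ θ (σ 1) - Ψ θ (σ 0) := by
  obtain ⟨l, hl⟩ := exists_halfPants_loops hs
  obtain ⟨k, hk, hk1⟩ := exists_index hs
  obtain ⟨a, ha, ha1⟩ := hmon k
  have harg : ∀ w : ℂ, (‖w‖ : ℂ) * (Circle.exp (Complex.arg w) : ℂ) = w := fun w => by
    rw [Circle.coe_exp]; exact Complex.norm_mul_exp_arg_mul_I w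
  have r0 : ∀ n, radiusPhase n 0 = n := fun n => by simp [radiusPhase, radialPhase]
  have r1 : ∀ n, radiusPhase n 1 = n := fun n => by simp [radiusPhase, radialPhase]
  have a0 : angularPhase 0 = 0 := by simp [angularPhase]
  have a1 : angularPhase 1 = 2 * Real.pi := by norm_num [angularPhase]
  have hl0 : ∀ y : halfPants s, l (y, 0) = y := fun y => Subtype.ext (Subtype.ext (by
    rw [hl, Set.Icc.coe_zero, r0, a0, add_zero, harg]; ring))
  have hl1 : ∀ y : halfPants s, l (y, 1) = y := fun y => Subtype.ext (Subtype.ext (by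
    rw [hl, Set.Icc.coe_one, r1, a1, Circle.periodic_exp, harg]; ring))
  refine hp.exists_potential_of_loops χ (halfPants s) l hl0 hl1 fun y => ⟨a, hpq _ _ ?_ ?_, ha1⟩
  · exact (hl0 y).trans (hl1 y).symm
  have hy := one_lt_norm_sub hs y.1
  refine hasMonodromy_of_radial hq ha _
    ⟨fun t : I => radiusPhase ‖y.1.1.1 - (2 * s : ℝ)‖ t, by
      unfold radiusPhase radialPhase; fun_prop⟩
    ⟨fun t : I => Complex.arg (y.1.1.1 - (2 * s : ℝ)) + angularPhase t, by
      unfold angularPhase; fun_prop⟩ (fun t => ?_) ?_ ?_ (fun v t => ?_)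
  · rw [hk]; exact hl y t
  · simp only [ContinuousMap.coe_mk, Set.Icc.coe_zero, Set.Icc.coe_one, r0, r1]
  · simp only [ContinuousMap.coe_mk, Set.Icc.coe_zero, Set.Icc.coe_one, a0, a1, add_zero]
  rw [hk, hk1]
  simp only [ContinuousMap.coe_mk]
  have h1 := one_le_radiusPhase hy t
  have hv0 := v.2.1
  have hv1 := v.2.2
  set r := radiusPhase ‖y.1.1.1 - (2 * s : ℝ)‖ t with hr
  have hge : 1 ≤ (1 - (v : ℝ)) * r + v * 1 := by nlinarith
  have hle : (1 - (v : ℝ)) * r + v * 1 ≤ r := by nlinarith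
  have hb := norm_lt_and_re_gt hs y.1.2.1 y.2
    (Circle.norm_coe (Circle.exp (Complex.arg (y.1.1.1 - (2 * s : ℝ)) + angularPhase t)))
    (zero_le_one.trans hge) ((radiusPhase_le_or t).imp (fun h => hle.trans h) fun h => by
      refine ⟨?_, hle.trans h.2⟩
      rw [Circle.exp_add, h.1, mul_one, harg])
  refine mem_of_re hs hb.1.le ?_ (by linarith [hb.2])
  rw [add_sub_cancel_left, norm_mul, Circle.norm_coe, mul_one, Complex.norm_real,
      Real.norm_of_nonneg (zero_le_one.trans hge)]
  exact hge

/-- A single linear condition forces an equivariant cocycle over the open pants to be exact: the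
canonical potentials on the two halves have to agree at one point over their intersection. -/
theorem exists_exactness_condition {F : Type*} [Field F] (χ : A →* F) (hp : IsPrincipal A p)
    (hq : IsPrincipal A q)
    (hpq : ∀ (L : C(I, interior)) (a : A), L 0 = L 1 →
      HasMonodromy q (ContinuousMap.comp ⟨Subtype.val, continuous_subtype_val⟩ L) a →
      HasMonodromy p L a)
    (hmon : ∀ k, ∃ a : A, HasMonodromy q (circleLoop (boundaryCircle k)) a ∧ χ a ≠ 1) :
    ∃ κ : (C(I, E) → F) →ₗ[F] F, ∀ θ : C(I, E) → F, IsCocycleOn Set.univ θ →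
      (∀ (a : A) σ, θ (a • σ) = χ a * θ σ) → κ θ = 0 →
      ∃ ψ : E → F, (∀ (a : A) e, ψ (a • e) = χ a * ψ e) ∧ ∀ γ, θ γ = ψ (γ 1) - ψ (γ 0) := by
  classical
  obtain ⟨Ψ, hΨ⟩ := exists_potential_halfPants χ hp hq hpq hmon (s := 1) (Or.inl rfl)
  obtain ⟨Ψ', hΨ'⟩ := exists_potential_halfPants χ hp hq hpq hmon (s := -1) (Or.inr rfl)
  let o : interior := ⟨⟨0, by norm_num⟩, by simp [interior]⟩
  obtain ⟨x₀, hx₀⟩ := hp.surjective o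
  refine ⟨(LinearMap.proj x₀).comp (Ψ - Ψ'), fun θ hθ hequiv hκ => ?_⟩
  obtain ⟨he, hi⟩ := hΨ θ hθ hequiv
  obtain ⟨he', hi'⟩ := hΨ' θ hθ hequiv
  have hκ' : Ψ θ x₀ = Ψ' θ x₀ := sub_eq_zero.1 hκ
  -- the two potentials agree over the strip common to the two halves, which is convex
  have agree : ∀ x, p x ∈ halfPants 1 → p x ∈ halfPants (-1) → Ψ θ x = Ψ' θ x := by
    intro x hx hx'
    have hre : |(p x).1.1.re| < 1 / 2 := by
      rw [abs_lt]; constructor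
      · simpa [halfPants] using hx
      · have : -(1 / 2) < -1 * (p x).1.1.re := hx'
        linarith
    have hre' : ∀ t : I, |((t : ℝ) * (p x).1.1 : ℂ).re| < 1 / 2 := by
      intro t
      simp only [Complex.mul_re, Complex.ofReal_re, Complex.ofReal_im, zero_mul, sub_zero, abs_mul,
        abs_of_nonneg t.2.1]
      nlinarith [abs_nonneg (p x).1.1.re, t.2.1, t.2.2]
    have hnorm : ∀ t : I, ‖((t : ℝ) * (p x).1.1 : ℂ)‖ < 4 := by
      intro t
      rw [norm_mul, Complex.norm_real, Real.norm_of_nonneg t.2.1]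
      have : ‖(p x).1.1‖ < 4 := (p x).2.1
      nlinarith [norm_nonneg (p x).1.1, t.2.1, t.2.2]
    have hd : ∀ t : I, 1 < ‖((t : ℝ) * (p x).1.1 : ℂ) - (2 * 1 : ℝ)‖ := by
      intro t
      have h1 := (neg_le_abs _).trans (Complex.abs_re_le_norm
        (((t : ℝ) * (p x).1.1 : ℂ) - (2 * 1 : ℝ)))
      have h2 := (abs_lt.1 (hre' t)).2
      rw [Complex.sub_re, Complex.ofReal_re] at h1
      linarith
    have hm : ∀ t : I, -1 < 1 * ((t : ℝ) * (p x).1.1 : ℂ).re := fun t => by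
      linarith [(abs_lt.1 (hre' t)).1]
    let L : C(I, interior) := ⟨fun t => ⟨⟨(t : ℝ) * (p x).1.1,
      mem_of_re (Or.inl rfl) (hnorm t).le (hd t).le (hm t).le⟩,
      mem_interior_of_re (Or.inl rfl) (hnorm t) (hd t) (hm t)⟩, by
        refine Continuous.subtype_mk (Continuous.subtype_mk ?_ _) _
        fun_prop⟩
    obtain ⟨Γ, hΓ, hΓ0⟩ := hp.exists_path_lift L x₀ (by
      rw [hx₀]; exact Subtype.ext (Subtype.ext (by simp [L, o])))
    have hΓ1 : p (Γ 1) = p x := by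
      rw [hΓ]; exact Subtype.ext (Subtype.ext (by simp [L]))
    obtain ⟨a, ha⟩ := hp.exists_smul _ _ hΓ1
    have h1 := hi Γ fun t => by
      rw [hΓ]
      change -(1 / 2) < 1 * ((t : ℝ) * (p x).1.1 : ℂ).re
      linarith [(abs_lt.1 (hre' t)).1]
    have h2 := hi' Γ fun t => by
      rw [hΓ]
      change -(1 / 2) < -1 * ((t : ℝ) * (p x).1.1 : ℂ).re
      linarith [(abs_lt.1 (hre' t)).2]
    rw [hΓ0] at h1 h2
    rw [ha, he, he']
    congr 1
    linear_combination h2 - h1 + hκ'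
  have cover : ∀ z : interior, z ∈ halfPants 1 ∨ z ∈ halfPants (-1) := by
    intro z
    by_cases h : -(1 / 2) < 1 * z.1.1.re
    · exact Or.inl h
    · right
      change -(1 / 2) < -1 * z.1.1.re
      linarith
  let ψ : E → F := fun x => if p x ∈ halfPants 1 then Ψ θ x else Ψ' θ x
  have hψ : ∀ x, p x ∈ halfPants 1 → ψ x = Ψ θ x := fun x hx => if_pos hx
  have hψ' : ∀ x, p x ∈ halfPants (-1) → ψ x = Ψ' θ x := by
    intro x hx
    by_cases h : p x ∈ halfPants 1
    · rw [hψ x h, agree x h hx]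
    · exact if_neg h
  refine ⟨ψ, fun a x => ?_, fun γ => ?_⟩
  · rcases cover (p x) with h | h
    · rw [hψ x h, hψ _ (by rwa [hp.map_smul]), he]
    · rw [hψ' x h, hψ' _ (by rwa [hp.map_smul]), he']
  · have hopen : ∀ s : ℝ, IsOpen (p ⁻¹' halfPants s) := fun s => by
      refine IsOpen.preimage hp.continuous (isOpen_lt continuous_const ?_)
      fun_prop
    have := (hθ.sub (isCocycleOn_increment Set.univ ψ)).eq_zero_of_locally (fun x _ => by
      rcases cover (p x) with h | h
      · refine ⟨_, hopen 1, h, fun σ hσ _ => ?_⟩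
        change θ σ - (ψ (σ 1) - ψ (σ 0)) = 0
        rw [hi σ hσ, hψ _ (hσ 0), hψ _ (hσ 1), sub_self]
      · refine ⟨_, hopen (-1), h, fun σ hσ _ => ?_⟩
        change θ σ - (ψ (σ 1) - ψ (σ 0)) = 0
        rw [hi' σ hσ, hψ' _ (hσ 0), hψ' _ (hσ 1), sub_self]) (σ := γ) fun _ => Set.mem_univ _
    exact sub_eq_zero.1 this

end ClosedPants

/-! ### The cocycle dual to an arc -/

/-- Over a contractible set, a principal covering has a locally constant equivariant coordinate. -/
theorem IsPrincipal.exists_coordinate {A : Type*} [CommGroup A] {E Y : Type*} [TopologicalSpace E]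
    [TopologicalSpace Y] [MulAction A E] [ContinuousConstSMul A E] {p : E → Y}
    (hp : IsPrincipal A p) (U : Set Y) (l : C(U × I, Y)) (y₀ : Y) (hl0 : ∀ y, l (y, 0) = y)
    (hl1 : ∀ y, l (y, 1) = y₀) :
    ∃ w : E → A, (∀ (a : A) x, p x ∈ U → w (a • x) = a * w x) ∧
      ∀ σ : C(I, E), (∀ t, p (σ t) ∈ U) → w (σ 0) = w (σ 1) := by
  classical
  obtain ⟨x₀, hx₀⟩ := hp.surjective y₀
  choose Γ hΓ hΓ0 using fun e : {e : E // p e ∈ U} => hp.exists_path_lift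
    (l.comp ⟨fun t => (⟨p e.1, e.2⟩, t), by fun_prop⟩) e.1 (hl0 ⟨p e.1, e.2⟩).symm
  choose b hb using fun e : {e : E // p e ∈ U} => hp.exists_smul x₀ (Γ e 1)
    (hx₀.trans ((hΓ e 1).trans (hl1 _)).symm)
  refine ⟨fun e => if h : p e ∈ U then b ⟨e, h⟩ else 1, fun a x hx => ?_, fun σ hσ => ?_⟩
  · have hax : p (a • x) ∈ U := by rwa [hp.map_smul]
    simp only [dif_pos hx, dif_pos hax]
    have e1 : Γ ⟨a • x, hax⟩ = a • Γ ⟨x, hx⟩ := hp.unique _ _ (fun t => (hΓ _ t).trans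
      ((congrArg (fun y => l (y, t)) (Subtype.ext (hp.map_smul a x))).trans
        ((hp.map_smul a _).trans (hΓ ⟨x, hx⟩ t)).symm)) 0 (by rw [ContinuousMap.smul_apply, hΓ0, hΓ0])
    have e2 := DFunLike.congr_fun e1 1
    rw [ContinuousMap.smul_apply, hb, hb ⟨x, hx⟩, smul_smul] at e2
    exact hp.smul_right_cancel e2
  · simp only [dif_pos (hσ 0), dif_pos (hσ 1)]
    let h : C(I × I, Y) := l.comp ⟨fun x => (⟨p (σ x.1), hσ x.1⟩, x.2), by
      have := hp.continuous
      fun_prop⟩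
    obtain ⟨H, hH, hH0⟩ := hp.lift h σ fun s => (hl0 ⟨p (σ s), hσ s⟩).symm
    have row : ∀ s : I, squareRow H s = Γ ⟨σ s, hσ s⟩ := fun s =>
      hp.unique _ _ (fun t => (hH (s, t)).trans (hΓ ⟨σ s, hσ s⟩ t).symm) 0
        ((hH0 s).trans (hΓ0 ⟨σ s, hσ s⟩).symm)
    have col : squareCol H 1 = ContinuousMap.const I (H (0, 1)) :=
      hp.unique _ _ (fun s => (hH (s, 1)).trans ((hl1 _).trans
        ((hH (0, 1)).trans (hl1 _)).symm)) 0 rfl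
    have e0 : H (0, 1) = b ⟨σ 0, hσ 0⟩ • x₀ := (DFunLike.congr_fun (row 0) 1).trans (hb _)
    have e1 : H (1, 1) = b ⟨σ 1, hσ 1⟩ • x₀ := (DFunLike.congr_fun (row 1) 1).trans (hb _)
    have e2 : H (1, 1) = H (0, 1) := DFunLike.congr_fun col 1
    exact hp.smul_right_cancel (e0.symm.trans (e2.symm.trans e1))

namespace ClosedPants

/-- A neighbourhood of the arc which joins the top of the boundary circle about `2 s` vertically
to the outer boundary circle. -/
def arcNhd (s : ℝ) : Set ClosedPants := {z | |z.1.re - 2 * s| < 3 / 5 ∧ 0 < z.1.im}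

/-- The complement of the vertical arc from the top of the boundary circle about `2 s`. -/
def offArc (s : ℝ) : Set ClosedPants := {z | z.1.re ≠ 2 * s ∨ z.1.im < 0}

theorem isOpen_arcNhd (s : ℝ) : IsOpen (arcNhd s) := by
  have h1 : IsOpen {z : ClosedPants | |z.1.re - 2 * s| < 3 / 5} :=
    isOpen_lt (by fun_prop) continuous_const
  have h2 : IsOpen {z : ClosedPants | 0 < z.1.im} := isOpen_lt continuous_const (by fun_prop)
  exact h1.inter h2

theorem isOpen_offArc (s : ℝ) : IsOpen (offArc s) := by
  have h1 : IsOpen {z : ClosedPants | z.1.re ≠ 2 * s} := isOpen_ne_fun (by fun_prop) continuous_const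
  have h2 : IsOpen {z : ClosedPants | z.1.im < 0} := isOpen_lt (by fun_prop) continuous_const
  exact h1.union h2

theorem one_le_norm_sub {s : ℝ} (hs : s = 1 ∨ s = -1) (z : ClosedPants) :
    1 ≤ ‖z.1 - (2 * s : ℝ)‖ := by
  rcases hs with rfl | rfl
  · simpa using z.2.2.1
  · simpa using z.2.2.2

theorem mem_arcNhd_or {s : ℝ} (hs : s = 1 ∨ s = -1) (z : ClosedPants) :
    z ∈ arcNhd s ∨ z ∈ offArc s := by
  by_cases h : z.1.re = 2 * s
  · rcases lt_trichotomy z.1.im 0 with h1 | h1 | h1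
    · exact Or.inr (Or.inr h1)
    · have := one_le_norm_sub hs z
      have e : z.1 - (2 * s : ℝ) = 0 := Complex.ext (by simp [h]) (by simp [h1])
      rw [e, norm_zero] at this
      norm_num at this
    · exact Or.inl ⟨by rw [h, sub_self, abs_zero]; norm_num, h1⟩
  · exact Or.inr (Or.inl h)

/-- The neighbourhood of the arc is star-shaped about the point at height `3 / 2`. -/
theorem exists_arcNhd_contraction {s : ℝ} (hs : s = 1 ∨ s = -1) :
    ∃ (y₀ : ClosedPants) (l : C(arcNhd s × I, ClosedPants)), (∀ y, l (y, 0) = y) ∧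
      ∀ y, l (y, 1) = y₀ := by
  have hss : s * s = 1 := by rcases hs with rfl | rfl <;> norm_num
  have hn : ∀ w : ℂ, ‖w‖ ^ 2 = w.re ^ 2 + w.im ^ 2 := fun w => by
    rw [Complex.sq_norm, Complex.normSq_apply]; ring
  let o : ℂ := ⟨2 * s, 3 / 2⟩
  have ho : ‖o‖ ≤ 4 := by
    refine (pow_le_pow_iff_left₀ (norm_nonneg _) (by norm_num) two_ne_zero).1 ?_
    rw [hn]
    change (2 * s) ^ 2 + (3 / 2) ^ 2 ≤ _
    nlinarith
  have hmem : ∀ (y : arcNhd s) (t : I),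
      ‖((1 - t : ℝ) : ℂ) * y.1.1 + (t : ℝ) * o‖ ≤ 4 ∧
      1 ≤ ‖((1 - t : ℝ) : ℂ) * y.1.1 + (t : ℝ) * o - 2‖ ∧
      1 ≤ ‖((1 - t : ℝ) : ℂ) * y.1.1 + (t : ℝ) * o + 2‖ := by
    intro y t
    obtain ⟨h1, h2⟩ := y.2
    have h0 := t.2.1
    have h0' : 0 ≤ 1 - (t : ℝ) := sub_nonneg.2 t.2.2
    have hd := one_le_norm_sub hs y.1
    have hy4 := y.1.2.1
    set z := y.1.1
    generalize (t : ℝ) = t at h0 h0'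
    refine mem_of_re hs ?_ ?_ ?_
    · refine (norm_add_le _ _).trans ?_
      rw [norm_mul, norm_mul, Complex.norm_real, Complex.norm_real, Real.norm_of_nonneg h0,
        Real.norm_of_nonneg h0']
      nlinarith
    · have h3 : 1 ≤ (z.re - 2 * s) ^ 2 + z.im ^ 2 := by
        have := pow_le_pow_left₀ zero_le_one hd 2
        rw [hn] at this
        simpa using this
      have h4 : (z.re - 2 * s) ^ 2 ≤ (3 / 5) ^ 2 := sq_le_sq' (by linarith [(abs_lt.1 h1).1])
        (abs_lt.1 h1).2.le
      have h5 : 4 / 5 ≤ z.im := by nlinarith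
      refine (pow_le_pow_iff_left₀ zero_le_one (norm_nonneg _) two_ne_zero).1 ?_
      rw [hn, one_pow]
      have e1 : (((1 - t : ℝ) : ℂ) * z + (t : ℝ) * o - (2 * s : ℝ)).re = (1 - t) * (z.re - 2 * s) := by
        simp [o]; ring
      have e2 : (((1 - t : ℝ) : ℂ) * z + (t : ℝ) * o - (2 * s : ℝ)).im = (1 - t) * z.im + t * (3 / 2)
        := by simp [o]
      rw [e1, e2]
      have h6 : 0 ≤ (1 - t) ^ 2 * ((z.re - 2 * s) ^ 2 + z.im ^ 2 - 1) :=
        mul_nonneg (sq_nonneg _) (by linarith)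
      have h7 : 0 ≤ (1 - t) * t * (z.im - 4 / 5) := mul_nonneg (mul_nonneg h0' h0) (by linarith)
      nlinarith [mul_nonneg h0' h0]
    · have e : s * (((1 - t : ℝ) : ℂ) * z + (t : ℝ) * o).re =
          2 + (1 - t) * (s * (z.re - 2 * s)) := by
        simp [o]
        linear_combination 2 * hss
      have h3 : |s * (z.re - 2 * s)| ≤ 3 / 5 := by
        rw [abs_mul]
        rcases hs with rfl | rfl <;> simpa using h1.le
      rw [e]
      nlinarith [(abs_le.1 h3).1]
  refine ⟨⟨o, mem_of_re hs ho ?_ ?_⟩, ⟨fun x => ⟨_, hmem x.1 x.2⟩, ?_⟩, fun y => ?_, fun y => ?_⟩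
  · have := (le_abs_self _).trans (Complex.abs_im_le_norm (o - (2 * s : ℝ)))
    refine le_trans ?_ this
    rw [Complex.sub_im, Complex.ofReal_im]
    norm_num [o]
  · change -1 ≤ s * (2 * s)
    linarith
  · refine Continuous.subtype_mk ?_ _
    fun_prop
  · ext; simp
  · ext; simp

variable {A : Type*} [CommGroup A] {Q : Type*} [TopologicalSpace Q] [MulAction A Q]
  [ContinuousConstSMul A Q] {q : Q → ClosedPants} {R : Type*} [CommRing R] (χ : A →* R)

/-- The equivariant cocycle dual to the vertical arc at `2 s`: it counts the crossings of a path
with the translates of a lift of the arc. -/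
theorem exists_arc_cocycle (hq : IsPrincipal A q) {s : ℝ} (hs : s = 1 ∨ s = -1) :
    ∃ D : C(I, Q) → R, IsCocycleOn Set.univ D ∧ (∀ (a : A) σ, D (a • σ) = χ a * D σ) ∧
      (∀ σ : C(I, Q), (∀ t, q (σ t) ∈ offArc s) → D σ = 0) ∧
      ∀ σ : C(I, Q), (∀ t, q (σ t) ∈ arcNhd s) → 2 * s < (q (σ 0)).1.re →
        (q (σ 1)).1.re < 2 * s → ∃ a : A, D σ = - χ a := by
  classical
  obtain ⟨y₀, l, hl0, hl1⟩ := exists_arcNhd_contraction hs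
  obtain ⟨w, hw, hwσ⟩ := hq.exists_coordinate (arcNhd s) l y₀ hl0 hl1
  -- near the arc, the cocycle is the increment of the equivariant step function `ψ`, which is
  -- locally constant off the lifts of the arc
  let ψ : Q → R := fun x => if 2 * s < (q x).1.re then χ (w x) else 0
  have hψ : ∀ (a : A) x, q x ∈ arcNhd s → ψ (a • x) = χ a * ψ x := by
    intro a x hx
    simp only [ψ, hq.map_smul, hw a x hx, map_mul, mul_ite, mul_zero]
  have hopen : ∀ b : Bool, IsOpen (q ⁻¹' (bif b then arcNhd s else offArc s)) := by
    rintro (_ | _)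
    · exact (isOpen_offArc s).preimage hq.continuous
    · exact (isOpen_arcNhd s).preimage hq.continuous
  have disj : ∀ σ : C(I, Q), (∀ t, q (σ t) ∈ arcNhd s) → (∀ t, q (σ t) ∈ offArc s) →
      ψ (σ 1) - ψ (σ 0) = 0 := by
    intro σ h1 h2
    have hne : ∀ t, (q (σ t)).1.re ≠ 2 * s := fun t =>
      (h2 t).resolve_right (not_lt.2 (h1 t).2.le)
    have hcont : Continuous fun t => (q (σ t)).1.re := by
      have := hq.continuous
      fun_prop
    have hiff : 2 * s < (q (σ 0)).1.re ↔ 2 * s < (q (σ 1)).1.re := by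
      have hpre : IsPreconnected (Set.univ : Set I) := isPreconnected_univ
      constructor
      · intro h
        by_contra h'
        obtain ⟨t, -, ht⟩ := hpre.intermediate_value (Set.mem_univ 1) (Set.mem_univ 0)
          hcont.continuousOn ⟨not_lt.1 h', h.le⟩
        exact hne t ht
      · intro h
        by_contra h'
        obtain ⟨t, -, ht⟩ := hpre.intermediate_value (Set.mem_univ 0) (Set.mem_univ 1)
          hcont.continuousOn ⟨not_lt.1 h', h.le⟩
        exact hne t ht
    simp only [ψ, hiff, hwσ σ h1, sub_self]
  obtain ⟨D, hD, hDσ⟩ := exists_glued_cocycle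
    (Ws := fun b : Bool => q ⁻¹' (bif b then arcNhd s else offArc s))
    (θs := fun b σ => bif b then ψ (σ 1) - ψ (σ 0) else 0) hopen
    (fun x => (mem_arcNhd_or hs (q x)).elim (fun h => ⟨true, h⟩) fun h => ⟨false, h⟩)
    (by
      rintro (_ | _)
      · exact IsCocycleOn.zero _
      · exact isCocycleOn_increment _ ψ)
    (by
      rintro (_ | _) (_ | _) σ h1 h2
      · rfl
      · exact (disj σ h2 h1).symm
      · exact disj σ h1 h2
      · rfl)
  refine ⟨D, hD, fun a σ => ?_, fun σ hσ => hDσ false σ hσ, fun σ hσ h0 h1 => ⟨w (σ 0), ?_⟩⟩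
  · have hc : IsCocycleOn Set.univ fun σ : C(I, Q) => D (a • σ) - χ a * D σ :=
      (hD.comap ⟨fun x => a • x, continuous_const_smul a⟩ fun _ _ => Set.mem_univ _).sub
        (hD.map (AddMonoidHom.mulLeft (χ a)))
    refine sub_eq_zero.1 (hc.eq_zero_of_locally (fun x _ => ?_) (σ := σ) fun _ => Set.mem_univ _)
    rcases mem_arcNhd_or hs (q x) with h | h
    · refine ⟨_, hopen true, h, fun σ hσ _ => ?_⟩
      rw [hDσ true σ hσ, hDσ true (a • σ) fun t => by
        rw [Set.mem_preimage, ContinuousMap.smul_apply, hq.map_smul]; exact hσ t]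
      change ψ (a • σ 1) - ψ (a • σ 0) - χ a * (ψ (σ 1) - ψ (σ 0)) = 0
      rw [hψ a _ (hσ 0), hψ a _ (hσ 1)]
      ring
    · refine ⟨_, hopen false, h, fun σ hσ _ => ?_⟩
      rw [hDσ false σ hσ, hDσ false (a • σ) fun t => by
        rw [Set.mem_preimage, ContinuousMap.smul_apply, hq.map_smul]; exact hσ t]
      simp
  · rw [hDσ true σ hσ]
    simp [ψ, h0, not_lt.2 h1.le]

omit [MulAction A Q] [ContinuousConstSMul A Q] in
/-- The cocycle dual to an arc takes the value `-χ a` on circles which cross the arc once. -/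
theorem arc_cocycle_circle {s : ℝ} {D : C(I, Q) → R} (hD : IsCocycleOn Set.univ D)
    (hoff : ∀ σ : C(I, Q), (∀ t, q (σ t) ∈ offArc s) → D σ = 0)
    (hcross : ∀ σ : C(I, Q), (∀ t, q (σ t) ∈ arcNhd s) → 2 * s < (q (σ 0)).1.re →
        (q (σ 1)).1.re < 2 * s → ∃ a : A, D σ = - χ a)
    {Γ : C(I, Q)} {c r m : ℝ} (hr : 0 < r) (hm : -1 < m) (hm' : m < 1) (hcm : c + r * m = 2 * s)
    (hΓ : ∀ t, (q (Γ t)).1 = c + r * (Circle.exp (2 * Real.pi * t) : ℂ)) :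
    ∃ a : A, D Γ = - χ a := by
  have hre : ∀ t, (q (Γ t)).1.re = c + r * Real.cos (2 * Real.pi * t) := fun t => by
    rw [hΓ, Circle.coe_exp, Complex.add_re, Complex.re_ofReal_mul, Complex.exp_ofReal_mul_I_re]
    rfl
  have him : ∀ t, (q (Γ t)).1.im = r * Real.sin (2 * Real.pi * t) := fun t => by
    rw [hΓ, Circle.coe_exp, Complex.add_im, Complex.im_ofReal_mul, Complex.exp_ofReal_mul_I_im]
    simp
  have hpi := Real.pi_pos
  set φ := Real.arccos m with hφ
  have hcos : Real.cos φ = m := Real.cos_arccos hm.le hm'.le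
  have hφ0 : 0 < φ := Real.arccos_pos.2 hm'
  have hφ1 : φ < Real.pi := by
    refine (Real.arccos_le_pi m).lt_of_ne fun h => ?_
    rw [hφ, h, Real.cos_pi] at hcos
    linarith
  -- around the crossing the circle stays in the neighbourhood of the arc
  obtain ⟨δ, hδ, hδ'⟩ := Metric.continuousAt_iff.1 (Real.continuous_cos.continuousAt (x := φ))
    (3 / 5 / r) (by positivity)
  obtain ⟨η, hη, hηδ, hη0, hη1⟩ : ∃ η > 0, η < δ ∧ η < φ ∧ φ + η < Real.pi := by
    refine ⟨min δ (min φ (Real.pi - φ)) / 2, ?_, ?_, ?_, ?_⟩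
    · have : 0 < Real.pi - φ := by linarith
      positivity
    · have := min_le_left δ (min φ (Real.pi - φ))
      linarith
    · have := (min_le_right δ (min φ (Real.pi - φ))).trans (min_le_left _ _)
      linarith
    · have := (min_le_right δ (min φ (Real.pi - φ))).trans (min_le_right _ _)
      linarith
  have hmono : ∀ x y, 0 ≤ x → x < y → y ≤ Real.pi → Real.cos y < Real.cos x := fun x y h h' h'' =>
    Real.cos_lt_cos_of_nonneg_of_le_pi h h'' h'
  have htwo : 0 < 2 * Real.pi := by linarith
  let t₁ : I := ⟨(φ - η) / (2 * Real.pi), by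
    constructor
    · exact div_nonneg (by linarith) htwo.le
    · rw [div_le_one htwo]; linarith⟩
  let t₂ : I := ⟨(φ + η) / (2 * Real.pi), by
    constructor
    · exact div_nonneg (by linarith) htwo.le
    · rw [div_le_one htwo]; linarith⟩
  have ht₁ : 2 * Real.pi * t₁ = φ - η := mul_div_cancel₀ _ htwo.ne'
  have ht₂ : 2 * Real.pi * t₂ = φ + η := mul_div_cancel₀ _ htwo.ne'
  -- the three pieces of the circle: before, around and after the crossing
  obtain ⟨g, hg⟩ := hD.exists_path_potential Γ
  let seg : ∀ u v : I, C(I, I) := fun u v => ⟨fun t => ⟨(1 - t) * u + t * v, by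
    have h0 := t.2.1
    have h1 := sub_nonneg.2 t.2.2
    constructor
    · exact add_nonneg (mul_nonneg h1 u.2.1) (mul_nonneg h0 v.2.1)
    · nlinarith [u.2.2, v.2.2]⟩, by fun_prop⟩
  have seg0 : ∀ u v, seg u v 0 = u := fun u v => Subtype.ext (by simp [seg])
  have seg1 : ∀ u v, seg u v 1 = v := fun u v => Subtype.ext (by simp [seg])
  have hseg : ∀ (u v : I) (x y : ℝ), 2 * Real.pi * u = x → 2 * Real.pi * v = y → x ≤ y → ∀ t,
      x ≤ 2 * Real.pi * (seg u v t : ℝ) ∧ 2 * Real.pi * (seg u v t : ℝ) ≤ y := by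
    rintro u v x y rfl rfl huv t
    have e : 2 * Real.pi * (seg u v t : ℝ) =
      (1 - t) * (2 * Real.pi * u) + t * (2 * Real.pi * v) := by simp only [seg, ContinuousMap.coe_mk]; ring
    have h0 := t.2.1
    have h1 := sub_nonneg.2 t.2.2
    rw [e]
    constructor <;> nlinarith
  have g1 : g t₁ - g 0 = 0 := by
    have := hg (seg 0 t₁)
    rw [seg0, seg1] at this
    rw [← this]
    refine hoff _ fun t => Or.inl ?_
    obtain ⟨h1, h2⟩ := hseg 0 t₁ 0 (φ - η) (by simp) ht₁ (by linarith) t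
    rw [ContinuousMap.comp_apply, hre]
    have := hmono _ φ h1 (by linarith) hφ1.le
    rw [hcos] at this
    have := mul_lt_mul_of_pos_left this hr
    exact ne_of_gt (by linarith)
  have g2 : g 1 - g t₂ = 0 := by
    have := hg (seg t₂ 1)
    rw [seg0, seg1] at this
    rw [← this]
    refine hoff _ fun t => ?_
    obtain ⟨h1, h2⟩ := hseg t₂ 1 (φ + η) (2 * Real.pi) ht₂ (by simp) (by linarith) t
    generalize hx : 2 * Real.pi * (seg t₂ 1 t : ℝ) = x at h1 h2
    rcases le_or_gt x Real.pi with h3 | h3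
    · left
      rw [ContinuousMap.comp_apply, hre, hx]
      have := hmono φ _ hφ0.le (by linarith) h3
      rw [hcos] at this
      have := mul_lt_mul_of_pos_left this hr
      exact ne_of_lt (by linarith)
    · rcases h2.lt_or_eq with h4 | h4
      · right
        rw [ContinuousMap.comp_apply, him, hx]
        refine mul_neg_of_pos_of_neg hr ?_
        have := Real.sin_pos_of_pos_of_lt_pi (x := x - Real.pi) (by linarith) (by linarith)
        rw [Real.sin_sub_pi] at this
        linarith
      · left
        rw [ContinuousMap.comp_apply, hre, hx, h4, Real.cos_two_pi, ← hcm]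
        have := mul_lt_mul_of_pos_left hm' hr
        exact ne_of_gt (by linarith)
  obtain ⟨a, ha⟩ := hcross (Γ.comp (seg t₁ t₂)) (fun t => by
    obtain ⟨h1, h2⟩ := hseg t₁ t₂ _ _ ht₁ ht₂ (by linarith) t
    rw [ContinuousMap.comp_apply]
    constructor
    · rw [hre]
      have := hδ' (x := 2 * Real.pi * (seg t₁ t₂ t : ℝ)) (by
        rw [Real.dist_eq, abs_lt]; constructor <;> linarith)
      rw [Real.dist_eq, hcos, lt_div_iff₀ hr] at this
      rw [← hcm, show c + r * Real.cos (2 * Real.pi * (seg t₁ t₂ t : ℝ)) - (c + r * m) =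
        (Real.cos (2 * Real.pi * (seg t₁ t₂ t : ℝ)) - m) * r by ring, abs_mul, abs_of_pos hr]
      exact this
    · rw [him]
      exact mul_pos hr (Real.sin_pos_of_pos_of_lt_pi (by linarith) (by linarith)))
    (by
      rw [ContinuousMap.comp_apply, seg0, hre, ht₁, ← hcm]
      have := hmono (φ - η) φ (by linarith) (by linarith) hφ1.le
      rw [hcos] at this
      have := mul_lt_mul_of_pos_left this hr
      linarith)
    (by
      rw [ContinuousMap.comp_apply, seg1, hre, ht₂, ← hcm]
      have := hmono φ (φ + η) hφ0.le (by linarith) hη1.le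
      rw [hcos] at this
      have := mul_lt_mul_of_pos_left this hr
      linarith)
  refine ⟨a, ?_⟩
  have h3 := hg (seg t₁ t₂)
  have h4 := hg (ContinuousMap.id I)
  rw [seg0, seg1, ha] at h3
  rw [ContinuousMap.comp_id] at h4
  simp only [ContinuousMap.id_apply] at h4
  linear_combination h4 - h3 + g1 + g2

/-- An inner boundary circle is singled out by an equivariant cocycle which vanishes on it, but not
on the other two boundary circles. -/
theorem exists_cocycle_vanishing (hq : IsPrincipal A q) (ε : R →+* ℤ) (hε : ∀ a, ε (χ a) = 1)
    {i : Fin 3} (hi : i ≠ 0) :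
    ∃ D : C(I, Q) → R, IsCocycleOn Set.univ D ∧ (∀ (a : A) σ, D (a • σ) = χ a * D σ) ∧
      (∀ Γ : C(I, Q), (∀ t, q (Γ t) = circleLoop (boundaryCircle i) t) → D Γ = 0) ∧
      ∀ k ≠ i, ∀ Γ : C(I, Q), (∀ t, q (Γ t) = circleLoop (boundaryCircle k) t) → ε (D Γ) ≠ 0 := by
  -- the arc starts at the other inner boundary circle; the circle with centre `c` and radius `r`
  -- meets the vertical line through `2 s` where the cosine of the angle is `m`
  obtain ⟨s, hs, hci, hri, hk⟩ : ∃ s : ℝ, (s = 1 ∨ s = -1) ∧ center i = (-(2 * s) : ℝ) ∧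
      radius i = 1 ∧ ∀ k ≠ i, ∃ c r m : ℝ, 0 < r ∧ -1 < m ∧ m < 1 ∧ c + r * m = 2 * s ∧
        center k = c ∧ radius k = r := by
    fin_cases i
    · exact absurd rfl hi
    · refine ⟨-1, Or.inr rfl, by simp [center], by simp [radius], fun k hk => ?_⟩
      fin_cases k
      · exact ⟨0, 4, -(1 / 2), by norm_num, by norm_num, by norm_num, by norm_num,
          by simp [center], by simp [radius]⟩
      · exact absurd rfl hk
      · exact ⟨-2, 1, 0, by norm_num, by norm_num, by norm_num, by norm_num,
          by simp [center], by simp [radius]⟩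
    · refine ⟨1, Or.inl rfl, by simp [center], by simp [radius], fun k hk => ?_⟩
      fin_cases k
      · exact ⟨0, 4, 1 / 2, by norm_num, by norm_num, by norm_num, by norm_num,
          by simp [center], by simp [radius]⟩
      · exact ⟨2, 1, 0, by norm_num, by norm_num, by norm_num, by norm_num,
          by simp [center], by simp [radius]⟩
      · exact absurd rfl hk
  obtain ⟨D, hD, hequiv, hoff, hcross⟩ := exists_arc_cocycle χ hq hs
  refine ⟨D, hD, hequiv, fun Γ hΓ => hoff Γ fun t => Or.inl ?_, fun k hki Γ hΓ => ?_⟩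
  · rw [hΓ]
    have e : (circleLoop (boundaryCircle i) t).1 = center i + radius i *
      (Circle.exp (2 * Real.pi * t) : ℂ) := rfl
    rw [e, hci, hri, Complex.add_re, Complex.ofReal_re, Complex.re_ofReal_mul]
    have h1 := abs_le.1 ((Complex.abs_re_le_norm (Circle.exp (2 * Real.pi * t) : ℂ)).trans_eq
      (Circle.norm_coe _))
    rcases hs with rfl | rfl <;> intro h <;> linarith
  · obtain ⟨c, r, m, hr, hm, hm', hcm, hc, hr'⟩ := hk k hki
    obtain ⟨a, ha⟩ := arc_cocycle_circle χ hD hoff hcross hr hm hm' hcm (Γ := Γ) fun t => by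
      rw [hΓ, ← hc, ← hr']; rfl
    rw [ha, map_neg, hε]
    norm_num

/-- A loop homotopic to the commutator of two boundary circles lifts to closed paths, which are
detected by an equivariant cocycle. -/
theorem exists_cocycle_commutator [IsDomain R] (hq : IsPrincipal A q) (ε : R →+* ℤ)
    (hε : ∀ a, ε (χ a) = 1)
    (hmon : ∀ k, ∃ a : A, HasMonodromy q (circleLoop (boundaryCircle k)) a ∧ χ a ≠ 1)
    {g : C(Circle, ClosedPants)} {j k : Fin 3} (hjk : j ≠ k)
    (hg : HomotopicToCommutator g (boundaryCircle j) (boundaryCircle k)) :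
    HasMonodromy q (circleLoop g) (1 : A) ∧
    ∃ D : C(I, Q) → R, IsCocycleOn Set.univ D ∧ (∀ (a : A) σ, D (a • σ) = χ a * D σ) ∧
      ∀ Γ : C(I, Q), (∀ t, q (Γ t) = circleLoop g t) → D Γ ≠ 0 := by
  obtain ⟨a, ha, ha1⟩ := hmon j
  obtain ⟨b, hb, hb1⟩ := hmon k
  by_cases hj : j = 0
  · have hk : k ≠ 0 := fun h => hjk (hj.trans h.symm)
    obtain ⟨D, hD, hequiv, h0, h1⟩ := exists_cocycle_vanishing χ hq ε hε hk
    have := hq.cocycle_commutator_ne_zero χ hD hequiv ε hε hg ha hb ha1 hb1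
      (Or.inr ⟨h1 j hjk, h0⟩)
    exact ⟨this.1, D, hD, hequiv, this.2⟩
  · obtain ⟨D, hD, hequiv, h0, h1⟩ := exists_cocycle_vanishing χ hq ε hε hj
    have := hq.cocycle_commutator_ne_zero χ hD hequiv ε hε hg ha hb ha1 hb1
      (Or.inl ⟨h0, h1 k hjk.symm⟩)
    exact ⟨this.1, D, hD, hequiv, this.2⟩

end ClosedPants

/-! ### Extending a cocycle from the pair of pants to the surface -/

/-- A cocycle on the paths of a subspace, as a cocycle over this subspace. -/
theorem IsCocycleOn.exists_extend {E M : Type*} [TopologicalSpace E] [AddCommGroup M] {W : Set E}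
    {θ : C(I, W) → M} (hθ : IsCocycleOn Set.univ θ) :
    ∃ θ' : C(I, E) → M, IsCocycleOn W θ' ∧
      ∀ σ : C(I, W), θ' (ContinuousMap.comp ⟨Subtype.val, continuous_subtype_val⟩ σ) = θ σ := by
  classical
  let θ' : C(I, E) → M := fun σ => if h : ∀ t, σ t ∈ W then
    θ ⟨fun t => ⟨σ t, h t⟩, σ.continuous.subtype_mk _⟩ else 0
  have key : ∀ σ : C(I, W), θ' (ContinuousMap.comp ⟨Subtype.val, continuous_subtype_val⟩ σ) = θ σ :=
    fun σ => dif_pos fun t => (σ t).2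
  refine ⟨θ', fun h hW => ?_, key⟩
  let h' : C(stdSimplex ℝ (Fin 3), W) := ⟨fun x => ⟨h x, hW x⟩, h.continuous.subtype_mk _⟩
  have := hθ h' fun _ => Set.mem_univ _
  rwa [← key, ← key, ← key] at this

namespace ClosedPants

/-- The part of the open pair of pants near the `k`-th boundary circle. -/
def collar (k : Fin 3) : Set ClosedPants :=
  {z | z ∈ interior ∧ |‖z.1 - center k‖ - radius k| < 1 / 2}

/-- The pair of pants without its collars.  It is compact and contained in the open pants. -/
def core : Set ClosedPants := {z | ∀ k, 1 / 2 ≤ |‖z.1 - center k‖ - radius k|}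

theorem isOpen_interior : IsOpen interior := by
  have h1 : IsOpen {z : ClosedPants | ‖z.1‖ < 4} := isOpen_lt (by fun_prop) continuous_const
  have h2 : IsOpen {z : ClosedPants | 1 < ‖z.1 - 2‖} := isOpen_lt continuous_const (by fun_prop)
  have h3 : IsOpen {z : ClosedPants | 1 < ‖z.1 + 2‖} := isOpen_lt continuous_const (by fun_prop)
  exact h1.inter (h2.inter h3)

theorem isOpen_collar (k : Fin 3) : IsOpen (collar k) :=
  have : IsOpen {z : ClosedPants | |‖z.1 - center k‖ - radius k| < 1 / 2} :=
    isOpen_lt (by fun_prop) continuous_const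
  isOpen_interior.inter this

theorem isCompact_core : IsCompact core := by
  have h1 : IsClosed core := by
    have : core = ⋂ k, {z : ClosedPants | 1 / 2 ≤ |‖z.1 - center k‖ - radius k|} := by
      ext; simp [core]
    rw [this]
    exact isClosed_iInter fun k => isClosed_le continuous_const (by fun_prop)
  have h2 : IsCompact {z : ℂ | ‖z‖ ≤ 4 ∧ 1 ≤ ‖z - 2‖ ∧ 1 ≤ ‖z + 2‖} := by
    refine (isCompact_closedBall (0 : ℂ) 4).of_isClosed_subset ?_ fun z hz => by simpa using hz.1
    have h3 : IsClosed {z : ℂ | ‖z‖ ≤ 4} := isClosed_le (by fun_prop) continuous_const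
    have h4 : IsClosed {z : ℂ | 1 ≤ ‖z - 2‖} := isClosed_le continuous_const (by fun_prop)
    have h5 : IsClosed {z : ℂ | 1 ≤ ‖z + 2‖} := isClosed_le continuous_const (by fun_prop)
    exact h3.inter (h4.inter h5)
  have : CompactSpace ClosedPants := isCompact_iff_compactSpace.1 h2
  exact h1.isCompact

theorem core_subset : core ⊆ interior := by
  intro z hz
  have h0 := hz 0
  have h1 := hz 1
  have h2 := hz 2
  obtain ⟨z, h3, h4, h5⟩ := z
  simp only [center, radius, Matrix.cons_val, sub_zero, sub_neg_eq_add] at h0 h1 h2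
  refine ⟨?_, ?_, ?_⟩
  · by_contra! h
    rw [le_antisymm h3 h] at h0
    norm_num at h0
  · by_contra! h
    rw [le_antisymm h h4] at h1
    norm_num at h1
  · by_contra! h
    rw [le_antisymm h h5] at h2
    norm_num at h2

theorem collar_disjoint {j k : Fin 3} {z : ClosedPants} (hj : z ∈ collar j) (hk : z ∈ collar k) :
    j = k := by
  have h2 : ‖(2 : ℂ)‖ = 2 := by simp
  have h4 : ‖(4 : ℂ)‖ = 4 := by simp
  have e1 := norm_sub_norm_le z.1 2
  have e2 := norm_sub_norm_le z.1 (-2)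
  have e3 := norm_sub_le (z.1 + 2) (z.1 - 2)
  rw [norm_neg, sub_neg_eq_add] at e2
  rw [show z.1 + 2 - (z.1 - 2) = 4 by ring] at e3
  have hj' := abs_lt.1 hj.2
  have hk' := abs_lt.1 hk.2
  fin_cases j <;> fin_cases k <;> first
    | rfl
    | (exfalso
       simp only [Fin.zero_eta, Fin.mk_one, Fin.reduceFinMk, center, radius, Matrix.cons_val,
         sub_zero, sub_neg_eq_add] at hj' hk'
       linarith [hj'.1, hj'.2, hk'.1, hk'.2])

/-- A collar is swept out by circles around its boundary circle. -/
theorem mem_of_mem_collar {k : Fin 3} {z : ClosedPants} (hz : z ∈ collar k) {w : ℂ}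
    (hw : ∃ s : I, ‖w - center k‖ = (1 - s) * ‖z.1 - center k‖ + s * radius k) :
    ‖w‖ ≤ 4 ∧ 1 ≤ ‖w - 2‖ ∧ 1 ≤ ‖w + 2‖ := by
  obtain ⟨s, hs⟩ := hw
  have h0 := s.2.1
  have h1 := s.2.2
  obtain ⟨h2, h3⟩ := abs_lt.1 hz.2
  obtain ⟨h4, h5, h6⟩ := z.2
  generalize (s : ℝ) = s at hs h0 h1
  have inner : ∀ v : ℝ, (v = 1 ∨ v = -1) → ∀ n : ℝ, ‖w - (2 * v : ℝ)‖ = (1 - s) * n + s * 1 →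
      1 ≤ n → n - 1 < 1 / 2 → ‖w‖ ≤ 4 ∧ 1 ≤ ‖w - 2‖ ∧ 1 ≤ ‖w + 2‖ := by
    intro v hv n hwn hn1 hn2
    have hle : ‖w - (2 * v : ℝ)‖ ≤ 3 / 2 := by rw [hwn]; nlinarith
    have hvv : v * v = 1 := by rcases hv with rfl | rfl <;> norm_num
    have hv1 : |v| = 1 := by rcases hv with rfl | rfl <;> simp
    refine mem_of_re hv ?_ (by rw [hwn]; nlinarith) ?_
    · have := norm_sub_norm_le w ((2 * v : ℝ) : ℂ)
      rw [Complex.norm_real, norm_mul, Real.norm_eq_abs, Real.norm_eq_abs, hv1] at this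
      norm_num at this
      norm_num at hle
      linarith
    · have h7 := (Complex.abs_re_le_norm _).trans hle
      have e : v * w.re = 2 + v * (w - (2 * v : ℝ)).re := by
        simp
        linear_combination 2 * hvv
      have h8 : |v * (w - (2 * v : ℝ)).re| ≤ 3 / 2 := by rwa [abs_mul, hv1, one_mul]
      rw [e]
      linarith [(abs_le.1 h8).1]
  fin_cases k
  · simp only [Fin.zero_eta, center, radius, Matrix.cons_val, sub_zero] at hs h2 h3
    refine mem_of_three_le_norm ?_ ?_ <;> rw [hs] <;> nlinarith
  · simp only [Fin.mk_one, center, radius, Matrix.cons_val] at hs h2 h3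
    exact inner 1 (Or.inl rfl) _ (by simpa using hs) h5 h3
  · simp only [Fin.reduceFinMk, center, radius, Matrix.cons_val, sub_neg_eq_add] at hs h2 h3
    exact inner (-1) (Or.inr rfl) _ (by simpa using hs) h6 h3

variable {A : Type*} [CommGroup A] {Q : Type*} [TopologicalSpace Q] [MulAction A Q]
  [ContinuousConstSMul A Q] {q : Q → ClosedPants} {F : Type*} [Field F] (χ : A →* F)

/-- An equivariant cocycle can be changed by a coboundary so as to vanish on the collars. -/
theorem exists_cocycle_vanishing_collars (hq : IsPrincipal A q)
    (hmon : ∀ k, ∃ a : A, HasMonodromy q (circleLoop (boundaryCircle k)) a ∧ χ a ≠ 1)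
    {D : C(I, Q) → F} (hD : IsCocycleOn Set.univ D) (hequiv : ∀ (a : A) σ, D (a • σ) = χ a * D σ) :
    ∃ D' : C(I, Q) → F, IsCocycleOn Set.univ D' ∧ (∀ (a : A) σ, D' (a • σ) = χ a * D' σ) ∧
      (∀ σ, σ 1 = σ 0 → D' σ = D σ) ∧
      ∀ σ, (∀ t, q (σ t) ∈ interior ∧ q (σ t) ∉ core) → D' σ = 0 := by
  classical
  have hpot : ∀ k, ∃ ψ : Q → F, (∀ (a : A) x, ψ (a • x) = χ a * ψ x) ∧
      ∀ σ : C(I, Q), (∀ t, q (σ t) ∈ collar k) → D σ = ψ (σ 1) - ψ (σ 0) := by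
    intro k
    obtain ⟨a, ha, ha1⟩ := hmon k
    let rot : collar k → I → ℂ := fun z t =>
      center k + (z.1.1 - center k) * (Circle.exp (2 * Real.pi * t) : ℂ)
    have hrot : ∀ z t, ‖rot z t‖ ≤ 4 ∧ 1 ≤ ‖rot z t - 2‖ ∧ 1 ≤ ‖rot z t + 2‖ := fun z t =>
      mem_of_mem_collar z.2 ⟨0, by
        simp only [rot]
        rw [add_sub_cancel_left, norm_mul, Circle.norm_coe]
        simp⟩
    let l : C(collar k × I, ClosedPants) := ⟨fun x => ⟨rot x.1 x.2, hrot x.1 x.2⟩, by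
      refine Continuous.subtype_mk ?_ _
      simp only [rot]
      fun_prop⟩
    obtain ⟨Ψ, hΨ⟩ := hq.exists_potential_of_loops χ (collar k) l
      (fun y => Subtype.ext (by simp [l, rot])) (fun y => Subtype.ext (by simp [l, rot]))
      fun y => ⟨a, hasMonodromy_rotation hq ha _ y.1.1 (fun t => rfl)
        fun w hw => mem_of_mem_collar y.2 hw, ha1⟩
    exact ⟨Ψ D, hΨ D hD hequiv⟩
  choose ψ hψ hψσ using hpot
  let φ : Q → F := fun x => ∑ k, if q x ∈ collar k then ψ k x else 0
  have hφ : ∀ k x, q x ∈ collar k → φ x = ψ k x := by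
    intro k x hx
    refine (Finset.sum_eq_single k (fun j _ hj => if_neg fun h => hj (collar_disjoint h hx))
      fun h => absurd (Finset.mem_univ k) h).trans (if_pos hx)
  have hD' := hD.sub (isCocycleOn_increment Set.univ φ)
  refine ⟨_, hD', fun a σ => ?_, fun σ hσ => ?_, fun σ hσ => ?_⟩
  · have h1 : ∀ x, φ (a • x) = χ a * φ x := fun x => by
      simp only [φ, hq.map_smul, hψ, Finset.mul_sum, mul_ite, mul_zero]
    simp only [hequiv, ContinuousMap.smul_apply, h1]
    ring
  · simp only [hσ, sub_self, sub_zero]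
  · refine (hD'.mono (Set.subset_univ (q ⁻¹' (interior \ core)))).eq_zero_of_locally
      (fun x hx => ?_) hσ
    obtain ⟨k, hk⟩ := not_forall.1 hx.2
    refine ⟨q ⁻¹' collar k, (isOpen_collar k).preimage hq.continuous, ⟨hx.1, not_le.1 hk⟩,
      fun τ hτ _ => ?_⟩
    simp only [hψσ k τ hτ, hφ k _ (hτ 0), hφ k _ (hτ 1), sub_self]

end ClosedPants

namespace AlphaCover

variable {S A : Type*} [TopologicalSpace S] [T2Space S] {x₀ : S} [CommGroup A]
  {α : FundamentalGroup S x₀ →* A} (c : AlphaCover α) (P : PairOfPants S)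
  {F : Type*} [Field F] (χ : A →* F)

/-- A cocycle over the closed pair of pants which vanishes on the collars extends by zero to a
cocycle over the surface. -/
theorem exists_extension_by_zero {D : C(I, c.Restrict P.toMap) → F} (hD : IsCocycleOn Set.univ D)
    (hequiv : ∀ (a : A) σ, D (a • σ) = χ a * D σ)
    (h0 : ∀ σ, (∀ t, c.restrictBase P.toMap (σ t) ∈ ClosedPants.interior ∧
      c.restrictBase P.toMap (σ t) ∉ ClosedPants.core) → D σ = 0) :
    ∃ θ : C(I, c.Total) → F, IsCocycleOn Set.univ θ ∧ (∀ (a : A) σ, θ (a • σ) = χ a * θ σ) ∧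
      ∀ σ : C(I, c.Restrict P.toMap), (∀ t, c.restrictBase P.toMap (σ t) ∈ ClosedPants.interior) →
        θ ((c.restrictProj P.toMap).comp σ) = D σ := by
  -- glue the given cocycle over the open pants with zero over the complement of the core
  let W : Set c.Total := c.proj ⁻¹' P.carrier
  let W' : Set c.Total := c.proj ⁻¹' (P.toMap '' ClosedPants.core)ᶜ
  have hcont := c.isPrincipal.continuous
  have hW : IsOpen W := P.isOpen_carrier.preimage hcont
  have hW' : IsOpen W' :=
    (ClosedPants.isCompact_core.image P.toMap.continuous).isClosed.isOpen_compl.preimage hcont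
  let u : C(W, c.Restrict P.toMap) :=
    ⟨fun x => ⟨((P.homeo.symm ⟨c.proj x.1, x.2⟩).1, x.1), P.toMap_homeo_symm _⟩, by
      refine Continuous.subtype_mk ?_ _
      fun_prop⟩
  have hu : ∀ x, c.restrictBase P.toMap (u x) = (P.homeo.symm ⟨c.proj x.1, x.2⟩).1 := fun x => rfl
  obtain ⟨θ₁, hθ₁, hθ₁σ⟩ := (hD.comap u fun _ _ => Set.mem_univ _ :
    IsCocycleOn Set.univ fun σ : C(I, W) => D (u.comp σ)).exists_extend
  have hθ₁' : ∀ (σ : C(I, c.Total)) (h : ∀ t, σ t ∈ W),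
      θ₁ σ = D (u.comp ⟨fun t => ⟨σ t, h t⟩, σ.continuous.subtype_mk _⟩) := fun σ h =>
    hθ₁σ ⟨fun t => ⟨σ t, h t⟩, σ.continuous.subtype_mk _⟩
  have agree : ∀ σ : C(I, c.Total), (∀ t, σ t ∈ W) → (∀ t, σ t ∈ W') → θ₁ σ = 0 := by
    intro σ h1 h2
    rw [hθ₁' σ h1]
    refine h0 _ fun t => ⟨(P.homeo.symm _).2, fun h => h2 t ?_⟩
    exact ⟨_, h, P.toMap_homeo_symm ⟨c.proj (σ t), h1 t⟩⟩
  have cover : ∀ x, x ∈ W ∨ x ∈ W' := by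
    intro x
    by_cases h : c.proj x ∈ P.toMap '' ClosedPants.core
    · exact Or.inl (Set.image_mono ClosedPants.core_subset h)
    · exact Or.inr h
  have hopen : ∀ b : Bool, IsOpen (bif b then W else W') := by
    rintro (_ | _)
    · exact hW'
    · exact hW
  obtain ⟨θ, hθ, hθσ⟩ := exists_glued_cocycle (Ws := fun b : Bool => bif b then W else W')
    (θs := fun b σ => bif b then θ₁ σ else 0) hopen
    (fun x => (cover x).elim (fun h => ⟨true, h⟩) fun h => ⟨false, h⟩)
    (by
      rintro (_ | _)
      · exact IsCocycleOn.zero _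
      · exact hθ₁)
    (by
      rintro (_ | _) (_ | _) σ h1 h2
      · rfl
      · exact (agree σ h2 h1).symm
      · exact agree σ h1 h2
      · rfl)
  have hθW : ∀ (σ : C(I, c.Total)) (h : ∀ t, σ t ∈ W),
      θ σ = D (u.comp ⟨fun t => ⟨σ t, h t⟩, σ.continuous.subtype_mk _⟩) := fun σ h =>
    (hθσ true σ h).trans (hθ₁' σ h)
  refine ⟨θ, hθ, fun a σ => ?_, fun σ hσ => ?_⟩
  · have hc : IsCocycleOn Set.univ fun σ : C(I, c.Total) => θ (a • σ) - χ a * θ σ :=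
      (hθ.comap ⟨fun x => a • x, continuous_const_smul a⟩ fun _ _ => Set.mem_univ _).sub
        (hθ.map (AddMonoidHom.mulLeft (χ a)))
    refine sub_eq_zero.1 (hc.eq_zero_of_locally (fun x _ => ?_) (σ := σ) fun _ => Set.mem_univ _)
    rcases cover x with h | h
    · refine ⟨W, hW, h, fun τ hτ _ => ?_⟩
      have hτ' : ∀ t, (a • τ) t ∈ W := fun t => by
        change c.proj (a • τ t) ∈ P.carrier
        rw [c.isPrincipal.map_smul]; exact hτ t
      rw [hθW _ hτ', hθW _ hτ, ← hequiv, sub_eq_zero]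
      congr 1
      ext t
      refine Subtype.ext (Prod.ext ?_ rfl)
      exact congrArg (fun y => (P.homeo.symm y).1) (Subtype.ext (c.isPrincipal.map_smul a (τ t)))
    · refine ⟨W', hW', h, fun τ hτ _ => ?_⟩
      rw [hθσ false τ hτ, hθσ false (a • τ) fun t => by
        change c.proj (a • τ t) ∈ (P.toMap '' ClosedPants.core)ᶜ
        rw [c.isPrincipal.map_smul]; exact hτ t]
      simp
  · have hmem : ∀ t, c.restrictProj P.toMap (σ t) ∈ W := fun t =>
      ⟨_, hσ t, (σ t).2⟩
    refine (hθW _ hmem).trans ?_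
    congr 1
    ext t
    refine Subtype.ext (Prod.ext ?_ rfl)
    have h : (⟨c.proj (c.restrictProj P.toMap (σ t)), hmem t⟩ : P.carrier) =
        P.homeo ⟨c.restrictBase P.toMap (σ t), hσ t⟩ := Subtype.ext (σ t).2.symm
    exact congrArg Subtype.val (P.homeo.symm_apply_eq.2 h)

end AlphaCover

/-! ### The Pochhammer principle -/

namespace AlphaCover

variable {S : Type*} [TopologicalSpace S] [T2Space S] {x₀ : S}
  (c : AlphaCover (hurewicz S x₀)) (P : PairOfPants S)

theorem exists_hasMonodromy_boundaryCircle {S : Type*} [TopologicalSpace S] {x₀ : S}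
    (c : AlphaCover (hurewicz S x₀)) (P : PairOfPants S) (hP : P.Fashionable x₀) (k : Fin 3) :
    ∃ a : FreeH1 S x₀, HasMonodromy (c.restrictBase P.toMap)
      (circleLoop (ClosedPants.boundaryCircle k)) a ∧ a ≠ 1 := by
  obtain ⟨a, ha, ha1⟩ := c.exists_hasMonodromy_of_nontrivial (hP k)
  exact ⟨a, c.hasMonodromy_restrict P.toMap (circleLoop_zero_eq_one _) ha, ha1⟩

/-- The lifts of a commutator of boundary circles to the `α`-cover of the surface are closed, and
some equivariant cocycle does not vanish on them. -/
theorem exists_detecting_cocycle (hP : P.Fashionable x₀) {f : C(Circle, P.carrier)}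
    (hf : P.IsCommutatorOfBoundary f) :
    HasMonodromy c.proj (circleLoop (P.incl.comp f)) (1 : FreeH1 S x₀) ∧
    ∃ θ : C(I, c.Total) → QuotField (FreeH1 S x₀), IsCocycleOn Set.univ θ ∧
      (∀ (a : FreeH1 S x₀) σ, θ (a • σ) = groupToField _ a * θ σ) ∧
      ∀ Γ : C(I, c.Total), (∀ t, c.proj (Γ t) = circleLoop (P.incl.comp f) t) → θ Γ ≠ 0 := by
  obtain ⟨g, hg, j, k, hjk, hcomm⟩ := hf
  have hq := c.restrictBase_isPrincipal P.toMap
  have hmon := c.exists_hasMonodromy_boundaryCircle P hP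
  have hloop : P.toMap.comp (circleLoop g) = circleLoop (P.incl.comp f) :=
    ContinuousMap.ext fun t => (hg _).2
  obtain ⟨h1, D, hD, hequiv, hne⟩ := ClosedPants.exists_cocycle_commutator
    (MonoidAlgebra.of ℤ (FreeH1 S x₀)) hq
    (MonoidAlgebra.lift ℤ ℤ (FreeH1 S x₀) (1 : FreeH1 S x₀ →* ℤ)).toRingHom
    (fun a => by simp)
    (fun k => by
      obtain ⟨a, ha, ha1⟩ := hmon k
      exact ⟨a, ha, fun h => ha1 (MonoidAlgebra.of_injective (h.trans (map_one _).symm))⟩)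
    hjk hcomm
  have hinj := IsFractionRing.injective (MonoidAlgebra ℤ (FreeH1 S x₀)) (QuotField (FreeH1 S x₀))
  obtain ⟨D', hD', hequiv', hclosed, hcollar⟩ := ClosedPants.exists_cocycle_vanishing_collars
    (groupToField (FreeH1 S x₀)) hq
    (fun k => by
      obtain ⟨a, ha, ha1⟩ := hmon k
      exact ⟨a, ha, groupToField_ne_one ha1⟩)
    (hD.map (algebraMap (MonoidAlgebra ℤ (FreeH1 S x₀)) (QuotField (FreeH1 S x₀))).toAddMonoidHom)
    (fun a σ => by
      rw [hequiv]
      exact map_mul (algebraMap (MonoidAlgebra ℤ (FreeH1 S x₀)) (QuotField (FreeH1 S x₀))) _ _)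
  obtain ⟨θ, hθ, hθequiv, hθσ⟩ := c.exists_extension_by_zero P (groupToField (FreeH1 S x₀)) hD'
    hequiv' hcollar
  refine ⟨hloop ▸ c.hasMonodromy_of_restrict P.toMap h1, θ, hθ, hθequiv, fun Γ hΓ => ?_⟩
  let Γ' : C(I, c.Restrict P.toMap) := ⟨fun t => ⟨(circleLoop g t, Γ t),
    (DFunLike.congr_fun hloop t).trans (hΓ t).symm⟩, Continuous.subtype_mk (by fun_prop) _⟩
  have hΓ' : ∀ t, c.restrictBase P.toMap (Γ' t) = circleLoop g t := fun t => rfl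
  have h2 := hθσ Γ' fun t => (hg _).1
  have h3 : (c.restrictProj P.toMap).comp Γ' = Γ := rfl
  rw [h3, hclosed Γ' ((h1 Γ' hΓ').trans (one_smul _ _))] at h2
  rw [h2]
  exact fun h => hne Γ' hΓ' (hinj (h.trans (map_zero _).symm))

/-- The twisted homology of the open pair of pants is at most one-dimensional. -/
theorem exists_smul_eq_of_pants {S : Type*} [TopologicalSpace S] {x₀ : S}
    (c : AlphaCover (hurewicz S x₀)) (P : PairOfPants S) (hP : P.Fashionable x₀)
    {v : c.H1 P.incl} (hv : v ≠ 0) (w : c.H1 P.incl) :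
    ∃ k : QuotField (FreeH1 S x₀), w = k • v := by
  have hp := (c.restrictBase_isPrincipal P.incl).comp_homeomorph P.homeo.symm
  obtain ⟨κ, hκ⟩ := ClosedPants.exists_exactness_condition (groupToField (FreeH1 S x₀)) hp
    (c.restrictBase_isPrincipal P.toMap)
    (fun L a hL ha => HasMonodromy.comp_homeomorph P.homeo.symm
      (c.hasMonodromy_restrict P.incl (congrArg P.homeo hL)
        (c.hasMonodromy_of_restrict P.toMap ha)))
    (fun k => by
      obtain ⟨a, ha, ha1⟩ := c.exists_hasMonodromy_boundaryCircle P hP k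
      exact ⟨a, ha, groupToField_ne_one ha1⟩)
  exact exists_smul_eq_of_exact κ hκ hv w

/-- A lift of a circle with trivial monodromy is closed; if its class in the twisted homology of
this circle is nonzero, then this class spans. -/
theorem exists_spanning_loop {S : Type*} [TopologicalSpace S] {x₀ : S}
    (c : AlphaCover (hurewicz S x₀)) (u : C(Circle, S))
    (hu : HasMonodromy c.proj (circleLoop u) (1 : FreeH1 S x₀)) :
    ∃ (γ : C(I, c.Restrict u)) (hγ : γ 1 = γ 0),
      (∀ t, c.proj (c.restrictProj u (γ t)) = circleLoop u t) ∧
      (loopH1 (FreeH1 S x₀) γ hγ ≠ 0 → ∀ w : c.H1 u, ∃ k : QuotField (FreeH1 S x₀),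
        w = k • loopH1 (FreeH1 S x₀) γ hγ) := by
  obtain ⟨e, he⟩ := c.exists_real_lift (u.comp ⟨fun t => Circle.exp (2 * Real.pi * t), by fun_prop⟩)
  let e' : C(ℝ, c.Restrict u) := ⟨fun t => ⟨(Circle.exp (2 * Real.pi * t), e t), (he t).symm⟩,
    Continuous.subtype_mk (by fun_prop) _⟩
  have h1 : e 1 = e 0 := by
    have := hu (e.comp ⟨fun t : I => (t : ℝ), by fun_prop⟩) fun t => he t
    simpa using this
  have hexp : Circle.exp (2 * Real.pi * 1) = Circle.exp (2 * Real.pi * 0) := by simp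
  have h1' : e' 1 = e' 0 := Subtype.ext (Prod.ext hexp h1)
  have hmon : e'.comp ⟨fun t : I => (t : ℝ), by fun_prop⟩ 1 =
    e'.comp ⟨fun t : I => (t : ℝ), by fun_prop⟩ 0 := by simpa using h1'
  refine ⟨e'.comp ⟨fun t : I => (t : ℝ), by fun_prop⟩, hmon, fun t => he t, fun hv w => ?_⟩
  exact exists_smul_eq_of_exact (LinearMap.proj (e'.comp ⟨fun t : I => (t : ℝ), by fun_prop⟩))
    (fun θ hθ hequiv h0 => (c.restrictBase_isPrincipal u).exists_potential_of_circle
      (groupToField (FreeH1 S x₀)) e' (fun t => rfl) h1' hθ hequiv h0) hv w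

end AlphaCover

end

theorem theorem3p4 {S : Type*} [TopologicalSpace S] [T2Space S] [CompactSpace S]
    [ConnectedSpace S] [ChartedSpace (EuclideanHalfSpace 2) S]
    (x₀ : S) (c : AlphaCover (hurewicz S x₀))
    (P : PairOfPants S) (hP : P.Fashionable x₀)
    (f : C(Circle, P.carrier)) (hf : P.IsCommutatorOfBoundary f) :
    Nonempty (c.H1 (P.incl.comp f) ≃ₗ[QuotField (FreeH1 S x₀)] QuotField (FreeH1 S x₀)) ∧
    Function.Bijective (c.mapH1 P.incl f) ∧
    Function.Injective (c.toBaseH1 (P.incl.comp f)) ∧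
    LinearMap.range (c.toBaseH1 (P.incl.comp f)) = LinearMap.range (c.toBaseH1 P.incl) := by
  let _ : Field (QuotField (FreeH1 S x₀)) := fieldQuotField _
  obtain ⟨hmon, θ, hθ, hequiv, hne⟩ := c.exists_detecting_cocycle P hP hf
  obtain ⟨γ, hγ, hγproj, hspan⟩ := c.exists_spanning_loop (P.incl.comp f) hmon
  set v := loopH1 (FreeH1 S x₀) γ hγ
  -- the image of the loop in the surface is detected, hence so are all the loops above it
  have hv₃ : c.toBaseH1 (P.incl.comp f) v ≠ 0 := by
    have e : c.toBaseH1 (P.incl.comp f) v = _ := TwistedH1.map_loopH1 _ _ γ hγ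
    rw [e]
    exact loopH1_ne_zero hθ hequiv _ (hne _ hγproj)
  have hcomp : c.toBaseH1 P.incl (c.mapH1 P.incl f v) = c.toBaseH1 (P.incl.comp f) v := by
    have e1 : c.mapH1 P.incl f v = _ := TwistedH1.map_loopH1 _ _ γ hγ
    have e2 : c.toBaseH1 (P.incl.comp f) v = _ := TwistedH1.map_loopH1 _ _ γ hγ
    rw [e1, e2]
    exact TwistedH1.map_loopH1 _ _ _ _
  have hv₂ : c.mapH1 P.incl f v ≠ 0 := fun h => hv₃ (by rw [← hcomp, h, map_zero])
  have hv : v ≠ 0 := fun h => hv₃ (by rw [h, map_zero])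
  have hspan₁ := hspan hv
  have hspan₂ := c.exists_smul_eq_of_pants P hP hv₂
  have inj₂ : Function.Injective (c.mapH1 P.incl f) := by
    refine (injective_iff_map_eq_zero _).2 fun w hw => ?_
    obtain ⟨k, rfl⟩ := hspan₁ w
    rw [map_smul] at hw
    rw [(smul_eq_zero.1 hw).resolve_right hv₂, zero_smul]
  have inj₃ : Function.Injective (c.toBaseH1 (P.incl.comp f)) := by
    refine (injective_iff_map_eq_zero _).2 fun w hw => ?_
    obtain ⟨k, rfl⟩ := hspan₁ w
    rw [map_smul] at hw
    rw [(smul_eq_zero.1 hw).resolve_right hv₃, zero_smul]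
  refine ⟨⟨(LinearEquiv.ofBijective (LinearMap.toSpanSingleton (QuotField (FreeH1 S x₀)) _ v)
    ⟨smul_left_injective _ hv, fun w => ?_⟩).symm⟩, ⟨inj₂, fun w => ?_⟩, inj₃, ?_⟩
  · obtain ⟨k, hk⟩ := hspan₁ w
    exact ⟨k, hk.symm⟩
  · obtain ⟨k, hk⟩ := hspan₂ w
    exact ⟨k • v, (map_smul _ _ _).trans hk.symm⟩
  · ext y
    constructor
    · rintro ⟨w, rfl⟩
      obtain ⟨k, rfl⟩ := hspan₁ w
      exact ⟨k • c.mapH1 P.incl f v, by rw [map_smul, map_smul, hcomp]⟩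
    · rintro ⟨w, rfl⟩
      obtain ⟨k, rfl⟩ := hspan₂ w
      exact ⟨k • v, by rw [map_smul, map_smul, hcomp]⟩
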